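/- Let $K$ be a non-archimedean local field of characteristic $0$ with finite residue field, let $\bar K$ be an algebraic closure of $K$, $G=\mathrm{Gal}(\bar K/K)$, and let $K_{ur}\subset\bar K$ be the maximal unramified extension of $K$. Let $\mathfrak w\subset \mathrm{Gal}(K_{ur}/K)$ be the subgroup of integral powers of the Frobenius automorphism. The Weil group $W$ of $K$ is the preimage of $\mathfrak w$ under $G\to\mathrm{Gal}(K_{ur}/K)$, with the group topology for which the inertia group $I=\mathrm{Gal}(\bar K/K_{ur})$, with its profinite topology, is an open subgroup. A discrete $G$-module $M$ is an abelian group with the discrete topology and a continuous action of $G$; it is also a $W$-module through $W\to G$. Write $H^i(G,M)$ and $H^i(W,M)$ for the cohomology groups defined by continuous cochains. Let $M$ be a discrete $G$-module. The restriction maps $\mathrm{res}^i\colon H^i(G,M)\to H^i(W,M)$, which are functorial in $M$, have the following properties. (i) $\mathrm{res}^0\colon H^0(G,M)\to H^0(W,M)$ is an isomorphism. (ii) $\mathrm{res}^1$ is injective and its image is the torsion subgroup of $H^1(W,M)$, so that $H^1(G,M)\cong H^1(W,M)_{\mathrm{tors}}$. (iii) There is a short exact sequence, functorial in $M$, $$0\to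 H^1(W,M)\otimes_{\mathbf Z}\mathbf Q/\mathbf Z\to H^2(G,M)\xrightarrow{\ \mathrm{res}^2\ }H^2(W,M)\to 0.$$ (iv) $\mathrm{res}^i\colon H^i(G,M)\to H^i(W,M)$ is an isomorphism for all $i\ge 3$. -/

import Mathlib

open ValuativeRel TensorProduct CategoryTheory

universe u v w

noncomputable section

/-! ### The Weil group of a local field -/

section WeilGroup

variable (K : Type u) [Field K] [ValuativeRel K] (Kbar : Type v) [Field Kbar] [Algebra K Kbar]

/-- An intermediate field `E` of `Kbar / K` is a finite unramified extension of `K` if it is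
finite over `K` and its ring of integers is unramified over the ring of integers of `K`. -/
def IsFiniteUnramified (E : IntermediateField K Kbar) : Prop :=
  FiniteDimensional K E ∧ Algebra.FormallyUnramified 𝒪[K] (integralClosure 𝒪[K] E)

/-- The maximal unramified extension `K_ur` of `K` inside `Kbar`: the compositum of all finite
unramified extensions of `K` contained in `Kbar`. -/
def maximalUnramified : IntermediateField K Kbar :=
  ⨆ E : {E : IntermediateField K Kbar // IsFiniteUnramified K Kbar E}, E.1

variable {K Kbar} in
theorem IsFiniteUnramified.map {E : IntermediateField K Kbar} (hE : IsFiniteUnramified K Kbar E)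
    (σ : Kbar →ₐ[K] Kbar) : IsFiniteUnramified K Kbar (E.map σ) := by
  obtain ⟨h₁, h₂⟩ := hE
  let e : E ≃ₐ[K] E.map σ := IntermediateField.equivMap E σ
  exact ⟨e.toLinearEquiv.finiteDimensional,
    .of_equiv ((e.restrictScalars 𝒪[K]).mapIntegralClosure)⟩

instance normal_maximalUnramified [IsAlgClosure K Kbar] :
    Normal K (maximalUnramified K Kbar) := by
  have : Normal K Kbar := IsAlgClosure.normal K Kbar
  rw [IntermediateField.normal_iff_forall_map_le]
  intro σ
  rw [maximalUnramified, IntermediateField.map_iSup]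
  exact iSup_le fun E => le_iSup
    (fun E : {E : IntermediateField K Kbar // IsFiniteUnramified K Kbar E} => E.1)
    ⟨E.1.map σ, E.2.map σ⟩

variable [IsAlgClosure K Kbar]

/-- The quotient map `Gal(Kbar/K) → Gal(K_ur/K)`. -/
def galToUnramified : Gal(Kbar/K) →* Gal(maximalUnramified K Kbar/K) :=
  AlgEquiv.restrictNormalHom (maximalUnramified K Kbar)

variable {K Kbar} in
/-- `φ ∈ Gal(K_ur/K)` is the Frobenius automorphism if it induces the map `x ↦ x ^ q` on the
residue field of the ring of integers of `K_ur`, where `q` is the cardinality of the residue field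
of `K`. -/
def IsUnramifiedFrobenius (φ : Gal(maximalUnramified K Kbar/K)) : Prop :=
  ∀ Q : Ideal (integralClosure 𝒪[K] (maximalUnramified K Kbar)), Q.IsMaximal →
    (φ.restrictScalars 𝒪[K]).mapIntegralClosure.toAlgHom.IsArithFrobAt Q

/-- The subgroup `𝔴` of `Gal(K_ur/K)` consisting of the integral powers of the Frobenius. -/
def frobeniusPowers : Subgroup Gal(maximalUnramified K Kbar/K) :=
  Subgroup.closure {φ | IsUnramifiedFrobenius φ}

/-- The Weil group `W` of `K`: the pullback of `𝔴` under `Gal(Kbar/K) → Gal(K_ur/K)`. -/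
def WeilGroup : Type v := ↥((frobeniusPowers K Kbar).comap (galToUnramified K Kbar))

instance : Group (WeilGroup K Kbar) :=
  inferInstanceAs (Group ↥((frobeniusPowers K Kbar).comap (galToUnramified K Kbar)))

namespace WeilGroup

/-- The inclusion `W → G`. -/
def toGal : WeilGroup K Kbar →* Gal(Kbar/K) :=
  ((frobeniusPowers K Kbar).comap (galToUnramified K Kbar)).subtype

/-- The projection `W → 𝔴`. -/
def toFrobeniusPowers : WeilGroup K Kbar →* frobeniusPowers K Kbar :=
  (galToUnramified K Kbar).subgroupComap (frobeniusPowers K Kbar)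

/-- The topology of `W` as the fibre product of the profinite group `G` and the discrete group `𝔴`:
it is the group topology for which the inertia group `I = ker (W → 𝔴)`, with its
topology as a subgroup of `G`, is an open topological subgroup. -/
instance : TopologicalSpace (WeilGroup K Kbar) :=
  TopologicalSpace.induced (toGal K Kbar) (krullTopology K Kbar) ⊓
    TopologicalSpace.induced (toFrobeniusPowers K Kbar) ⊥

instance : IsTopologicalGroup (WeilGroup K Kbar) := by
  have h₁ := topologicalGroup_induced (toGal K Kbar)
  let _ : TopologicalSpace (frobeniusPowers K Kbar) := ⊥
  have _ : DiscreteTopology (frobeniusPowers K Kbar) := ⟨rfl⟩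
  have h₂ := topologicalGroup_induced (toFrobeniusPowers K Kbar)
  exact topologicalGroup_inf h₁ h₂

/-- The inclusion `W → G` as a continuous homomorphism. -/
def toGalCont : WeilGroup K Kbar →ₜ* Gal(Kbar/K) where
  toMonoidHom := toGal K Kbar
  continuous_toFun := continuous_iff_le_induced.2 inf_le_left

end WeilGroup

end WeilGroup

/-! ### Cohomology of discrete modules -/

section Cohomology

variable {Γ Δ : Type v} [Group Γ] [TopologicalSpace Γ] [IsTopologicalGroup Γ]
  [Group Δ] [TopologicalSpace Δ] [IsTopologicalGroup Δ]

/-- A `Γ`-module is discrete if it has the discrete topology and the action `Γ × M → M` is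
continuous. -/
def IsDiscreteModule (M : TopRep.{max v w} ℤ Γ) : Prop :=
  DiscreteTopology M ∧ Continuous fun p : Γ × M => M.ρ p.1 p.2

/-- The cohomology group `H^n(Γ, M)` (cohomology of the complex of continuous cochains). -/
def Coh (n : ℕ) (M : TopRep.{max v w} ℤ Γ) : Type (max v w) :=
  continuousCohomology.{0, v, w} n M

instance (n : ℕ) (M : TopRep.{max v w} ℤ Γ) : AddCommGroup (Coh.{v, w} n M) :=
  inferInstanceAs (AddCommGroup (continuousCohomology.{0, v, w} n M))

namespace Coh

/-- The homomorphism `H^n(Γ, M) → H^n(Γ, N)` induced by a homomorphism `M → N` of `Γ`-modules. -/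
def map (n : ℕ) {M N : TopRep.{max v w} ℤ Γ} (f : M ⟶ N) : Coh.{v, w} n M →+ Coh.{v, w} n N :=
  (ContinuousCohomology.map.{0, v, w} (ContinuousMonoidHom.id Γ) f n).hom.toLinearMap.toAddMonoidHom

/-- The restriction homomorphism `H^n(Γ, M) → H^n(Δ, M)` along a continuous homomorphism
`φ : Δ → Γ`, where `Δ` acts on `M` through `φ`. -/
def res (φ : Δ →ₜ* Γ) (n : ℕ) (M : TopRep.{max v w} ℤ Γ) :
    Coh.{v, w} n M →+ Coh.{v, w} n (TopRep.res (φ : Δ →* Γ) M) :=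
  (ContinuousCohomology.map.{0, v, w} φ (𝟙 _) n).hom.toLinearMap.toAddMonoidHom

end Coh

end Cohomology

/-- A discrete `G`-module `M` viewed as a `W`-module through `W → G`, as a functor of `M`. -/
abbrev weilRes (K : Type u) [Field K] [ValuativeRel K] (Kbar : Type v) [Field Kbar] [Algebra K Kbar]
    [IsAlgClosure K Kbar] : TopRep.{max v w} ℤ Gal(Kbar/K) ⥤ TopRep.{max v w} ℤ (WeilGroup K Kbar) :=
  TopRep.resFunctor (WeilGroup.toGalCont K Kbar : WeilGroup K Kbar →* Gal(Kbar/K))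

/-- The restriction homomorphism `H^n(G, M) → H^n(W, M)`. -/
def galoisToWeil (K : Type u) [Field K] [ValuativeRel K] (Kbar : Type v) [Field Kbar]
    [Algebra K Kbar] [IsAlgClosure K Kbar] (n : ℕ) (M : TopRep.{max v w} ℤ Gal(Kbar/K)) :
    Coh.{v, w} n M →+ Coh.{v, w} n ((weilRes K Kbar).obj M) :=
  Coh.res (WeilGroup.toGalCont K Kbar) n M

end

/-! Only a few features of `W → G` matter, and `DegreeDatum` collects them: `W` is dense in `G`, it
has a degree map onto ℤ whose reductions mod `m` extend to `G`, and `(g, z) ↦ kerPart g * gen ^ z`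
is a continuous `W`-equivariant map from `G × ℤ` to `W`.

Dimension shifting embeds `M` in `C = C(G, M)` with quotient `S = shift M`. Over `G` the module `C`
is acyclic. Over `W` it is nearly so: in the sequence `0 → C → coind C → coind C → 0`, where `coind
C` consists of the functions `ℤ → C` and the second map is the difference operator, `coind C` is
acyclic. Hence `H^i(W, C) = 0` for `i ≥ 2`, and `V = H^1(W, C)` is the cokernel of the difference
operator on the invariants of `coind C`. These are the periodic functions `ℤ → M`, so `V` is morally
`M ⊗ ℚ` (take the mean over a period); what is needed and proved is that `V` is uniquely divisible
(`nsmul_bijective`).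

Now compare the long exact sequences of `0 → M → C → S → 0` over `G` and `W`. By density `res^0` is
bijective, so `res^1` identifies `H^1(G, M)` with the kernel of `H^1(W, M) → V`. That kernel is the
whole torsion subgroup, because `V` is torsion-free and `H^1(G, M)` is torsion by averaging. Applied
to `S` this gives `H^2(G, M) = H^1(G, S) = H^1(W, S)_tors`. Let `L` be the image of `H^1(W, M)` in
`V`. Then `V / L` embeds in `H^1(W, S)` with quotient `H^2(W, M)`, and the torsion of `V / L` is `L
⊗ ℚ/ℤ = H^1(W, M) ⊗ ℚ/ℤ`, which is therefore the kernel of `res^2`. Surjectivity of `res^2` follows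
from the divisibility of `V` once `H^2(W, M)` is known to be torsion (`exists_nsmul_eq_zero_two`).
The same facts write `H^1(W, S)` as torsion plus divisible, so `H^1(W, S) ⊗ ℚ/ℤ = 0` and `res^2` is
bijective for `S`; this is degree three for `M`, and higher degrees follow by shifting.

For a local field, the powers of the Frobenius are dense in `Gal(K_ur/K)`, and the stabiliser of a
root of unity of order `q ^ m - 1` meets them exactly in the multiples of `m`. A lift of the
Frobenius to `G` topologically generates a closed subgroup isomorphic to the profinite completion of
ℤ, which splits `G` over inertia and supplies `kerPart` (`exists_degreeDatum`). -/

noncomputable section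

/-! ### Homology classes in a complex of topological modules, represented by elements of kernels. -/

section Homology

open Limits

variable {k : Type*} [Ring k] [TopologicalSpace k] (C : CochainComplex (TopModuleCat k) ℕ)

/-- The identification of the kernel of the differential with the cycles. -/
def kerIsoCycles (n : ℕ) : TopModuleCat.ker (C.d n (n + 1)) ≅ C.cycles n :=
  (TopModuleCat.isLimitKer (C.d n (n + 1))).conePointUniqueUpToIso
    (C.cyclesIsKernel n (n + 1) (by simp))

theorem kerIsoCycles_hom_iCycles (n : ℕ) :
    (kerIsoCycles C n).hom ≫ C.iCycles n = TopModuleCat.kerι (C.d n (n + 1)) :=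
  IsLimit.conePointUniqueUpToIso_hom_comp (TopModuleCat.isLimitKer (C.d n (n + 1)))
    (C.cyclesIsKernel n (n + 1) (by simp)) WalkingParallelPair.zero

/-- The class in homology of a cocycle, as a morphism from the kernel of the differential. -/
def cocycleClass (n : ℕ) : TopModuleCat.ker (C.d n (n + 1)) ⟶ C.homology n :=
  (kerIsoCycles C n).hom ≫ C.homologyπ n

theorem homologyπ_apply_eq_zero_iff {i j : ℕ} (h : (ComplexShape.up ℕ).prev j = i)
    (z : C.cycles j) : C.homologyπ j z = 0 ↔ ∃ y, C.toCycles i j y = z := by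
  let e := (C.homologyIsCokernel i j h).coconePointUniqueUpToIso
    (TopModuleCat.isColimitCoker (C.toCycles i j))
  have he : C.homologyπ j ≫ e.hom = TopModuleCat.cokerπ (C.toCycles i j) :=
    (C.homologyIsCokernel i j h).comp_coconePointUniqueUpToIso_hom _ WalkingParallelPair.one
  have hinj : Function.Injective e.hom :=
    Function.LeftInverse.injective (g := e.inv) fun x => by simp
  rw [← map_eq_zero_iff e.hom.hom.toLinearMap hinj]
  exact (ConcreteCategory.congr_hom he z).congr_left.trans (Submodule.Quotient.mk_eq_zero _)

theorem homologyπ_surjective (j : ℕ) : Function.Surjective (C.homologyπ j) := by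
  let e := (C.homologyIsCokernel _ j rfl).coconePointUniqueUpToIso
    (TopModuleCat.isColimitCoker (C.toCycles _ j))
  have he : C.homologyπ j = TopModuleCat.cokerπ (C.toCycles _ j) ≫ e.inv := by
    rw [Iso.eq_comp_inv]
    exact (C.homologyIsCokernel _ j rfl).comp_coconePointUniqueUpToIso_hom _ WalkingParallelPair.one
  intro x
  obtain ⟨y, hy⟩ := TopModuleCat.cokerπ_surjective (C.toCycles _ j) (e.hom x)
  refine ⟨y, ?_⟩
  rw [he]
  change e.inv (TopModuleCat.cokerπ (C.toCycles _ j) y) = x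
  erw [hy]
  simp

theorem cocycleClass_surjective (n : ℕ) : Function.Surjective (cocycleClass C n) := by
  intro x
  obtain ⟨y, rfl⟩ := homologyπ_surjective C n x
  exact ⟨(kerIsoCycles C n).inv y, by rw [cocycleClass, ← ConcreteCategory.comp_apply,
    Iso.inv_hom_id_assoc]⟩

theorem iCycles_injective (n : ℕ) : Function.Injective (C.iCycles n) := by
  have h : C.iCycles n = (kerIsoCycles C n).inv ≫ TopModuleCat.kerι _ := by
    rw [Iso.eq_inv_comp, kerIsoCycles_hom_iCycles]
  rw [h]
  exact Subtype.val_injective.comp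
    (Function.LeftInverse.injective (g := (kerIsoCycles C n).hom)
      (ConcreteCategory.congr_hom (kerIsoCycles C n).inv_hom_id))

theorem cocycleClass_eq_zero_iff {i n : ℕ} (h : (ComplexShape.up ℕ).prev n = i)
    (z : TopModuleCat.ker (C.d n (n + 1))) :
    cocycleClass C n z = 0 ↔ ∃ y, C.d i n y = z.1 := by
  rw [cocycleClass, ConcreteCategory.comp_apply, homologyπ_apply_eq_zero_iff C h]
  refine exists_congr fun y => ?_
  rw [← (iCycles_injective C n).eq_iff, ← ConcreteCategory.comp_apply, C.toCycles_i,
    ← ConcreteCategory.comp_apply, kerIsoCycles_hom_iCycles]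
  rfl

theorem cocycleClass_succ_eq_zero_iff (n : ℕ) (z : TopModuleCat.ker (C.d (n + 1) (n + 1 + 1))) :
    cocycleClass C (n + 1) z = 0 ↔ ∃ y, C.d n (n + 1) y = z.1 :=
  cocycleClass_eq_zero_iff C (CochainComplex.prev_nat_succ n) z

theorem cocycleClass_zero_eq_zero_iff (z : TopModuleCat.ker (C.d 0 (0 + 1))) :
    cocycleClass C 0 z = 0 ↔ z = 0 := by
  rw [cocycleClass_eq_zero_iff C CochainComplex.prev_nat_zero, C.shape 0 0 (by simp)]
  simp only [TopModuleCat.hom_zero_apply, exists_const]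
  exact ⟨fun h => Subtype.ext h.symm, fun h => by rw [h]; rfl⟩

variable {C}

theorem homologyMap_cocycleClass {D : CochainComplex (TopModuleCat k) ℕ} (f : C ⟶ D) (n : ℕ)
    (z : TopModuleCat.ker (C.d n (n + 1))) (z' : TopModuleCat.ker (D.d n (n + 1)))
    (h : f.f n z.1 = z'.1) :
    HomologicalComplex.homologyMap f n (cocycleClass C n z) = cocycleClass D n z' := by
  rw [cocycleClass, cocycleClass, ← ConcreteCategory.comp_apply, Category.assoc,
    HomologicalComplex.homologyπ_naturality, ConcreteCategory.comp_apply,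
    ConcreteCategory.comp_apply, ConcreteCategory.comp_apply]
  congr 1
  apply iCycles_injective D n
  simp only [← ConcreteCategory.comp_apply]
  rw [Category.assoc, HomologicalComplex.cyclesMap_i, ← Category.assoc, kerIsoCycles_hom_iCycles,
    kerIsoCycles_hom_iCycles]
  exact h

end Homology

/-! ### Continuous cohomology in terms of homogeneous cocycles -/

namespace Coh

open TopRep ContRepresentation

variable {Γ Δ : Type v} [Group Γ] [TopologicalSpace Γ] [IsTopologicalGroup Γ]
  [Group Δ] [TopologicalSpace Δ] [IsTopologicalGroup Δ]

/-- The homogeneous cocycles of degree `n`. -/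
def cocycles (n : ℕ) (X : TopRep.{max v w} ℤ Γ) : AddSubgroup (resolutionX X (n + 1)) where
  -- The index is shifted by one: `resolutionX X 0` is `X` itself, so cochains of degree `n` live in
  -- `resolutionX X (n + 1)`.
  carrier := {F | (∀ g, (resolutionX X (n + 1)).ρ g F = F) ∧ d X (n + 1) F = 0}
  zero_mem' := ⟨fun g => map_zero _, map_zero _⟩
  add_mem' := fun hF hE => ⟨fun g => by rw [map_add, hF.1, hE.1],
    by rw [map_add, hF.2, hE.2, add_zero]⟩
  neg_mem' := fun hF => ⟨fun g => by rw [map_neg, hF.1], by rw [map_neg, hF.2, neg_zero]⟩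

variable {n : ℕ} {X : TopRep.{max v w} ℤ Γ} {Y : TopRep.{max v w} ℤ Δ}

/-- A cocycle as an element of the kernel of the differential. -/
def cocycles.toKer (n : ℕ) (X : TopRep.{max v w} ℤ Γ) :
    cocycles n X →+ TopModuleCat.ker ((homogeneousCochains X).d n (n + 1)) where
  toFun F := ⟨⟨F.1, F.2.1⟩,
    LinearMap.mem_ker.2 (Subtype.ext ((homogeneousCochains.d_apply X n _).trans F.2.2))⟩
  map_zero' := rfl
  map_add' _ _ := rfl

/-- The cohomology class of a cocycle. -/
def cls (n : ℕ) (X : TopRep.{max v w} ℤ Γ) : cocycles n X →+ Coh.{v, w} n X where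
  toFun F := cocycleClass (homogeneousCochains X) n (cocycles.toKer n X F)
  map_zero' := by rw [map_zero, map_zero]; rfl
  map_add' F E := by rw [map_add, map_add]; rfl

theorem cls_surjective : Function.Surjective (cls n X) := by
  intro x
  obtain ⟨z, rfl⟩ := cocycleClass_surjective _ n x
  refine ⟨⟨z.1.1, z.1.2, ?_⟩, rfl⟩
  have := congr_arg Subtype.val z.2
  exact (homogeneousCochains.d_apply X n _).symm.trans this

theorem cls_succ_eq_zero_iff (F : cocycles (n + 1) X) :
    cls (n + 1) X F = 0 ↔ ∃ E : resolutionX X (n + 1),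
      (∀ g, (resolutionX X (n + 1)).ρ g E = E) ∧ d X (n + 1) E = F := by
  refine (cocycleClass_succ_eq_zero_iff (homogeneousCochains X) n (cocycles.toKer
    (n + 1) X F)).trans
    ⟨fun ⟨y, hy⟩ => ⟨y.1, y.2, ?_⟩, fun ⟨E, hE, hE'⟩ => ⟨⟨E, hE⟩, Subtype.ext ?_⟩⟩
  · exact (homogeneousCochains.d_apply X n y).symm.trans (congr_arg Subtype.val hy)
  · exact (homogeneousCochains.d_apply X n _).trans hE'

theorem cls_zero_injective : Function.Injective (cls 0 X) := by
  rw [injective_iff_map_eq_zero]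
  intro F hF
  have := (cocycleClass_zero_eq_zero_iff (homogeneousCochains X) (cocycles.toKer 0 X F)).1 hF
  exact Subtype.ext (congr_arg (fun z => z.1.1) this)

/-- The map in cohomology induced by a continuous homomorphism `φ : Δ → Γ` and a morphism of
`Δ`-modules `X → Y`. -/
def pullback (φ : Δ →ₜ* Γ) (f : TopRep.res (φ : Δ →* Γ) X ⟶ Y) (n : ℕ) :
    Coh.{v, w} n X →+ Coh.{v, w} n Y :=
  (ContinuousCohomology.map.{0, v, w} φ f n).hom.toLinearMap.toAddMonoidHom

/-- The map on cocycles inducing `Coh.pullback`. -/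
def pullbackCocycle (φ : Δ →ₜ* Γ) (f : TopRep.res (φ : Δ →* Γ) X ⟶ Y) (F : cocycles n X) :
    cocycles n Y :=
  ⟨ContinuousCohomology.resolutionMap φ f (n + 1) F.1, fun g => by
    rw [← hom_comm_apply]
    exact congr_arg _ (F.2.1 (φ g)), by
    rw [← TopRep.comp_apply, ContinuousCohomology.resolutionMap_comp_d, TopRep.comp_apply]
    exact (congr_arg _ F.2.2).trans (map_zero _)⟩

theorem pullback_cls (φ : Δ →ₜ* Γ) (f : TopRep.res (φ : Δ →* Γ) X ⟶ Y) (F : cocycles n X) :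
    pullback φ f n (cls n X F) = cls n Y (pullbackCocycle φ f F) :=
  homologyMap_cocycleClass (ContinuousCohomology.cochainsMap φ f) n (cocycles.toKer n X F)
    (cocycles.toKer n Y (pullbackCocycle φ f F)) rfl

end Coh

/-! ### The long exact sequence of a topologically split short exact sequence -/

namespace Coh

open TopRep ContRepresentation

section Level

variable {Γ Δ : Type v} [Group Γ] [TopologicalSpace Γ] [IsTopologicalGroup Γ]
  [Group Δ] [TopologicalSpace Δ] [IsTopologicalGroup Δ]
  {X : TopRep.{max v w} ℤ Γ} {Y : TopRep.{max v w} ℤ Δ}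

/-- The action of `Γ` on a module is jointly continuous. -/
def HasContinuousAction (X : TopRep.{max v w} ℤ Γ) : Prop :=
  Continuous fun p : Γ × X => X.ρ p.1 p.2

/-- Local compactness makes evaluation `C(Γ, X) × Γ → X` jointly continuous, and the translation
action is built from evaluation and the action on values. -/
theorem HasContinuousAction.resolutionX [LocallyCompactSpace Γ] (hX : HasContinuousAction.{v, w} X)
    (n : ℕ) : HasContinuousAction.{v, w} (resolutionX X n) := by
  induction n with
  | zero => exact hX
  | succ n ih =>
    refine ContinuousMap.continuous_of_continuous_uncurry _ ?_
    have h : Continuous fun q : (Γ × C(Γ, TopRep.resolutionX X n)) × Γ =>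
        (q.1.1, q.1.2 (q.1.1⁻¹ * q.2)) :=
      (continuous_fst.comp continuous_fst).prodMk (ContinuousEval.continuous_eval.comp
        ((continuous_snd.comp continuous_fst).prodMk
          ((continuous_fst.comp continuous_fst).inv.mul continuous_snd)))
    exact ih.comp h

/-- The map induced on the terms of the standard resolutions. -/
def levelMap (φ : Δ →ₜ* Γ) (f : TopRep.res (φ : Δ →* Γ) X ⟶ Y) (n : ℕ) :
    resolutionX X n →+ resolutionX Y n where
  toFun F := ContinuousCohomology.resolutionMap φ f n F
  map_zero' := map_zero _
  map_add' _ _ := map_add _ _ _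

variable (φ : Δ →ₜ* Γ) (f : TopRep.res (φ : Δ →* Γ) X ⟶ Y)

theorem levelMap_ρ (n : ℕ) (g : Δ) (F : resolutionX X n) :
    levelMap φ f n ((resolutionX X n).ρ (φ g) F) = (resolutionX Y n).ρ g (levelMap φ f n F) :=
  hom_comm_apply (ContinuousCohomology.resolutionMap φ f n) g F

theorem d_levelMap (n : ℕ) (F : resolutionX X n) :
    d Y n (levelMap φ f n F) = levelMap φ f (n + 1) (d X n F) :=
  congr($(ContinuousCohomology.resolutionMap_comp_d φ f n) F)

theorem d_ρ (n : ℕ) (g : Γ) (F : resolutionX X n) :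
    d X n ((resolutionX X n).ρ g F) = (resolutionX X (n + 1)).ρ g (d X n F) :=
  hom_comm_apply (d X n) g F

theorem d_d (n : ℕ) (F : resolutionX X n) : d X (n + 1) (d X n F) = 0 :=
  congr($(d_comp_d X n) F)

/-- The coboundary of an invariant cochain. -/
def coboundary (n : ℕ) (E : resolutionX X (n + 1))
    (hE : ∀ g, (resolutionX X (n + 1)).ρ g E = E) : cocycles (n + 1) X :=
  ⟨d X (n + 1) E, fun g => by rw [← d_ρ, hE], d_d _ _⟩

theorem cls_coboundary (n : ℕ) (E : resolutionX X (n + 1))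
    (hE : ∀ g, (resolutionX X (n + 1)).ρ g E = E) :
    cls (n + 1) X (coboundary n E hE) = 0 :=
  (cls_succ_eq_zero_iff _).2 ⟨E, hE, rfl⟩

end Level

variable {Γ : Type v} [Group Γ] [TopologicalSpace Γ] [IsTopologicalGroup Γ]
  {A B C : TopRep.{max v w} ℤ Γ}

/-- The map on the terms of the standard resolutions induced by a morphism of modules. -/
def level (f : A ⟶ B) (n : ℕ) : resolutionX A n →+ resolutionX B n :=
  levelMap (ContinuousMonoidHom.id Γ) f n

theorem level_ρ (f : A ⟶ B) (n : ℕ) (g : Γ) (F : resolutionX A n) :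
    level f n ((resolutionX A n).ρ g F) = (resolutionX B n).ρ g (level f n F) :=
  levelMap_ρ (ContinuousMonoidHom.id Γ) f n g F

theorem d_level (f : A ⟶ B) (n : ℕ) (F : resolutionX A n) :
    d B n (level f n F) = level f (n + 1) (d A n F) :=
  d_levelMap (ContinuousMonoidHom.id Γ) f n F

/-- The map on cocycles inducing `Coh.map`. -/
def mapCocycle (f : A ⟶ B) {n : ℕ} (F : cocycles n A) : cocycles n B :=
  ⟨level f (n + 1) F, fun g => by rw [← level_ρ, F.2.1], by rw [d_level, F.2.2, map_zero]⟩

theorem map_cls (f : A ⟶ B) {n : ℕ} (F : cocycles n A) :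
    map n f (cls n A F) = cls n B (mapCocycle f F) :=
  pullback_cls (ContinuousMonoidHom.id Γ) f F

/-- A short exact sequence of modules with jointly continuous action that splits as a sequence of
topological spaces. -/
structure TopSplitExact (f : A ⟶ B) (g : B ⟶ C) : Prop where
  continuousAction : HasContinuousAction.{v, w} B
  -- The retraction and the section need only be continuous: they are applied to the values of
  -- cochains, and equivariance is recovered separately.
  exists_splitting : ∃ (r : C(B, A)) (s : C(C, B)), (∀ a, r (f a) = a) ∧ (∀ c, g (s c) = c) ∧
    (∀ a, g (f a) = 0) ∧ ∀ b, g b = 0 → f (r b) = b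

/-- The relation underlying the connecting homomorphism. -/
def connecting (f : A ⟶ B) (g : B ⟶ C) (n : ℕ) : AddSubgroup (Coh.{v, w} n C × Coh.{v, w}
    (n + 1) A) where
  carrier := {p | ∃ (F : cocycles n C) (E : resolutionX B (n + 1)) (D : cocycles (n + 1) A),
    (∀ x, (resolutionX B (n + 1)).ρ x E = E) ∧ level g (n + 1) E = F ∧
    level f (n + 1 + 1) D = d B (n + 1) E ∧ cls n C F = p.1 ∧ cls (n + 1) A D = p.2}
  zero_mem' := ⟨0, 0, 0, fun _ => map_zero _, map_zero _, by simp, map_zero _, map_zero _⟩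
  add_mem' := by
    rintro p q ⟨F, E, D, h₁, h₂, h₃, h₄, h₅⟩ ⟨F', E', D', h₁', h₂', h₃', h₄', h₅'⟩
    refine ⟨F + F', E + E', D + D', fun x => ?_, ?_, ?_, ?_, ?_⟩
    · rw [map_add, h₁, h₁']
    · rw [map_add, h₂, h₂', AddSubgroup.coe_add]
    · rw [AddSubgroup.coe_add, map_add, h₃, h₃', map_add]
    · rw [map_add, h₄, h₄', Prod.fst_add]
    · rw [map_add, h₅, h₅', Prod.snd_add]
  neg_mem' := by
    rintro p ⟨F, E, D, h₁, h₂, h₃, h₄, h₅⟩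
    refine ⟨-F, -E, -D, fun x => ?_, ?_, ?_, ?_, ?_⟩
    · rw [map_neg, h₁]
    · rw [map_neg, h₂, AddSubgroup.coe_neg]
    · rw [AddSubgroup.coe_neg, map_neg, h₃, map_neg]
    · rw [map_neg, h₄, Prod.fst_neg]
    · rw [map_neg, h₅, Prod.snd_neg]

namespace TopSplitExact

variable {f : A ⟶ B} {g : B ⟶ C} (h : TopSplitExact.{v, w} f g)
include h

theorem exists_splitting_level (n : ℕ) :
    ∃ (r : C(resolutionX B n, resolutionX A n)) (s : C(resolutionX C n, resolutionX B n)),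
      (∀ a, r (level f n a) = a) ∧ (∀ c, level g n (s c) = c) ∧
      (∀ a, level g n (level f n a) = 0) ∧ ∀ b, level g n b = 0 → level f n (r b) = b := by
  induction n with
  | zero => exact h.exists_splitting
  | succ n ih =>
    obtain ⟨r, s, h₁, h₂, h₃, h₄⟩ := ih
    refine ⟨⟨fun F => r.comp F, r.continuous_postcomp⟩, ⟨fun F => s.comp F, s.continuous_postcomp⟩,
      fun a => ContinuousMap.ext fun x => h₁ _, fun a => ContinuousMap.ext fun x => h₂ _,
      fun a => ContinuousMap.ext fun x => h₃ _, fun b hb => ContinuousMap.ext fun x => h₄ _ ?_⟩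
    exact congr($hb x)

theorem level_injective (n : ℕ) : Function.Injective (level f n) := by
  obtain ⟨r, -, hr, -⟩ := h.exists_splitting_level n
  exact Function.LeftInverse.injective hr

theorem level_comp (n : ℕ) (a : resolutionX A n) : level g n (level f n a) = 0 := by
  obtain ⟨_, _, _, _, h', _⟩ := h.exists_splitting_level n
  exact h' a

theorem exists_level_eq (n : ℕ) (b : resolutionX B n) (hb : level g n b = 0)
    (hb' : ∀ x, (resolutionX B n).ρ x b = b) :
    ∃ a, level f n a = b ∧ ∀ x, (resolutionX A n).ρ x a = a := by
  obtain ⟨r, _, _, _, _, hr⟩ := h.exists_splitting_level n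
  refine ⟨r b, hr b hb, fun x => h.level_injective n ?_⟩
  rw [level_ρ, hr b hb, hb']

/-- An invariant `c` satisfies `c x = ρ x (c 1)`, so it suffices to lift the single value `c 1` and
spread it by the action. Joint continuity of the action makes the result a continuous cochain. -/
theorem exists_lift [LocallyCompactSpace Γ] (n : ℕ) (c : resolutionX C (n + 1))
    (hc : ∀ x, (resolutionX C (n + 1)).ρ x c = c) :
    ∃ b, level g (n + 1) b = c ∧ ∀ x, (resolutionX B (n + 1)).ρ x b = b := by
  obtain ⟨_, s, _, hs, _⟩ := h.exists_splitting_level n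
  have hcont : Continuous fun x : Γ => (resolutionX B n).ρ x (s (c 1)) :=
    (h.continuousAction.resolutionX n).comp (continuous_id.prodMk continuous_const)
  refine ⟨(⟨_, hcont⟩ : C(Γ, resolutionX B n)), ContinuousMap.ext fun x => ?_, fun x =>
    ContinuousMap.ext fun y => ?_⟩
  · have h₁ : (resolutionX C n).ρ x (c (x⁻¹ * x)) = c x := congr($(hc x) x)
    rw [inv_mul_cancel] at h₁
    refine (level_ρ g n x (s (c 1))).trans ?_
    rw [hs, h₁]
  · change (resolutionX B n).ρ x ((resolutionX B n).ρ (x⁻¹ * y) (s (c 1))) =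
      (resolutionX B n).ρ y (s (c 1))
    rw [← mul_apply_eq_comp, ← map_mul, mul_inv_cancel_left]

theorem exists_cocycle_of_lift (n : ℕ) (E : resolutionX B (n + 1))
    (hE : ∀ x, (resolutionX B (n + 1)).ρ x E = E) (hd : d C (n + 1) (level g (n + 1) E) = 0) :
    ∃ D : cocycles (n + 1) A, level f (n + 1 + 1) D = d B (n + 1) E := by
  obtain ⟨D, hD, hD'⟩ := h.exists_level_eq (n + 1 + 1) (d B (n + 1) E)
    ((d_level g (n + 1) E).symm.trans hd)
    (fun x => by rw [← d_ρ, hE])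
  refine ⟨⟨D, hD', h.level_injective _ ?_⟩, hD⟩
  rw [map_zero]
  refine (d_level f _ D).symm.trans ?_
  rw [hD, d_d]

theorem exists_connecting [LocallyCompactSpace Γ] (n : ℕ) (x : Coh.{v, w} n C) :
    ∃ y, (x, y) ∈ connecting f g n := by
  obtain ⟨F, rfl⟩ := cls_surjective x
  obtain ⟨E, hE, hE'⟩ := h.exists_lift n F F.2.1
  obtain ⟨D, hD⟩ := h.exists_cocycle_of_lift n E hE' (by rw [hE]; exact F.2.2)
  exact ⟨_, F, E, D, hE', hE, hD, rfl, rfl⟩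

/-- An invariant cochain of the middle term that maps to a coboundary differs from a cochain of the
left term by a coboundary. -/
theorem exists_sub_coboundary [LocallyCompactSpace Γ] (n : ℕ) (F : cocycles n C)
    (hF : cls n C F = 0) (E : resolutionX B (n + 1))
    (hE : ∀ x, (resolutionX B (n + 1)).ρ x E = E) (hEF : level g (n + 1) E = F) :
    ∃ (E' : cocycles n B) (D : resolutionX A (n + 1)), cls n B E' = 0 ∧
      (∀ x, (resolutionX A (n + 1)).ρ x D = D) ∧ level f (n + 1) D = E - E' := by
  obtain ⟨E', hE', hEE'⟩ : ∃ E' : cocycles n B, cls n B E' = 0 ∧ level g (n + 1) E' = F := by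
    cases n with
    | zero =>
      obtain rfl : F = 0 := cls_zero_injective (hF.trans (map_zero _).symm)
      exact ⟨0, map_zero _, map_zero _⟩
    | succ n =>
      obtain ⟨F', hF', hF''⟩ := (cls_succ_eq_zero_iff F).1 hF
      obtain ⟨E', hE', hE''⟩ := h.exists_lift n F' hF'
      refine ⟨coboundary n E' hE'', cls_coboundary n E' hE'', ?_⟩
      refine (d_level g _ E').symm.trans ?_
      rw [← hF'', ← hE']
  obtain ⟨D, hD, hD'⟩ := h.exists_level_eq (n + 1) (E - E') (by rw [map_sub, hEF, hEE', sub_self])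
    (fun x => by rw [map_sub, hE, E'.2.1])
  exact ⟨E', D, hE', hD', hD⟩

/-- This is the independence of choices that turns the relation `connecting` into a homomorphism. -/
theorem connecting_zero [LocallyCompactSpace Γ] (n : ℕ) (y : Coh.{v, w} (n + 1) A)
    (hy : (0, y) ∈ connecting f g n) : y = 0 := by
  obtain ⟨F, E, D, h₁, h₂, h₃, h₄, rfl⟩ := hy
  obtain ⟨E', D', hE', hD', hDE⟩ := h.exists_sub_coboundary n F h₄ E h₁ h₂
  refine (cls_succ_eq_zero_iff D).2 ⟨D', hD', h.level_injective _ ?_⟩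
  rw [h₃]
  refine (d_level f _ D').symm.trans ?_
  rw [hDE, map_sub, E'.2.2, sub_zero]

variable [LocallyCompactSpace Γ]

/-- The connecting homomorphism. -/
def δ (n : ℕ) : Coh.{v, w} n C →+ Coh.{v, w} (n + 1) A :=
  AddMonoidHom.mk' (fun x => (h.exists_connecting n x).choose) fun x y => by
    have hx := (h.exists_connecting n x).choose_spec
    have hy := (h.exists_connecting n y).choose_spec
    have hxy := (h.exists_connecting n (x + y)).choose_spec
    have := sub_mem hxy (add_mem hx hy)
    simp only [Prod.mk_add_mk, Prod.mk_sub_mk, sub_self] at this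
    exact sub_eq_zero.1 (h.connecting_zero n _ this)

theorem mem_connecting (n : ℕ) (x : Coh.{v, w} n C) : (x, h.δ n x) ∈ connecting f g n :=
  (h.exists_connecting n x).choose_spec

theorem δ_eq_of_mem {n : ℕ} {x : Coh.{v, w} n C} {y : Coh.{v, w} (n + 1) A}
    (hxy : (x, y) ∈ connecting f g n) : h.δ n x = y := by
  have := sub_mem (h.mem_connecting n x) hxy
  simp only [Prod.mk_sub_mk, sub_self] at this
  exact sub_eq_zero.1 (h.connecting_zero n _ this)

theorem exact₁ (n : ℕ) : Function.Exact (h.δ n) (map (n + 1) f) := by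
  intro y
  constructor
  · intro hy
    obtain ⟨D, rfl⟩ := cls_surjective y
    rw [map_cls] at hy
    obtain ⟨E, hE, hE'⟩ := (cls_succ_eq_zero_iff _).1 hy
    refine ⟨cls n C ⟨level g (n + 1) E, fun x => by rw [← level_ρ, hE], ?_⟩,
      h.δ_eq_of_mem ⟨_, E, D, hE, rfl, hE'.symm, rfl, rfl⟩⟩
    refine (d_level g _ E).trans ?_
    rw [hE']
    exact h.level_comp _ _
  · rintro ⟨x, rfl⟩
    obtain ⟨F, E, D, h₁, h₂, h₃, h₄, h₅⟩ := h.mem_connecting n x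
    dsimp only at h₅
    rw [← h₅, map_cls]
    exact (cls_succ_eq_zero_iff _).2 ⟨E, h₁, h₃.symm⟩

theorem exact₃ (n : ℕ) : Function.Exact (map n g) (h.δ n) := by
  intro x
  constructor
  · intro hx
    obtain ⟨F, E, D, h₁, h₂, h₃, h₄, h₅⟩ := h.mem_connecting n x
    dsimp only at h₄ h₅
    rw [hx] at h₅
    obtain ⟨D', hD', hD''⟩ := (cls_succ_eq_zero_iff _).1 h₅
    refine ⟨cls n B ⟨E - level f (n + 1) D', fun x => by rw [map_sub, h₁, ← level_ρ, hD'], ?_⟩, ?_⟩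
    · rw [map_sub, ← h₃, ← hD'']
      exact sub_eq_zero.2 (d_level f _ D').symm
    · rw [map_cls, ← h₄]
      congr 1
      refine Subtype.ext ?_
      change level g (n + 1) (E - level f (n + 1) D') = F
      rw [map_sub, h.level_comp, h₂, sub_zero]
  · rintro ⟨y, rfl⟩
    obtain ⟨E, rfl⟩ := cls_surjective y
    rw [map_cls]
    exact h.δ_eq_of_mem ⟨_, E.1, 0, E.2.1, rfl, (map_zero _).trans E.2.2.symm, rfl, map_zero _⟩

theorem exact₂ (n : ℕ) : Function.Exact (map n f) (map n g) := by
  intro x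
  constructor
  · intro hx
    obtain ⟨E, rfl⟩ := cls_surjective x
    rw [map_cls] at hx
    obtain ⟨E', D, hE', hD, hDE⟩ := h.exists_sub_coboundary n _ hx E.1 E.2.1 rfl
    refine ⟨cls n A ⟨D, hD, h.level_injective _ ?_⟩, ?_⟩
    · refine (d_level f _ D).symm.trans ?_
      rw [hDE, map_sub, E.2.2, E'.2.2, sub_zero, map_zero]
    · rw [map_cls]
      have : cls n B (E - E') = cls n B E := by rw [map_sub, hE', sub_zero]
      rw [← this]
      congr 1
      exact Subtype.ext hDE
  · rintro ⟨y, rfl⟩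
    obtain ⟨D, rfl⟩ := cls_surjective y
    rw [map_cls, map_cls, ← map_zero (cls n C)]
    congr 1
    exact Subtype.ext (h.level_comp _ _)

-- Allowing a change of group as well as of coefficients covers two uses at once: compatibility with
-- restriction to `W`, and functoriality in the module.
omit h in
theorem δ_naturality {Δ : Type v} [Group Δ] [TopologicalSpace Δ] [IsTopologicalGroup Δ]
    [LocallyCompactSpace Δ] (φ : Δ →ₜ* Γ) {A' B' C' : TopRep.{max v w} ℤ Δ} {f' : A' ⟶ B'}
    {g' : B' ⟶ C'} (h : TopSplitExact.{v, w} f g) (h' : TopSplitExact.{v, w} f' g')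
    (a : TopRep.res (φ : Δ →* Γ) A ⟶ A') (b : TopRep.res (φ : Δ →* Γ) B ⟶ B')
    (c : TopRep.res (φ : Δ →* Γ) C ⟶ C') (hf : ∀ x : A, b (f x) = f' (a x))
    (hg : ∀ x : B, c (g x) = g' (b x)) (n : ℕ) (x : Coh.{v, w} n C) :
    pullback φ a (n + 1) (h.δ n x) = h'.δ n (pullback φ c n x) := by
  have hf' : ∀ n (x : resolutionX A n), levelMap φ b n (level f n x) =
      level f' n (levelMap φ a n x) := by
    intro n
    induction n with
    | zero => exact hf
    | succ n ih => exact fun F => ContinuousMap.ext fun x => ih _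
  have hg' : ∀ n (x : resolutionX B n), levelMap φ c n (level g n x) =
      level g' n (levelMap φ b n x) := by
    intro n
    induction n with
    | zero => exact hg
    | succ n ih => exact fun F => ContinuousMap.ext fun x => ih _
  obtain ⟨F, E, D, h₁, h₂, h₃, h₄, h₅⟩ := h.mem_connecting n x
  dsimp only at h₄ h₅
  rw [← h₅, ← h₄, pullback_cls, pullback_cls]
  symm
  refine h'.δ_eq_of_mem ⟨_, levelMap φ b (n + 1) E, _, fun x => ?_, ?_, ?_, rfl, rfl⟩
  · rw [← levelMap_ρ, h₁]
  · rw [← hg', h₂]; rfl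
  · rw [d_levelMap, ← h₃, hf']; rfl

end TopSplitExact

end Coh

/-! ### Dimension shifting -/

namespace Coh

open TopRep ContRepresentation

variable {Γ : Type v} [Group Γ] [TopologicalSpace Γ] [IsTopologicalGroup Γ]

/-- A morphism of topological representations from a continuous equivariant linear map. -/
def homOfLinear {k : Type*} [Ring k] [TopologicalSpace k] {X Y : TopRep k Γ} (f : X →+ Y)
    (hf : Continuous f) (h : ∀ (g : Γ) (x : X), f (X.ρ g x) = Y.ρ g (f x))
    (hs : ∀ (c : k) (x : X), f (c • x) = c • f x) : X ⟶ Y :=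
  TopRep.ofHom
    { toFun := f
      map_add' := f.map_add
      map_smul' := hs
      cont := hf
      isIntertwining' := fun g => ContinuousLinearMap.ext (h g) }

/-- A morphism of modules from a continuous equivariant additive map. -/
def homMk {X Y : TopRep.{max v w} ℤ Γ} (f : X →+ Y) (hf : Continuous f)
    (h : ∀ (g : Γ) (x : X), f (X.ρ g x) = Y.ρ g (f x)) : X ⟶ Y :=
  homOfLinear f hf h fun c x =>
    (congr_arg f (int_smul_eq_zsmul X.hV2 c x)).trans
      ((map_zsmul f c x).trans (int_smul_eq_zsmul Y.hV2 c (f x)).symm)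

omit [TopologicalSpace Γ] [IsTopologicalGroup Γ] in
theorem continuous_ρ {k : Type*} [Ring k] [TopologicalSpace k] (X : TopRep k Γ) (g : Γ) :
    Continuous (X.ρ g) :=
  (X.ρ g).cont

omit [TopologicalSpace Γ] [IsTopologicalGroup Γ] in
theorem continuous_hom {k : Type*} [Ring k] [TopologicalSpace k] {X Y : TopRep k Γ} (f : X ⟶ Y) :
    Continuous f :=
  f.hom.cont

/-- The action of a group element as an additive map. -/
def ρAddHom (X : TopRep.{max v w} ℤ Γ) (g : Γ) : X →+ X where
  toFun := X.ρ g
  map_zero' := map_zero _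
  map_add' := map_add _

/-- A module over `Γ` from an action of `Γ` by continuous additive maps. -/
def repMk (V : Type max v w) [AddCommGroup V] [TopologicalSpace V] [IsTopologicalAddGroup V]
    (ρ : Γ → V →+ V) (hρ : ∀ g, Continuous (ρ g)) (h₁ : ∀ x, ρ 1 x = x)
    (h₂ : ∀ g h x, ρ (g * h) x = ρ g (ρ h x)) : TopRep.{max v w} ℤ Γ :=
  TopRep.of (ContRepresentation.ofMonoidHom
    { toFun := fun g =>
        { toFun := ρ g
          map_add' := map_add _
          map_smul' := fun c x => map_zsmul (ρ g) c x
          cont := hρ g }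
      map_one' := ContinuousLinearMap.ext h₁
      map_mul' := fun g h => ContinuousLinearMap.ext (h₂ g h) })

/-- The subgroup of invariant elements of a module. -/
def invariants (X : TopRep.{max v w} ℤ Γ) : AddSubgroup X where
  carrier := {x | ∀ g, X.ρ g x = x}
  zero_mem' _ := map_zero _
  add_mem' h₁ h₂ g := by rw [map_add, h₁, h₂]
  neg_mem' h g := by rw [map_neg, h]

section Contraction

variable {X : TopRep.{max v w} ℤ Γ}

/-- The contracting homotopy of the standard resolution attached to a retraction of
`X → C(Γ, X)`. -/
def contraction (s : X.coind₁ ⟶ X) : (n : ℕ) → (resolutionX X (n + 1) ⟶ resolutionX X n)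
  | 0 => s
  | n + 1 => -(coind₁Functor ℤ Γ).map (contraction s n)

/-- The differential is recursive, `(d F) x = F - d (F x)`; the sign in the recursion for
`contraction` is chosen so that the induction closes. -/
theorem contraction_d (s : X.coind₁ ⟶ X) (hs : ∀ x : X, s (ContinuousMap.const Γ x) = x) (n : ℕ)
    (F : resolutionX X (n + 1)) :
    contraction s (n + 1) (d X (n + 1) F) + d X n (contraction s n F) = F := by
  induction n with
  | zero =>
    refine ContinuousMap.ext fun x => ?_
    change -(s (F - ContinuousMap.const Γ (F x))) + s F = F x
    rw [map_sub, hs]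
    abel
  | succ n ih =>
    refine ContinuousMap.ext fun x => ?_
    have hx := ih (F x)
    change -(contraction s (n + 1) (F - d X (n + 1) (F x))) +
      (contraction s (n + 1) F - d X n (-(contraction s n (F x)))) = F x
    rw [map_sub, map_neg]
    refine Eq.trans ?_ hx
    abel

/-- The contraction is equivariant, so it preserves invariant cochains and writes each cocycle as a
coboundary. This is the only acyclicity criterion used, both for `C(Γ, X)` and for the coinduced
module over `W`. -/
theorem eq_zero_of_retraction (s : X.coind₁ ⟶ X) (hs : ∀ x : X, s (ContinuousMap.const Γ x) = x)
    (n : ℕ) (x : Coh.{v, w} (n + 1) X) : x = 0 := by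
  obtain ⟨F, rfl⟩ := cls_surjective x
  refine (cls_succ_eq_zero_iff F).2 ⟨contraction s (n + 1) F, fun g => ?_, ?_⟩
  · rw [← hom_comm_apply, F.2.1]
  · have := contraction_d s hs (n + 1) F
    rwa [F.2.2, map_zero, zero_add] at this

end Contraction

section DegreeZero

variable {X : TopRep.{max v w} ℤ Γ}

/-- The class in `H^0` of an invariant element. -/
def invariantClass (X : TopRep.{max v w} ℤ Γ) : invariants X →+ Coh.{v, w} 0 X :=
  (cls 0 X).comp
    { toFun := fun x => ⟨ContinuousMap.const Γ x.1, fun g => ContinuousMap.ext fun _ => x.2 g,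
        ContinuousMap.ext fun _ => ContinuousMap.ext fun _ => sub_self x.1⟩
      map_zero' := rfl
      map_add' := fun _ _ => rfl }

theorem invariantClass_bijective : Function.Bijective (invariantClass.{v, w} X) := by
  constructor
  · intro x y hxy
    have := congr_arg Subtype.val (cls_zero_injective hxy)
    exact Subtype.ext congr($this 1)
  · intro x
    obtain ⟨F, rfl⟩ := cls_surjective x
    have h₁ (a b : Γ) : (F.1 : C(Γ, X)) a = (F.1 : C(Γ, X)) b := by
      have : (F.1 : C(Γ, X)) a - (F.1 : C(Γ, X)) b = 0 := congr($(F.2.2) b a)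
      exact sub_eq_zero.1 this
    have h₂ (g : Γ) : X.ρ g ((F.1 : C(Γ, X)) (g⁻¹ * 1)) = (F.1 : C(Γ, X)) 1 := congr($(F.2.1 g) 1)
    refine ⟨⟨(F.1 : C(Γ, X)) 1, fun g => ?_⟩, ?_⟩
    · exact (congr_arg (X.ρ g) (h₁ _ _)).trans (h₂ g)
    · refine congr_arg (cls 0 X) (Subtype.ext (ContinuousMap.ext fun y => h₁ _ _))

theorem pullback_invariantClass {Δ : Type v} [Group Δ] [TopologicalSpace Δ] [IsTopologicalGroup Δ]
    {Y : TopRep.{max v w} ℤ Δ} (φ : Δ →ₜ* Γ) (f : TopRep.res (φ : Δ →* Γ) X ⟶ Y)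
    (x : invariants X) (y : invariants Y) (h : f x.1 = y.1) :
    pullback φ f 0 (invariantClass X x) = invariantClass Y y := by
  rw [invariantClass, AddMonoidHom.comp_apply, pullback_cls]
  exact congr_arg (cls 0 Y) (Subtype.ext (ContinuousMap.ext fun _ => h))

theorem map_invariantClass {Y : TopRep.{max v w} ℤ Γ} (f : X ⟶ Y)
    (x : invariants X) (y : invariants Y) (h : f x.1 = y.1) :
    map 0 f (invariantClass X x) = invariantClass Y y :=
  pullback_invariantClass (ContinuousMonoidHom.id Γ) f x y h

end DegreeZero

section Shift

variable (X : TopRep.{max v w} ℤ Γ)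

/-- The functions on `Γ` that vanish at `1`. -/
def vanishing : AddSubgroup C(Γ, X) where
  carrier := {F | F 1 = 0}
  zero_mem' := rfl
  add_mem' h₁ h₂ := (congr_arg₂ _ h₁ h₂).trans (add_zero _)
  neg_mem' h := (congr_arg _ h).trans neg_zero

/-- The projection of `C(Γ, X)` onto the functions vanishing at `1`. -/
def toVanishing : C(Γ, X) →+ vanishing X where
  toFun F := ⟨F - ContinuousMap.const Γ (F 1), sub_self _⟩
  map_zero' := Subtype.ext (ContinuousMap.ext fun _ => sub_self _)
  map_add' _ _ := Subtype.ext (ContinuousMap.ext fun _ => add_sub_add_comm _ _ _ _)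

omit [IsTopologicalGroup Γ] in
theorem continuous_toVanishing : Continuous (toVanishing X) :=
  (continuous_id.sub (ContinuousMap.continuous_const'.comp (continuous_eval_const 1))).subtype_mk _

omit [IsTopologicalGroup Γ] in
theorem toVanishing_const (x : X) : toVanishing X (ContinuousMap.const Γ x) = 0 :=
  Subtype.ext (ContinuousMap.ext fun _ => sub_self _)

omit [IsTopologicalGroup Γ] in
theorem toVanishing_coe (F : vanishing X) : toVanishing X F.1 = F :=
  Subtype.ext (ContinuousMap.ext fun _ => (congr_arg _ F.2).trans (sub_zero _))

omit [IsTopologicalGroup Γ] in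
theorem coe_toVanishing (F : C(Γ, X)) :
    (toVanishing X F : C(Γ, X)) = F - ContinuousMap.const Γ (F 1) :=
  rfl

theorem coind₁_const (g : Γ) (x : X) :
    X.coind₁.ρ g (ContinuousMap.const Γ x) = ContinuousMap.const Γ (X.ρ g x) :=
  rfl

theorem toVanishing_coind₁_coe_toVanishing (g : Γ) (F : C(Γ, X)) :
    toVanishing X (X.coind₁.ρ g (toVanishing X F : C(Γ, X))) =
      toVanishing X (X.coind₁.ρ g F) := by
  rw [coe_toVanishing, map_sub, map_sub, coind₁_const, toVanishing_const, sub_zero]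

/-- The quotient of `C(Γ, X)` by the constant functions, realised as the module of functions
vanishing at `1`. -/
def shift : TopRep.{max v w} ℤ Γ :=
  repMk (vanishing X)
    (fun g => (toVanishing X).comp
      ((ρAddHom X.coind₁ g).comp (vanishing X).subtype))
    (fun g => (continuous_toVanishing X).comp
      (((continuous_ρ X.coind₁ g)).comp continuous_subtype_val))
    (fun F => (congr_arg (toVanishing X) congr($(map_one X.coind₁.ρ) F.1)).trans
      (toVanishing_coe X F))
    (fun g h F => (congr_arg (toVanishing X) congr($(map_mul X.coind₁.ρ g h) F.1)).trans
      (toVanishing_coind₁_coe_toVanishing X g (X.coind₁.ρ h F.1)).symm)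

/-- The projection `C(Γ, X) → shift X`. -/
def toShift : X.coind₁ ⟶ shift X :=
  homMk (toVanishing X) (continuous_toVanishing X)
    fun g F => (toVanishing_coind₁_coe_toVanishing X g F).symm

/-- The inclusion of `X` into `C(Γ, X)` as constant functions. -/
abbrev toCoind : X ⟶ X.coind₁ := d X 0

-- Realising the quotient by functions vanishing at `1` provides a continuous section for free,
-- namely the inclusion; evaluation at `1` is the retraction.
variable {X} in
theorem topSplitExact_shift [LocallyCompactSpace Γ] (hX : HasContinuousAction.{v, w} X) :
    TopSplitExact.{v, w} (toCoind X) (toShift X) where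
  continuousAction := hX.resolutionX 1
  exists_splitting := ⟨⟨fun F : C(Γ, X) => F 1, continuous_eval_const 1⟩,
    ⟨fun F : vanishing X => F.1, continuous_subtype_val⟩, fun x => rfl,
    fun F => toVanishing_coe X F, fun x => toVanishing_const X x, fun F hF => by
      have : (F : C(Γ, X)) - ContinuousMap.const Γ ((F : C(Γ, X)) 1) = 0 := congr_arg Subtype.val hF
      exact (sub_eq_zero.1 this).symm⟩

variable {X} in
/-- The diagonal retraction of `C(Γ, X) → C(Γ, C(Γ, X))`. -/
def diag [LocallyCompactSpace Γ] : X.coind₁.coind₁ ⟶ X.coind₁ :=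
  homMk (Y := X.coind₁)
    { toFun := fun F : C(Γ, C(Γ, X)) => (⟨fun x => F x x,
        ContinuousEval.continuous_eval.comp (F.continuous.prodMk continuous_id)⟩ : C(Γ, X))
      map_zero' := rfl
      map_add' := fun _ _ => rfl }
    (ContinuousMap.continuous_of_continuous_uncurry _ (by
      have h : Continuous fun p : C(Γ, C(Γ, X)) × Γ => (p.1 p.2, p.2) :=
        ContinuousEval.continuous_eval.prodMk continuous_snd
      exact ContinuousEval.continuous_eval.comp h))
    (fun g F => rfl)

theorem coind₁_eq_zero [LocallyCompactSpace Γ] (n : ℕ) (x : Coh.{v, w} (n + 1) X.coind₁) : x = 0 :=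
  eq_zero_of_retraction diag (fun _ => rfl) n x

end Shift

end Coh

/-! ### Dense subgroups with an infinite cyclic quotient -/

open TopRep ContRepresentation

/-- A group `W` mapping densely to a group `G`, together with a continuous degree map `W → ℤ` that
extends to the finite quotients `ℤ / m` of `ℤ` on `G`, and a splitting of the extension of
`G` determined by the degree, compatible with the splitting `n ↦ t ^ n` of the degree on `W`. -/
structure DegreeDatum (G W : Type v) [Group G] [TopologicalSpace G] [IsTopologicalGroup G]
    [Group W] [TopologicalSpace W] [IsTopologicalGroup W] where
  toGroup : W →ₜ* G
  denseRange : DenseRange toGroup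
  deg : W → ℤ
  deg_mul : ∀ a b, deg (a * b) = deg a + deg b
  continuous_deg : Continuous deg
  gen : W
  deg_gen : deg gen = 1
  kerPart : C(G, W)
  -- Equivalently, `(g, z) ↦ kerPart g * gen ^ z` commutes with left translation by `w`, acting on
  -- `G × ℤ` by `(g, z) ↦ (toGroup w * g, z + deg w)`.
  kerPart_mul : ∀ w g, kerPart (toGroup w * g) = w * kerPart g * gen ^ (-deg w)
  exists_extension : ∀ m : ℕ, m ≠ 0 → ∃ χ : G → ZMod m, IsLocallyConstant χ ∧
    (∀ a b, χ (a * b) = χ a + χ b) ∧ ∀ w, χ (toGroup w) = deg w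

namespace DegreeDatum

variable {G W : Type v} [Group G] [TopologicalSpace G] [IsTopologicalGroup G]
    [Group W] [TopologicalSpace W] [IsTopologicalGroup W] (D : DegreeDatum G W)

/-- The degree as a homomorphism. -/
def degHom : W →* Multiplicative ℤ where
  toFun w := .ofAdd (D.deg w)
  map_one' := by
    have := D.deg_mul 1 1
    rw [mul_one] at this
    exact congr_arg _ (by omega : D.deg 1 = 0)
  map_mul' a b := congr_arg _ (D.deg_mul a b)

theorem deg_one : D.deg 1 = 0 := D.degHom.map_one

theorem deg_inv (a : W) : D.deg a⁻¹ = -D.deg a := D.degHom.map_inv a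

theorem deg_gen_zpow (z : ℤ) : D.deg (D.gen ^ z) = z := by
  have := congr_arg Multiplicative.toAdd (map_zpow D.degHom D.gen z)
  rw [toAdd_zpow] at this
  change D.deg (D.gen ^ z) = z • D.deg D.gen at this
  rw [this, D.deg_gen, smul_eq_mul, mul_one]

section Induced

/-- The `W`-module of functions `ℤ → X`, coinduced from the restriction of `X` to the elements of
degree zero. -/
def coind (X : TopRep.{max v w} ℤ W) : TopRep.{max v w} ℤ W :=
  Coh.repMk.{v, w} (ℤ → X)
    (fun g => AddMonoidHom.mk' (fun f z => X.ρ g (f (z - D.deg g)))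
      fun f f' => funext fun z => map_add _ _ _)
    (fun g => continuous_pi fun z => (Coh.continuous_ρ X g).comp (continuous_apply _))
    (fun f => funext fun z => by
      change X.ρ 1 (f (z - D.deg 1)) = f z
      rw [D.deg_one, sub_zero, map_one]; rfl)
    (fun g h f => funext fun z => by
      change X.ρ (g * h) (f (z - D.deg (g * h))) = X.ρ g (X.ρ h (f (z - D.deg g - D.deg h)))
      rw [D.deg_mul, sub_sub, map_mul]; rfl)

variable {X Y Z : TopRep.{max v w} ℤ W}

theorem hasContinuousAction_coind (hX : Coh.HasContinuousAction.{v, w} X) :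
    Coh.HasContinuousAction.{v, w} (D.coind X) := by
  refine continuous_pi fun z => ?_
  have h₁ : Continuous fun p : ℤ × (ℤ → X) => p.2 p.1 :=
    continuous_prod_of_discrete_left.2 fun a => continuous_apply a
  have h₂ : Continuous fun p : W × (ℤ → X) => (p.1, p.2 (z - D.deg p.1)) :=
    continuous_fst.prodMk (h₁.comp
      ((continuous_const.sub (D.continuous_deg.comp continuous_fst)).prodMk continuous_snd))
  exact hX.comp h₂

/-- The functoriality of `coind`. -/
def coindMap (f : X ⟶ Y) : D.coind X ⟶ D.coind Y :=
  Coh.homMk (X := D.coind X) (Y := D.coind Y)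
    (AddMonoidHom.mk' (fun (x : ℤ → X) z => f (x z)) fun _ _ => funext fun _ => map_add _ _ _)
    (continuous_pi fun z => (Coh.continuous_hom f).comp (continuous_apply z))
    (fun g _ => funext fun _ => hom_comm_apply f g _)

theorem topSplitExact_coindMap {f : X ⟶ Y} {g : Y ⟶ Z} (h : Coh.TopSplitExact.{v, w} f g) :
    Coh.TopSplitExact.{v, w} (D.coindMap f) (D.coindMap g) := by
  refine ⟨D.hasContinuousAction_coind h.continuousAction, ?_⟩
  obtain ⟨r, s, h₁, h₂, h₃, h₄⟩ := h.exists_splitting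
  refine ⟨⟨fun (y : ℤ → Y) (z : ℤ) => r (y z),
      continuous_pi fun z => r.continuous.comp (continuous_apply z)⟩,
    ⟨fun (y : ℤ → Z) (z : ℤ) => s (y z),
      continuous_pi fun z => s.continuous.comp (continuous_apply z)⟩,
    fun _ => funext fun z => h₁ _, fun _ => funext fun z => h₂ _, fun _ => funext fun z => h₃ _,
    fun b hb => funext fun z => h₄ _ congr($hb z)⟩

/-- The inclusion of `X` as the constant functions. -/
def toCoind (X : TopRep.{max v w} ℤ W) : X ⟶ D.coind X :=
  Coh.homMk (Y := D.coind X)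
    (AddMonoidHom.mk' (fun x _ => x) fun _ _ => rfl)
    (continuous_pi fun _ => continuous_id)
    (fun _ _ => rfl)

/-- The difference operator on functions on `ℤ`. -/
def diff (X : TopRep.{max v w} ℤ W) : D.coind X ⟶ D.coind X :=
  Coh.homMk (X := D.coind X) (Y := D.coind X)
    (AddMonoidHom.mk' (fun (f : ℤ → X) z => f (z + 1) - f z) fun f f' => funext fun z =>
      add_sub_add_comm _ _ _ _)
    (continuous_pi fun z => (continuous_apply _).sub (continuous_apply _))
    (fun g f => funext fun z => by
      change X.ρ g (f (z + 1 - D.deg g)) - X.ρ g (f (z - D.deg g)) =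
        X.ρ g (f (z - D.deg g + 1) - f (z - D.deg g))
      rw [map_sub, sub_add_eq_add_sub])

end Induced

end DegreeDatum

/-- The summation operator, a right inverse of the difference operator. -/
def intSum {A : Type*} [AddCommGroup A] (f : ℤ → A) (z : ℤ) : A :=
  ∑ i ∈ Finset.Ico 0 z, f i - ∑ i ∈ Finset.Ico z 0, f i

theorem intSum_add_one_sub {A : Type*} [AddCommGroup A] (f : ℤ → A) (z : ℤ) :
    intSum f (z + 1) - intSum f z = f z := by
  rcases le_or_gt 0 z with h | h
  · have h₁ : Finset.Ico 0 (z + 1) = insert z (Finset.Ico 0 z) := by ext; simp; omega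
    have h₂ : Finset.Ico z 0 = ∅ := by ext; simp; omega
    have h₃ : Finset.Ico (z + 1) 0 = ∅ := by ext; simp; omega
    rw [intSum, intSum, h₁, h₂, h₃, Finset.sum_insert (by simp)]
    simp
  · have h₁ : Finset.Ico z 0 = insert z (Finset.Ico (z + 1) 0) := by ext; simp; omega
    have h₂ : Finset.Ico 0 z = ∅ := by ext; simp; omega
    have h₃ : Finset.Ico 0 (z + 1) = ∅ := by ext; simp; omega
    rw [intSum, intSum, h₁, h₂, h₃, Finset.sum_insert (by simp)]
    simp

theorem eq_apply_zero_of_add_one {A : Type*} {f : ℤ → A} (h : ∀ z, f (z + 1) = f z) (z : ℤ) :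
    f z = f 0 := by
  induction z with
  | zero => rfl
  | succ n ih => rw [h, ih]
  | pred n ih => rw [← ih, ← h, sub_add_cancel]

namespace DegreeDatum

variable {G W : Type v} [Group G] [TopologicalSpace G] [IsTopologicalGroup G]
    [Group W] [TopologicalSpace W] [IsTopologicalGroup W] (D : DegreeDatum G W)

/-- A coefficient sequence that replaces the spectral sequence of the extension of ℤ by the kernel
of the degree. The section `intSum` is continuous for the product topology since each of its
coordinates is a finite sum. -/
theorem topSplitExact_diff {X : TopRep.{max v w} ℤ W} (hX : Coh.HasContinuousAction.{v, w} X) :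
    Coh.TopSplitExact.{v, w} (D.toCoind X) (D.diff X) where
  continuousAction := D.hasContinuousAction_coind hX
  exists_splitting := ⟨⟨fun f : ℤ → X => f 0, continuous_apply 0⟩,
    ⟨fun (f : ℤ → X) z => intSum f z, continuous_pi fun _ =>
      (continuous_finsetSum _ fun i _ => continuous_apply i).sub
        (continuous_finsetSum _ fun i _ => continuous_apply i)⟩,
    fun _ => rfl, fun f => funext (intSum_add_one_sub f),
    fun x => funext fun _ => sub_self x,
    fun f hf => funext fun z => (eq_apply_zero_of_add_one (f := f)
      (fun z => sub_eq_zero.1 congr($hf z)) z).symm⟩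

/-- This equivariance makes `coindRetraction` a morphism: pulling functions on `W` back to `G × ℤ`
respects the action of `W`. -/
theorem kerPart_inv_mul (w : W) (g : G) (z : ℤ) :
    D.kerPart ((D.toGroup w)⁻¹ * g) * D.gen ^ (z - D.deg w) =
      w⁻¹ * (D.kerPart g * D.gen ^ z) := by
  rw [← map_inv, D.kerPart_mul, D.deg_inv, neg_neg, mul_assoc, ← zpow_add, add_sub_cancel,
    mul_assoc]

variable [LocallyCompactSpace G] [LocallyCompactSpace W]

/-- The retraction that shows that the coinduced module of `C(G, M)` is acyclic. -/
def coindRetraction (M : TopRep.{max v w} ℤ G) :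
    (D.coind (TopRep.res (D.toGroup : W →* G) M.coind₁)).coind₁ ⟶
      D.coind (TopRep.res (D.toGroup : W →* G) M.coind₁) :=
  Coh.homMk (X := (D.coind (TopRep.res (D.toGroup : W →* G) M.coind₁)).coind₁)
    (Y := D.coind (TopRep.res (D.toGroup : W →* G) M.coind₁))
    (AddMonoidHom.mk' (fun (F : C(W, ℤ → C(G, M))) z =>
      (⟨fun g => F (D.kerPart g * D.gen ^ z) z g, by
        have h : Continuous fun g => (F (D.kerPart g * D.gen ^ z) z, g) :=
          ((continuous_apply z).comp (F.continuous.comp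
            (D.kerPart.continuous.mul continuous_const))).prodMk continuous_id
        exact ContinuousEval.continuous_eval.comp h⟩ : C(G, M)))
      fun _ _ => rfl)
    (continuous_pi fun z => ContinuousMap.continuous_of_continuous_uncurry _ (by
      have h₁ : Continuous fun p : C(W, ℤ → C(G, M)) × G => (p.1, D.kerPart p.2 * D.gen ^ z) :=
        continuous_fst.prodMk ((D.kerPart.continuous.comp continuous_snd).mul continuous_const)
      have h₂ : Continuous fun p : C(W, ℤ → C(G, M)) × G =>
          (p.1 (D.kerPart p.2 * D.gen ^ z) z, p.2) :=
        ((continuous_apply z).comp (ContinuousEval.continuous_eval.comp h₁)).prodMk continuous_snd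
      exact ContinuousEval.continuous_eval.comp h₂))
    (fun w F => funext fun z => ContinuousMap.ext fun g => by
      change M.ρ (D.toGroup w) ((F : C(W, ℤ → C(G, M))) (w⁻¹ * (D.kerPart g * D.gen ^ z))
          (z - D.deg w) ((D.toGroup w)⁻¹ * g)) =
        M.ρ (D.toGroup w) ((F : C(W, ℤ → C(G, M)))
          (D.kerPart ((D.toGroup w)⁻¹ * g) * D.gen ^ (z - D.deg w))
          (z - D.deg w) ((D.toGroup w)⁻¹ * g))
      rw [kerPart_inv_mul])

theorem coind_eq_zero (M : TopRep.{max v w} ℤ G) (n : ℕ)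
    (x : Coh.{v, w} (n + 1) (D.coind (TopRep.res (D.toGroup : W →* G) M.coind₁))) : x = 0 :=
  Coh.eq_zero_of_retraction (D.coindRetraction M) (fun _ => rfl) n x

end DegreeDatum

/-! ### Differences of periodic functions -/

section Periodic

variable {A : Type*} [AddCommGroup A]

@[simp]
theorem intSum_zero (f : ℤ → A) : intSum f 0 = 0 := by simp [intSum]

theorem intSum_of_add_one_sub {f v : ℤ → A} (h : ∀ z, v (z + 1) - v z = f z) (z : ℤ) :
    intSum f z = v z - v 0 := by
  have := eq_apply_zero_of_add_one (f := fun z => intSum f z - v z) (fun z => by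
    have h₁ := intSum_add_one_sub f z
    rw [← h] at h₁
    rw [← sub_eq_zero, ← sub_eq_zero.2 h₁]
    abel) z
  rw [intSum_zero, sub_eq_iff_eq_add] at this
  rw [this]
  abel

theorem intSum_add_of_periodic {f : ℤ → A} {m : ℤ} (hf : Function.Periodic f m) (z : ℤ) :
    intSum f (z + m) = intSum f z + intSum f m := by
  have := eq_apply_zero_of_add_one (f := fun z => intSum f (z + m) - intSum f z) (fun z => by
    have h₁ := intSum_add_one_sub f z
    have h₂ := intSum_add_one_sub f (z + m)
    rw [hf, ← h₁] at h₂
    rw [← sub_eq_zero, ← sub_eq_zero.2 h₂, add_right_comm z m 1]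
    abel) z
  rw [intSum_zero, zero_add, sub_zero, sub_eq_iff_eq_add'] at this
  exact this

theorem intSum_nsmul_of_periodic {f : ℤ → A} {m : ℤ} (hf : Function.Periodic f m) (k : ℕ) :
    intSum f (k * m) = k • intSum f m := by
  induction k with
  | zero => simp
  | succ k ih => rw [Nat.cast_succ, add_mul, one_mul, intSum_add_of_periodic hf, ih, succ_nsmul]

theorem periodic_intSum {f : ℤ → A} {m : ℤ} (hf : Function.Periodic f m) (h : intSum f m = 0) :
    Function.Periodic (intSum f) m := fun z => by
  rw [intSum_add_of_periodic hf, h, add_zero]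

/-- A periodic function is a difference of periodic functions as soon as a multiple of it is. -/
theorem exists_periodic_of_nsmul {f v : ℤ → A} {m m' k : ℕ} (hm : m ≠ 0) (hm' : m' ≠ 0)
    (hk : k ≠ 0) (hf : Function.Periodic f m) (hv : Function.Periodic v m')
    (h : ∀ z, v (z + 1) - v z = k • f z) :
    ∃ (v' : ℤ → A) (n : ℕ), n ≠ 0 ∧ Function.Periodic v' n ∧ ∀ z, v' (z + 1) - v' z = f z := by
  have hf₁ : Function.Periodic f (m' * m : ℕ) := by
    simpa using hf.nat_mul m'
  have hv₁ : Function.Periodic v (m' * m : ℕ) := by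
    simpa [mul_comm] using hv.nat_mul m
  -- The sum of `f` over the common period `m' * m` need not vanish, only `k` times it, which
  -- telescopes to a difference of two equal values of `v`. Enlarging the period by the factor `k`
  -- kills it.
  have hf₂ : Function.Periodic f (k * (m' * m) : ℕ) := by
    simpa using hf₁.nat_mul k
  refine ⟨intSum f, k * (m' * m), by positivity, periodic_intSum hf₂ ?_, intSum_add_one_sub f⟩
  have h₁ := intSum_nsmul_of_periodic hf₁ k
  have h₂ : k • intSum f (m' * m : ℕ) = intSum (fun z => k • f z) (m' * m : ℕ) := by
    simp only [intSum, smul_sub, Finset.smul_sum]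
  rw [Nat.cast_mul, h₁, h₂, intSum_of_add_one_sub h, sub_eq_zero]
  simpa using hv₁ 0

/-- Every periodic function is divisible modulo differences of periodic functions. -/
theorem exists_periodic_nsmul_add {f : ℤ → A} {m k : ℕ} (hm : m ≠ 0) (hk : k ≠ 0)
    (hf : Function.Periodic f m) :
    ∃ (f' v : ℤ → A) (n : ℕ), n ≠ 0 ∧ Function.Periodic f' n ∧ Function.Periodic v n ∧
      ∀ z, v (z + 1) - v z = f z - k • f' z := by
  set n := k * m with hn
  have hn₀ : n ≠ 0 := by positivity
  -- Concentrate on the multiples of `n = k * m` the sum of `f` over one period `m`: over `n`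
  -- consecutive integers both `f` and `k • f'` then sum to `k • intSum f m`.
  let f' : ℤ → A := fun z => if (n : ℤ) ∣ z then intSum f m else 0
  have hf' : Function.Periodic f' n := fun z => by
    simp only [f', dvd_add_self_right]
  have hf₁ : Function.Periodic f n := by simpa [hn] using hf.nat_mul k
  have h₀ : Function.Periodic (fun z => f z - k • f' z) n := fun z => by
    simp only [hf₁ z, hf' z]
  refine ⟨f', intSum fun z => f z - k • f' z, n, hn₀, hf', periodic_intSum h₀ ?_,
    intSum_add_one_sub _⟩
  have h₁ : intSum (fun z => f z - k • f' z) n = intSum f n - k • intSum f' n := by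
    simp only [intSum, Finset.sum_sub_distrib, smul_sub, Finset.smul_sum]
    abel
  have h₂ : intSum f' n = intSum f m := by
    rw [intSum, Finset.Ico_eq_empty (a := (n : ℤ)) (by simp), Finset.sum_empty, sub_zero,
      Finset.sum_eq_single 0]
    · simp [f']
    · intro b hb hb'
      rw [Finset.mem_Ico] at hb
      exact if_neg fun h => hb' (Int.eq_zero_of_dvd_of_nonneg_of_lt hb.1 hb.2 h)
    · intro h
      exact absurd (Finset.mem_Ico.2 ⟨le_rfl, by positivity⟩) h
  rw [h₁, h₂, hn, Nat.cast_mul, intSum_nsmul_of_periodic hf, sub_self]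

end Periodic

/-! ### Discrete modules over compact groups -/

section Discrete

/-- A continuous map from a compact space to a discrete one has finitely many values with compact
fibres, so finitely many compact-open conditions isolate it. -/
theorem discreteTopology_continuousMap {X Y : Type*} [TopologicalSpace X] [TopologicalSpace Y]
    [CompactSpace X] [DiscreteTopology Y] : DiscreteTopology C(X, Y) := by
  rw [discreteTopology_iff_isOpen_singleton]
  intro f
  have hfin : (Set.range f).Finite := (isCompact_range f.continuous).finite_of_discrete
  have : {f} = ⋂ y ∈ Set.range f, {g : C(X, Y) | Set.MapsTo g (f ⁻¹' {y}) {y}} := by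
    ext g
    simp only [Set.mem_singleton_iff, Set.mem_iInter, Set.mem_ofPred_eq]
    constructor
    · rintro rfl y - x hx
      exact hx
    · intro h
      ext x
      exact h (f x) ⟨x, rfl⟩ rfl
  rw [this]
  refine hfin.isOpen_biInter fun y _ => ContinuousMap.isOpen_setOfPred_mapsTo ?_ (isOpen_discrete _)
  exact ((isClosed_discrete _).preimage f.continuous).isCompact

open TopRep

variable {G : Type v} [Group G] [TopologicalSpace G] [IsTopologicalGroup G]
  {M : TopRep.{max v w} ℤ G}

theorem IsDiscreteModule.coind₁ [CompactSpace G] (hM : IsDiscreteModule.{v, w} M) :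
    IsDiscreteModule.{v, w} M.coind₁ :=
  have := hM.1
  ⟨discreteTopology_continuousMap (X := G) (Y := M), Coh.HasContinuousAction.resolutionX hM.2 1⟩

theorem IsDiscreteModule.shift [CompactSpace G] (hM : IsDiscreteModule.{v, w} M) :
    IsDiscreteModule.{v, w} (Coh.shift.{v, w} M) := by
  have h₁ := hM.coind₁
  have : DiscreteTopology C(G, M) := h₁.1
  refine ⟨inferInstanceAs (DiscreteTopology (Coh.vanishing M)), ?_⟩
  have h : Continuous fun p : G × Coh.vanishing M => (p.1, p.2.1) :=
    continuous_fst.prodMk (continuous_subtype_val.comp continuous_snd)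
  exact (Coh.continuous_toVanishing M).comp (h₁.2.comp h)

omit [IsTopologicalGroup G] in
/-- Averaging over a finite orbit. -/
theorem IsDiscreteModule.exists_nsmul_invariant [CompactSpace G] (hM : IsDiscreteModule.{v, w} M)
    {N : TopRep.{max v w} ℤ G} (p : M ⟶ N) (H : Subgroup G) (b : M)
    (hb : ∀ g ∈ H, p (M.ρ g b) = p b) :
    ∃ (k : ℕ) (c : M), k ≠ 0 ∧ (∀ g ∈ H, M.ρ g c = c) ∧ p c = k • p b := by
  have := hM.1
  -- `H` need not be closed: its orbits are finite because they lie in orbits of the compact group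
  -- `G`.
  have hfin : (Set.range fun g : G => M.ρ g b).Finite :=
    (isCompact_range (hM.2.comp (continuous_id.prodMk continuous_const))).finite_of_discrete
  have hfin' : {x | ∃ g ∈ H, M.ρ g b = x}.Finite :=
    hfin.subset fun x ⟨g, _, hg⟩ => ⟨g, hg⟩
  have hmul (g h : G) (x : M) : M.ρ g (M.ρ h x) = M.ρ (g * h) x := by rw [map_mul]; rfl
  refine ⟨hfin'.toFinset.card, ∑ x ∈ hfin'.toFinset, x, ?_, fun g hg => ?_, ?_⟩
  · exact Finset.card_ne_zero_of_mem (hfin'.mem_toFinset.2 ⟨1, H.one_mem, rfl⟩)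
  · rw [map_sum]
    refine Finset.sum_bij' (fun x _ => M.ρ g x) (fun x _ => M.ρ g⁻¹ x) ?_ ?_ ?_ ?_ ?_
    · intro x hx
      obtain ⟨h, hh, rfl⟩ := hfin'.mem_toFinset.1 hx
      exact hfin'.mem_toFinset.2 ⟨g * h, H.mul_mem hg hh, (hmul g h b).symm⟩
    · intro x hx
      obtain ⟨h, hh, rfl⟩ := hfin'.mem_toFinset.1 hx
      exact hfin'.mem_toFinset.2 ⟨g⁻¹ * h, H.mul_mem (H.inv_mem hg) hh, (hmul g⁻¹ h b).symm⟩
    · intro x _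
      rw [hmul, inv_mul_cancel, map_one]; rfl
    · intro x _
      rw [hmul, mul_inv_cancel, map_one]; rfl
    · intro x _
      rfl
  · rw [map_sum, Finset.sum_congr rfl (g := fun _ => p b), Finset.sum_const]
    intro x hx
    obtain ⟨h, hh, rfl⟩ := hfin'.mem_toFinset.1 hx
    exact hb h hh

end Discrete

/-! ### Restriction of exact sequences -/

namespace Coh

open TopRep

variable {Γ Δ : Type v} [Group Γ] [TopologicalSpace Γ] [IsTopologicalGroup Γ]
  [Group Δ] [TopologicalSpace Δ] [IsTopologicalGroup Δ] {A B C : TopRep.{max v w} ℤ Γ}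

theorem res_map (φ : Δ →ₜ* Γ) (f : A ⟶ B) (n : ℕ) (x : Coh.{v, w} n A) :
    res φ n B (map n f x) = map n ((TopRep.resFunctor (φ : Δ →* Γ)).map f) (res φ n A x) := by
  obtain ⟨F, rfl⟩ := cls_surjective x
  change pullback φ (𝟙 _) n (map n f _) = map n _ (pullback φ (𝟙 _) n _)
  rw [map_cls, pullback_cls, pullback_cls, map_cls]
  congr 1
  have h : ∀ n (x : resolutionX A n),
      levelMap φ (𝟙 (TopRep.res (φ : Δ →* Γ) B)) n (level f n x) =
        level ((TopRep.resFunctor (φ : Δ →* Γ)).map f) n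
          (levelMap φ (𝟙 (TopRep.res (φ : Δ →* Γ) A)) n x) := by
    intro n
    induction n with
    | zero => exact fun _ => rfl
    | succ n ih => exact fun F => ContinuousMap.ext fun x => ih _
  exact Subtype.ext (h (n + 1) F.1)

theorem res_invariantClass (φ : Δ →ₜ* Γ) (x : invariants A)
    (y : invariants ((TopRep.resFunctor (φ : Δ →* Γ)).obj A)) (h : x.1 = y.1) :
    res φ 0 A (invariantClass A x) =
      invariantClass ((TopRep.resFunctor (φ : Δ →* Γ)).obj A) y :=
  pullback_invariantClass φ (𝟙 (TopRep.res (φ : Δ →* Γ) A)) x y h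

variable {f : A ⟶ B} {g : B ⟶ C}

omit [IsTopologicalGroup Γ] [IsTopologicalGroup Δ] in
theorem TopSplitExact.res (h : TopSplitExact.{v, w} f g) (φ : Δ →ₜ* Γ) :
    TopSplitExact.{v, w} ((TopRep.resFunctor (φ : Δ →* Γ)).map f)
      ((TopRep.resFunctor (φ : Δ →* Γ)).map g) where
  continuousAction := h.continuousAction.comp
    (((map_continuous φ).comp continuous_fst).prodMk continuous_snd)
  exists_splitting := h.exists_splitting

theorem TopSplitExact.res_δ [LocallyCompactSpace Γ] [LocallyCompactSpace Δ]
    (h : TopSplitExact.{v, w} f g) (φ : Δ →ₜ* Γ) (n : ℕ) (x : Coh.{v, w} n C) :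
    Coh.res φ (n + 1) A (h.δ n x) = (h.res φ).δ n (Coh.res φ n C x) :=
  h.δ_naturality φ (h.res φ) (𝟙 _) (𝟙 _) (𝟙 _) (fun _ => rfl) (fun _ => rfl) n x

theorem TopSplitExact.map_δ [LocallyCompactSpace Γ] {A' B' C' : TopRep.{max v w} ℤ Γ}
    {f' : A' ⟶ B'} {g' : B' ⟶ C'} (h : TopSplitExact.{v, w} f g)
    (h' : TopSplitExact.{v, w} f' g') (a : A ⟶ A') (b : B ⟶ B') (c : C ⟶ C')
    (hf : ∀ x : A, b (f x) = f' (a x)) (hg : ∀ x : B, c (g x) = g' (b x)) (n : ℕ)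
    (x : Coh.{v, w} n C) : map (n + 1) a (h.δ n x) = h'.δ n (map n c x) :=
  h.δ_naturality (ContinuousMonoidHom.id Γ) h' a b c hf hg n x

theorem map_comm {B' : TopRep.{max v w} ℤ Γ} (f : A ⟶ B) (g : B ⟶ C) (f' : A ⟶ B') (g' : B' ⟶ C)
    (h : ∀ x : A, g (f x) = g' (f' x)) (n : ℕ) (x : Coh.{v, w} n A) :
    map n g (map n f x) = map n g' (map n f' x) := by
  obtain ⟨F, rfl⟩ := cls_surjective x
  rw [map_cls, map_cls, map_cls, map_cls]
  congr 1
  have h : ∀ n (x : resolutionX A n), level g n (level f n x) = level g' n (level f' n x) := by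
    intro n
    induction n with
    | zero => exact h
    | succ n ih => exact fun F => ContinuousMap.ext fun x => ih _
  exact Subtype.ext (h (n + 1) F.1)

/-- The functoriality of `TopRep.coind₁`. -/
def coind₁Map (f : A ⟶ B) : A.coind₁ ⟶ B.coind₁ :=
  (coind₁Functor ℤ Γ).map f

/-- The functoriality of `Coh.shift`. -/
def shiftMap (f : A ⟶ B) : shift.{v, w} A ⟶ shift.{v, w} B :=
  homMk (X := shift.{v, w} A) (Y := shift.{v, w} B)
    { toFun := fun F : vanishing A =>
        (⟨coind₁Map f F.1, (congr_arg f F.2).trans (map_zero _)⟩ : vanishing B)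
      map_zero' := Subtype.ext (map_zero _)
      map_add' := fun _ _ => Subtype.ext (map_add _ _ _) }
    (((continuous_hom (coind₁Map f)).comp continuous_subtype_val).subtype_mk _)
    (fun g F => Subtype.ext (ContinuousMap.ext fun x => by
      change f (A.ρ g ((F : vanishing A).1 (g⁻¹ * x)) - A.ρ g ((F : vanishing A).1 (g⁻¹ * 1))) =
        B.ρ g (f ((F : vanishing A).1 (g⁻¹ * x))) - B.ρ g (f ((F : vanishing A).1 (g⁻¹ * 1)))
      rw [map_sub, hom_comm_apply, hom_comm_apply]))

theorem coind₁Map_toCoind (f : A ⟶ B) (x : A) :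
    coind₁Map f (toCoind A x) = toCoind B (f x) :=
  rfl

theorem shiftMap_toShift (f : A ⟶ B) (x : A.coind₁) :
    shiftMap f (toShift A x) = toShift B (coind₁Map f x) :=
  Subtype.ext (ContinuousMap.ext fun y => map_sub f.hom ((x : C(Γ, A)) y) ((x : C(Γ, A)) 1))

/-- The connecting map from degree zero, on invariants. -/
def TopSplitExact.invariantδ [LocallyCompactSpace Γ] (h : TopSplitExact.{v, w} f g) :
    invariants C →+ Coh.{v, w} 1 A :=
  (h.δ 0).comp (invariantClass C)

/-- With `invariantδ_surjective`, this presents `H^1` of the left term as a cokernel of invariants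
when the middle term is acyclic, so that questions in degree one become questions about invariant
elements. -/
theorem TopSplitExact.invariantδ_eq_zero_iff [LocallyCompactSpace Γ]
    (h : TopSplitExact.{v, w} f g) (c : invariants C) :
    h.invariantδ c = 0 ↔ ∃ b : invariants B, g b.1 = c.1 := by
  refine (h.exact₃ 0 _).trans ⟨?_, ?_⟩
  · rintro ⟨y, hy⟩
    obtain ⟨b, rfl⟩ := invariantClass_bijective.2 y
    have hb : ∀ x, C.ρ x (g b.1) = g b.1 := fun x => by rw [← hom_comm_apply, b.2 x]
    rw [map_invariantClass g b ⟨g b.1, hb⟩ rfl] at hy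
    exact ⟨b, congr_arg Subtype.val (invariantClass_bijective.1 hy)⟩
  · rintro ⟨b, hb⟩
    exact ⟨_, map_invariantClass g b c hb⟩

theorem TopSplitExact.invariantδ_surjective [LocallyCompactSpace Γ]
    (h : TopSplitExact.{v, w} f g) (hB : ∀ x : Coh.{v, w} 1 B, x = 0) :
    Function.Surjective h.invariantδ := by
  intro x
  obtain ⟨y, rfl⟩ := (h.exact₁ 0 x).1 (hB _)
  obtain ⟨c, rfl⟩ := invariantClass_bijective.2 y
  exact ⟨c, rfl⟩

end Coh

/-- Every element of the torsion subgroup is annihilated by a nonzero natural number. -/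
theorem mem_torsion_iff_exists_nsmul {A : Type*} [AddCommGroup A] {x : A} :
    x ∈ AddCommGroup.torsion A ↔ ∃ k : ℕ, k ≠ 0 ∧ k • x = 0 := by
  refine isOfFinAddOrder_iff_nsmul_eq_zero.trans ?_
  simp only [Nat.pos_iff_ne_zero]

theorem Function.Periodic.int_emod {A : Type*} {f : ℤ → A} {m : ℕ} (hf : Function.Periodic f m)
    {a b : ℤ} (h : (a : ZMod m) = b) : f a = f b := by
  obtain ⟨c, hc⟩ := (ZMod.intCast_eq_intCast_iff_dvd_sub a b m).1 h
  have := hf.int_mul c a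
  rw [← this, ← sub_add_cancel b a, hc, add_comm a, mul_comm]
  push_cast
  rfl

/-- A class comes from an invariant of `shift M`; the sum over the finite `G`-orbit of a lift to
`C(G, M)` is an invariant lift of a nonzero multiple. -/
theorem IsDiscreteModule.exists_nsmul_eq_zero {G : Type v} [Group G] [TopologicalSpace G]
    [IsTopologicalGroup G] [CompactSpace G] {M : TopRep.{max v w} ℤ G}
    (hM : IsDiscreteModule.{v, w} M) (x : Coh.{v, w} 1 M) :
    ∃ k : ℕ, k ≠ 0 ∧ k • x = 0 := by
  have h := Coh.topSplitExact_shift hM.2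
  obtain ⟨c, rfl⟩ := h.invariantδ_surjective (Coh.coind₁_eq_zero M 0) x
  obtain ⟨r, s, -, hs, -⟩ := h.exists_splitting
  obtain ⟨k, b, hk, hb, hbc⟩ := hM.coind₁.exists_nsmul_invariant (Coh.toShift M) ⊤ (s c.1)
    fun g _ => by rw [TopRep.hom_comm_apply, hs, c.2 g]
  refine ⟨k, hk, ?_⟩
  rw [← map_nsmul, h.invariantδ_eq_zero_iff]
  exact ⟨⟨b, fun g => hb g trivial⟩, hbc.trans (by rw [hs]; rfl)⟩

/-! ### Restriction along a degree datum: degree zero and invariants. -/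

namespace DegreeDatum

open TopRep

variable {G W : Type v} [Group G] [TopologicalSpace G] [IsTopologicalGroup G]
    [Group W] [TopologicalSpace W] [IsTopologicalGroup W] (D : DegreeDatum G W)

/-- The restriction of modules to `W`. -/
abbrev resFunctor : TopRep.{max v w} ℤ G ⥤ TopRep.{max v w} ℤ W :=
  TopRep.resFunctor (D.toGroup : W →* G)

/-- The restriction map on cohomology. -/
abbrev res (n : ℕ) (M : TopRep.{max v w} ℤ G) :
    Coh.{v, w} n M →+ Coh.{v, w} n (D.resFunctor.obj M) :=
  Coh.res D.toGroup n M

variable {M : TopRep.{max v w} ℤ G}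

theorem res_hasContinuousAction (hM : Coh.HasContinuousAction.{v, w} M) :
    Coh.HasContinuousAction.{v, w} (D.resFunctor.obj M) :=
  Continuous.comp hM (((map_continuous D.toGroup).comp continuous_fst).prodMk continuous_snd)

theorem invariant_of_res (hM : IsDiscreteModule.{v, w} M) {x : M}
    (hx : ∀ w, M.ρ (D.toGroup w) x = x) (g : G) : M.ρ g x = x := by
  have := hM.1
  have h : Continuous fun g : G => M.ρ g x := hM.2.comp (continuous_id.prodMk continuous_const)
  exact congr_fun (D.denseRange.equalizer h continuous_const (funext hx)) g

theorem res_zero_bijective (hM : IsDiscreteModule.{v, w} M) :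
    Function.Bijective (D.res.{v, w} 0 M) := by
  have key (x : Coh.invariants M) (y : Coh.invariants.{v, w} (D.resFunctor.{v, w}.obj M))
    (h : x.1 = y.1) :
      D.res.{v, w} 0 M (Coh.invariantClass.{v, w} M x) =
        Coh.invariantClass.{v, w} (D.resFunctor.{v, w}.obj M) y :=
    Coh.res_invariantClass.{v, w} D.toGroup x y h
  constructor
  · intro x y hxy
    obtain ⟨x, rfl⟩ := Coh.invariantClass_bijective.2 x
    obtain ⟨y, rfl⟩ := Coh.invariantClass_bijective.2 y
    rw [key x ⟨x.1, fun w => x.2 _⟩ rfl, key y ⟨y.1, fun w => y.2 _⟩ rfl] at hxy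
    have := congr_arg Subtype.val (Coh.invariantClass_bijective.1 hxy)
    exact congr_arg _ (Subtype.ext this)
  · intro y
    obtain ⟨y, rfl⟩ := Coh.invariantClass_bijective.2 y
    obtain ⟨y, hy⟩ := y
    exact ⟨_, key ⟨y, D.invariant_of_res hM hy⟩ ⟨y, hy⟩ rfl⟩

/-! #### Invariants of the coinduced module of `C(G, M)` -/

section Invariants

theorem coe_coind_invariant {X : TopRep.{max v w} ℤ W} (f : Coh.invariants (D.coind X)) (w : W)
    (z : ℤ) : X.ρ w ((f.1 : ℤ → X) (z - D.deg w)) = (f.1 : ℤ → X) z :=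
  congr_fun (f.2 w : (D.coind X).ρ w f.1 = f.1) z

theorem coind_invariant_apply (f : Coh.invariants (D.coind (D.resFunctor.obj M.coind₁))) (w : W)
    (z : ℤ) : ((f.1 : ℤ → C(G, M)) z) (D.toGroup w) =
      M.ρ (D.toGroup w) (((f.1 : ℤ → C(G, M)) (z - D.deg w)) 1) := by
  have := D.coe_coind_invariant f w z
  refine congr($(this.symm) (D.toGroup w)).trans ?_
  change M.ρ (D.toGroup w) (((f.1 : ℤ → C(G, M)) (z - D.deg w)) ((D.toGroup w)⁻¹ * D.toGroup w)) = _
  rw [inv_mul_cancel]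

/-- Invariance determines `f z` on the dense image of `W` from the values at `1`. Together with the
next lemmas this identifies the invariants with the periodic functions `ℤ → M`. -/
theorem coind_invariant_ext (hM : IsDiscreteModule.{v, w} M)
    {f f' : Coh.invariants (D.coind (D.resFunctor.obj M.coind₁))}
    (h : ∀ z, ((f.1 : ℤ → C(G, M)) z) 1 = ((f'.1 : ℤ → C(G, M)) z) 1) : f = f' := by
  have := hM.1
  refine Subtype.ext (funext fun z => DFunLike.coe_injective (F := C(G, M))
    (D.denseRange.equalizer (map_continuous (F := C(G, M)) _) (map_continuous (F := C(G, M)) _)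
      (funext fun w => ?_)))
  change ((f.1 : ℤ → C(G, M)) z) (D.toGroup w) = ((f'.1 : ℤ → C(G, M)) z) (D.toGroup w)
  rw [coind_invariant_apply, coind_invariant_apply, h]

theorem coind_invariant_eq_gen {X : TopRep.{max v w} ℤ W} (f : Coh.invariants (D.coind X)) (z : ℤ) :
    (f.1 : ℤ → X) z = X.ρ (D.gen ^ z) ((f.1 : ℤ → X) 0) := by
  rw [← D.coe_coind_invariant f (D.gen ^ z), D.deg_gen_zpow, sub_self]

/-- Invariance gives `f z = gen ^ z • f 0`, and the stabiliser of `f 0` is open in the compact group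
`G`, hence contains a positive power of `gen`. -/
theorem exists_periodic_coind_invariant [CompactSpace G] (hM : IsDiscreteModule.{v, w} M)
    (f : Coh.invariants (D.coind (D.resFunctor.obj M))) :
    ∃ m : ℕ, m ≠ 0 ∧ Function.Periodic (f.1 : ℤ → M) m := by
  have := hM.1
  let b : M := (f.1 : ℤ → M) 0
  let S : Subgroup G :=
    { carrier := {g | M.ρ g b = b}
      one_mem' := congr($(map_one M.ρ) b)
      mul_mem' := fun {g h} hg hh => by
        change M.ρ (g * h) b = b
        rw [map_mul]
        exact (congr_arg (M.ρ g) hh).trans hg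
      inv_mem' := fun {g} hg => by
        change M.ρ g⁻¹ b = b
        conv_lhs => rw [← (show M.ρ g b = b from hg)]
        change (M.ρ g⁻¹ * M.ρ g) b = b
        rw [← map_mul, inv_mul_cancel, map_one]
        rfl }
  have hS : IsOpen (S : Set G) := (isOpen_discrete {b}).preimage
    (show Continuous fun g : G => M.ρ g b from hM.2.comp (continuous_id.prodMk continuous_const))
  have := S.quotient_finite_of_isOpen hS
  have : S.FiniteIndex := S.finiteIndex_of_finite_quotient
  obtain ⟨m, hm, -, hmS⟩ := Subgroup.exists_pow_mem_of_index_ne_zero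
    (Subgroup.FiniteIndex.index_ne_zero (H := S)) (D.toGroup D.gen)
  refine ⟨m, hm.ne', fun z => ?_⟩
  have hb : (D.resFunctor.obj M).ρ (D.gen ^ (m : ℤ)) b = b := by
    change M.ρ (D.toGroup (D.gen ^ (m : ℤ))) b = b
    rw [zpow_natCast, map_pow]
    exact hmS
  rw [D.coind_invariant_eq_gen f, D.coind_invariant_eq_gen f z, zpow_add, map_mul]
  exact congr_arg ((D.resFunctor.obj M).ρ (D.gen ^ z)) hb

/-- Invariance forces the value `w • u (z - deg w)` at `w`. Since `u` has period `m`, the degree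
matters only mod `m`, where it extends to all of `G` as `χ`. -/
theorem exists_coind_invariant (hM : IsDiscreteModule.{v, w} M) {u : ℤ → M} {m : ℕ} (hm : m ≠ 0)
    (hu : Function.Periodic u m) :
    ∃ f : Coh.invariants (D.coind (D.resFunctor.obj M.coind₁)),
      ∀ z, ((f.1 : ℤ → C(G, M)) z) 1 = u z := by
  have := hM.1
  obtain ⟨χ, hχ, hχ_mul, hχ_deg⟩ := D.exists_extension m hm
  have : NeZero m := ⟨hm⟩
  have hχ_one : χ 1 = 0 := by simpa using hχ_mul 1 1
  let f : ℤ → C(G, M) := fun z => ⟨fun g => M.ρ g (u (z - (χ g).val)), by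
    have h₁ : IsLocallyConstant fun g => u (z - (χ g).val) := hχ.comp fun a => u (z - a.val)
    exact hM.2.comp (continuous_id.prodMk h₁.continuous)⟩
  refine ⟨⟨f, fun w => funext fun z => ContinuousMap.ext fun g => ?_⟩, fun z => ?_⟩
  · change M.ρ (D.toGroup w) (M.ρ ((D.toGroup w)⁻¹ * g)
      (u (z - D.deg w - (χ ((D.toGroup w)⁻¹ * g)).val))) = M.ρ g (u (z - (χ g).val))
    have h₁ : χ ((D.toGroup w)⁻¹ * g) = χ g - D.deg w := by
      rw [← map_inv, hχ_mul, hχ_deg, D.deg_inv]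
      push_cast
      ring
    have h₂ : u (z - D.deg w - (χ ((D.toGroup w)⁻¹ * g)).val) = u (z - (χ g).val) :=
      hu.int_emod (by simp [h₁])
    rw [h₂]
    change (M.ρ (D.toGroup w) * M.ρ ((D.toGroup w)⁻¹ * g)) _ = _
    rw [← map_mul, mul_inv_cancel_left]
  · change M.ρ 1 (u (z - (χ 1).val)) = u z
    rw [map_one, hχ_one]
    simp

end Invariants

/-! ### Cohomology of `W` with coefficients in `C(G, M)` and in coinduced modules. -/

section Restriction

variable [CompactSpace G] [LocallyCompactSpace W]

omit [LocallyCompactSpace W] in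
theorem exists_coind_invariant_of_nsmul (hM : IsDiscreteModule.{v, w} M) {k : ℕ} (hk : k ≠ 0)
    (f v : Coh.invariants (D.coind (D.resFunctor.obj M.coind₁)))
    (h : D.diff _ v.1 = k • f.1) :
    ∃ v' : Coh.invariants (D.coind (D.resFunctor.obj M.coind₁)), D.diff _ v'.1 = f.1 := by
  obtain ⟨m, hm, hf⟩ := D.exists_periodic_coind_invariant hM.coind₁ f
  obtain ⟨m', hm', hv⟩ := D.exists_periodic_coind_invariant hM.coind₁ v
  have hf' : Function.Periodic (fun z => ((f.1 : ℤ → C(G, M)) z) 1) m :=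
    fun z => congr($(hf z) 1)
  have hv' : Function.Periodic (fun z => ((v.1 : ℤ → C(G, M)) z) 1) m' :=
    fun z => congr($(hv z) 1)
  obtain ⟨u, n, hn, hu, huf⟩ := exists_periodic_of_nsmul hm hm' hk hf' hv'
    fun z => congr(($h z : C(G, M)) 1)
  obtain ⟨v', hv'⟩ := D.exists_coind_invariant hM hn hu
  have hinv : ∀ w, (D.coind (D.resFunctor.obj M.coind₁)).ρ w (D.diff _ v'.1) = D.diff _ v'.1 :=
    fun w => by rw [← hom_comm_apply, v'.2 w]
  refine ⟨v', congr_arg Subtype.val (D.coind_invariant_ext hM (f := ⟨_, hinv⟩) (f' := f)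
    fun z => ?_)⟩
  rw [← huf, ← hv', ← hv']
  rfl

omit [LocallyCompactSpace W] in
theorem exists_coind_invariant_nsmul_add (hM : IsDiscreteModule.{v, w} M) {k : ℕ} (hk : k ≠ 0)
    (f : Coh.invariants (D.coind (D.resFunctor.obj M.coind₁))) :
    ∃ f' v : Coh.invariants (D.coind (D.resFunctor.obj M.coind₁)),
      D.diff _ v.1 = (f - k • f').1 := by
  obtain ⟨m, hm, hf⟩ := D.exists_periodic_coind_invariant hM.coind₁ f
  have hf' : Function.Periodic (fun z => ((f.1 : ℤ → C(G, M)) z) 1) m :=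
    fun z => congr($(hf z) 1)
  obtain ⟨u, u', n, hn, hu, hu', huf⟩ := exists_periodic_nsmul_add hm hk hf'
  obtain ⟨f', hf'⟩ := D.exists_coind_invariant hM hn hu
  obtain ⟨v', hv'⟩ := D.exists_coind_invariant hM hn hu'
  have hinv : ∀ w, (D.coind (D.resFunctor.obj M.coind₁)).ρ w (D.diff _ v'.1) = D.diff _ v'.1 :=
    fun w => by rw [← hom_comm_apply, v'.2 w]
  refine ⟨f', v', congr_arg Subtype.val (D.coind_invariant_ext hM (f := ⟨_, hinv⟩)
    (f' := f - k • f') fun z => ?_)⟩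
  have := huf z
  rw [← hv', ← hv', ← hf'] at this
  exact this

/-- The cohomology of `W` with coefficients in `C(G, M)` is uniquely divisible in degree one. -/
theorem nsmul_bijective (hM : IsDiscreteModule.{v, w} M) {k : ℕ} (hk : k ≠ 0) :
    Function.Bijective
      (fun x : Coh.{v, w} 1 (D.resFunctor.obj M.coind₁) => k • x) := by
  -- This sequence presents the group as the cokernel of the difference operator on periodic
  -- functions; the two facts on differences of periodic functions give injectivity and
  -- surjectivity.
  have h := D.topSplitExact_diff (D.res_hasContinuousAction hM.coind₁.2)
  have hs := h.invariantδ_surjective (D.coind_eq_zero M 0)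
  constructor
  · have : Function.Injective (nsmulAddMonoidHom (α := Coh.{v, w} 1
      (D.resFunctor.obj M.coind₁)) k) := by
      rw [injective_iff_map_eq_zero]
      intro x hx
      obtain ⟨f, rfl⟩ := hs x
      rw [nsmulAddMonoidHom_apply, ← map_nsmul, h.invariantδ_eq_zero_iff] at hx
      obtain ⟨v, hv⟩ := hx
      exact (h.invariantδ_eq_zero_iff f).2 (D.exists_coind_invariant_of_nsmul hM hk f v hv)
    exact this
  · intro x
    obtain ⟨f, rfl⟩ := hs x
    obtain ⟨f', v, hv⟩ := D.exists_coind_invariant_nsmul_add hM hk f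
    have := (h.invariantδ_eq_zero_iff _).2 ⟨v, hv⟩
    rw [map_sub, map_nsmul, sub_eq_zero] at this
    exact ⟨_, this.symm⟩

/-- The class lies between degree `n + 1` and degree `n + 2` of the coinduced module, both of which
vanish; the argument starts in degree two because degree zero is not acyclic. -/
theorem res_coind₁_eq_zero (hM : IsDiscreteModule.{v, w} M) (n : ℕ)
    (x : Coh.{v, w} (n + 2) (D.resFunctor.obj M.coind₁)) : x = 0 := by
  have h := D.topSplitExact_diff (D.res_hasContinuousAction hM.coind₁.2)
  obtain ⟨y, rfl⟩ := (h.exact₁ (n + 1) x).1 (D.coind_eq_zero M (n + 1) _)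
  rw [D.coind_eq_zero M n y, map_zero]

/-- In the spirit of Shapiro's lemma this is torsion of `H^1` of the kernel of the degree. An
invariant of `coind (shift M)` is determined by its value at `0`, which that kernel fixes; average a
lift of it over the kernel, then spread the result over ℤ by the powers of `gen`. -/
theorem exists_nsmul_eq_zero_coind (hM : IsDiscreteModule.{v, w} M)
    (x : Coh.{v, w} 1 (D.coind (D.resFunctor.obj M))) : ∃ k : ℕ, k ≠ 0 ∧ k • x = 0 := by
  have h := Coh.topSplitExact_shift hM.2
  have hJ := D.topSplitExact_coindMap (h.res D.toGroup)
  obtain ⟨f, rfl⟩ := hJ.invariantδ_surjective (D.coind_eq_zero M 0) x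
  obtain ⟨r, s, -, hs, -⟩ := h.exists_splitting
  let f₀ : Coh.shift.{v, w} M := (f.1 : ℤ → Coh.shift.{v, w} M) 0
  obtain ⟨k, b, hk, hb, hbc⟩ := hM.coind₁.exists_nsmul_invariant (Coh.toShift M)
    (D.degHom.ker.map (D.toGroup : W →* G)) (s f₀) (by
      rintro _ ⟨w, hw, rfl⟩
      rw [hom_comm_apply, hs]
      have := D.coe_coind_invariant f w 0
      rw [show D.deg w = 0 from congr_arg Multiplicative.toAdd hw] at this
      exact this)
  refine ⟨k, hk, ?_⟩
  rw [← map_nsmul, hJ.invariantδ_eq_zero_iff]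
  let F : ℤ → C(G, M) := fun z => (D.resFunctor.obj M.coind₁).ρ (D.gen ^ z) b
  refine ⟨⟨F, fun w => funext fun z => ?_⟩, funext fun z => ?_⟩
  · change ((D.resFunctor.obj M.coind₁).ρ w * (D.resFunctor.obj M.coind₁).ρ (D.gen ^
      (z - D.deg w))) b =
      (D.resFunctor.obj M.coind₁).ρ (D.gen ^ z) b
    -- Moving `w` past the power of `gen` leaves an element of degree zero, and such elements fix
    -- `b`.
    have hdeg : D.gen ^ (-z) * w * D.gen ^ (z - D.deg w) ∈ D.degHom.ker :=
      congr_arg Multiplicative.ofAdd (by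
        rw [D.deg_mul, D.deg_mul, D.deg_gen_zpow, D.deg_gen_zpow]; ring :
          D.deg (D.gen ^ (-z) * w * D.gen ^ (z - D.deg w)) = 0)
    rw [← map_mul, show w * D.gen ^ (z - D.deg w) =
      D.gen ^ z * (D.gen ^ (-z) * w * D.gen ^ (z - D.deg w)) by
        rw [mul_assoc (D.gen ^ (-z)), ← mul_assoc, ← zpow_add, add_neg_cancel, zpow_zero, one_mul],
      map_mul]
    exact congr_arg ((D.resFunctor.obj M.coind₁).ρ (D.gen ^ z)) (hb _ ⟨_, hdeg, rfl⟩)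
  · change Coh.toShift M (M.coind₁.ρ (D.toGroup (D.gen ^ z)) b) =
      (k • f.1 : ℤ → Coh.shift.{v, w} M) z
    rw [hom_comm_apply, hbc, hs, map_nsmul]
    exact congr_arg (k • ·) (D.coind_invariant_eq_gen f z).symm

end Restriction

end DegreeDatum

/-! ### Tensor products with `ℚ / ℤ` -/

section RatTensor

variable {L V T : Type*} [AddCommGroup L] [AddCommGroup V] [AddCommGroup T]

/-- Scalar multiplication by rational numbers on a uniquely divisible group. -/
def ratSMul (hV : ∀ k : ℕ, k ≠ 0 → Function.Bijective fun v : V => k • v) (v : V) (q : ℚ) : V :=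
  ((hV q.den q.den_nz).2 (q.num • v)).choose

variable (hV : ∀ k : ℕ, k ≠ 0 → Function.Bijective fun v : V => k • v)

theorem nsmul_ratSMul (v : V) {q : ℚ} {n : ℕ} {m : ℤ} (h : q * n = m) :
    n • ratSMul hV v q = m • v := by
  have h₁ : q.den • ratSMul hV v q = q.num • v := ((hV q.den q.den_nz).2 (q.num • v)).choose_spec
  refine (hV q.den q.den_nz).1 ?_
  have h₂ : (n : ℤ) * q.num = q.den * m := by
    have := q.num_div_den
    have h₃ : (q.den : ℚ) ≠ 0 := Nat.cast_ne_zero.2 q.den_nz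
    rw [← this, div_mul_eq_mul_div, div_eq_iff h₃] at h
    rw [mul_comm, mul_comm _ m]
    exact_mod_cast h
  calc q.den • n • ratSMul hV v q = n • q.den • ratSMul hV v q := smul_comm _ _ _
    _ = ((n : ℤ) * q.num) • v := by rw [h₁, mul_smul, natCast_zsmul]
    _ = q.den • m • v := by rw [h₂, mul_smul, natCast_zsmul]

theorem eq_ratSMul_iff {v x : V} {q : ℚ} {n : ℕ} (hn : n ≠ 0) {m : ℤ} (h : q * n = m) :
    x = ratSMul hV v q ↔ n • x = m • v :=
  ⟨fun hx => hx ▸ nsmul_ratSMul hV v h, fun hx =>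
    (hV n hn).1 (hx.trans (nsmul_ratSMul hV v h).symm)⟩

/-- Scalar multiplication as a biadditive map. -/
def ratSMulHom : V →+ ℚ →+ V :=
  AddMonoidHom.mk'
    (fun v => AddMonoidHom.mk' (ratSMul hV v) fun q r => by
      symm
      have h₁ : q * (q.den * r.den : ℕ) = (q.num * r.den : ℤ) := by
        push_cast; rw [← mul_assoc, Rat.mul_den_eq_num]
      have h₂ : r * (q.den * r.den : ℕ) = (r.num * q.den : ℤ) := by
        push_cast; rw [mul_comm (q.den : ℚ), ← mul_assoc, Rat.mul_den_eq_num]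
      rw [eq_ratSMul_iff hV (n := q.den * r.den) (by simp)
        (m := q.num * r.den + r.num * q.den) (by rw [add_mul, h₁, h₂, Int.cast_add]), nsmul_add,
        nsmul_ratSMul hV v h₁, nsmul_ratSMul hV v h₂, add_smul])
    fun v v₂ => AddMonoidHom.ext fun q => by
      symm
      have h : q * (q.den : ℕ) = q.num := Rat.mul_den_eq_num q
      exact (eq_ratSMul_iff hV q.den_nz h).2
        ((smul_add _ _ _).trans ((congr_arg₂ _ (nsmul_ratSMul hV v h)
          (nsmul_ratSMul hV v₂ h)).trans (smul_add _ _ _).symm))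

theorem map_ratSMul {V' : Type*} [AddCommGroup V']
    (hV' : ∀ k : ℕ, k ≠ 0 → Function.Bijective fun v : V' => k • v) (f : V →+ V') (v : V) (q : ℚ) :
    f (ratSMul hV v q) = ratSMul hV' (f v) q := by
  have h : q * (q.den : ℕ) = q.num := Rat.mul_den_eq_num q
  rw [eq_ratSMul_iff hV' q.den_nz h, ← map_nsmul, nsmul_ratSMul hV v h, map_zsmul]

theorem ratSMul_one (v : V) : ratSMul hV v 1 = v :=
  ((eq_ratSMul_iff hV one_ne_zero (m := 1) (by simp)).2 (by simp)).symm

variable (i : L →+ V) (p : V →+ T) (hpi : ∀ x, p (i x) = 0)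

/-- The map `x ⊗ q ↦ p (q • i x)`, where `p ∘ i = 0`. -/
def ratTensorMap : L ⊗[ℤ] AddCircle (1 : ℚ) →+ T :=
  TensorProduct.liftAddHom
    (AddMonoidHom.mk' (fun x => QuotientAddGroup.lift (AddSubgroup.zmultiples (1 : ℚ))
        (p.comp (ratSMulHom hV (i x))) (by
          rw [AddSubgroup.zmultiples_le]
          change p (ratSMul hV (i x) 1) = 0
          rw [ratSMul_one, hpi]))
      fun x y => QuotientAddGroup.addMonoidHom_ext _ (AddMonoidHom.ext fun q => by
        change p (ratSMulHom hV (i (x + y)) q) = p (ratSMulHom hV (i x) q) + p (ratSMulHom hV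
          (i y) q)
        rw [map_add, map_add, AddMonoidHom.add_apply, map_add]))
    fun r x y => by rw [map_zsmul, map_zsmul]; rfl

theorem ratTensorMap_tmul (x : L) (q : ℚ) :
    ratTensorMap hV i p hpi (x ⊗ₜ (q : AddCircle (1 : ℚ))) = p (ratSMul hV (i x) q) :=
  rfl

/-- Common denominators reduce every tensor to a pure one with second factor `1 / n`. -/
theorem exists_eq_tmul_inv (z : L ⊗[ℤ] AddCircle (1 : ℚ)) :
    ∃ (x : L) (n : ℕ), n ≠ 0 ∧ z = x ⊗ₜ (((n : ℚ)⁻¹ : ℚ) : AddCircle (1 : ℚ)) := by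
  have key (x : L) (m : ℤ) (q : ℚ) : (m • x) ⊗ₜ[ℤ] (q : AddCircle (1 : ℚ)) =
      x ⊗ₜ ((m * q : ℚ) : AddCircle (1 : ℚ)) := by
    rw [TensorProduct.smul_tmul, ← zsmul_eq_mul]
    rfl
  induction z with
  | zero => exact ⟨0, 1, one_ne_zero, (TensorProduct.zero_tmul _ _).symm⟩
  | tmul x q =>
    induction q using QuotientAddGroup.induction_on with | H q => ?_
    refine ⟨q.num • x, q.den, q.den_nz, ?_⟩
    rw [key, ← div_eq_mul_inv, Rat.num_div_den]
  | add a b ha hb =>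
    obtain ⟨x, n, hn, rfl⟩ := ha
    obtain ⟨y, m, hm, rfl⟩ := hb
    refine ⟨(m : ℤ) • x + (n : ℤ) • y, n * m, mul_ne_zero hn hm, ?_⟩
    have hn' : (n : ℚ) ≠ 0 := Nat.cast_ne_zero.2 hn
    have hm' : (m : ℚ) ≠ 0 := Nat.cast_ne_zero.2 hm
    rw [TensorProduct.add_tmul, key, key]
    congr 4 <;> push_cast <;> field_simp

theorem tmul_eq_zero_of_nsmul {x : L} {k : ℕ} (hk : k ≠ 0) (hx : k • x = 0)
    (q : AddCircle (1 : ℚ)) : x ⊗ₜ[ℤ] q = 0 := by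
  induction q using QuotientAddGroup.induction_on with | H q => ?_
  have hk' : (k : ℚ) ≠ 0 := Nat.cast_ne_zero.2 hk
  have h₁ : (q : AddCircle (1 : ℚ)) = (k : ℤ) • ((q / k : ℚ) : AddCircle (1 : ℚ)) := by
    rw [← AddCircle.coe_zsmul, zsmul_eq_mul, Int.cast_natCast, mul_div_cancel₀ q hk']
  rw [h₁, ← TensorProduct.smul_tmul, natCast_zsmul, hx, TensorProduct.zero_tmul]

theorem nsmul_tmul_inv (x : L) (n : ℕ) :
    (n • x) ⊗ₜ[ℤ] (((n : ℚ)⁻¹ : ℚ) : AddCircle (1 : ℚ)) = 0 := by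
  rcases eq_or_ne n 0 with rfl | hn
  · rw [zero_smul, TensorProduct.zero_tmul]
  have h : (n : ℤ) • (((n : ℚ)⁻¹ : ℚ) : AddCircle (1 : ℚ)) = 0 := by
    rw [← AddCircle.coe_zsmul, zsmul_eq_mul, Int.cast_natCast,
      mul_inv_cancel₀ (Nat.cast_ne_zero.2 hn)]
    exact AddCircle.coe_period 1
  rw [← natCast_zsmul, TensorProduct.smul_tmul, h, TensorProduct.tmul_zero]

/-- A group that is the sum of its torsion subgroup and a divisible subgroup becomes trivial after
tensoring with `ℚ / ℤ`. -/
theorem eq_zero_of_torsion_add_divisible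
    (hV : ∀ k : ℕ, k ≠ 0 → Function.Bijective fun v : V => k • v) (p : V →+ T)
    (h : ∀ x : T, ∃ (k : ℕ) (v : V), k ≠ 0 ∧ k • (x - p v) = 0) (z : T ⊗[ℤ] AddCircle (1 : ℚ)) :
    z = 0 := by
  obtain ⟨x, n, hn, rfl⟩ := exists_eq_tmul_inv z
  obtain ⟨k, v, hk, hx⟩ := h x
  obtain ⟨v, rfl⟩ := (hV n hn).2 v
  dsimp only at hx
  rw [← sub_add_cancel x (p (n • v)), TensorProduct.add_tmul, tmul_eq_zero_of_nsmul hk hx,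
    map_nsmul, nsmul_tmul_inv, add_zero]

variable {i p}

theorem map_ratTensorMap {L' V' T' : Type*} [AddCommGroup L'] [AddCommGroup V'] [AddCommGroup T']
    (hV' : ∀ k : ℕ, k ≠ 0 → Function.Bijective fun v : V' => k • v) {i' : L' →+ V'} {p' : V' →+ T'}
    (hpi' : ∀ x, p' (i' x) = 0) (fL : L →+ L') (fV : V →+ V') (fT : T →+ T')
    (hi : ∀ x, fV (i x) = i' (fL x)) (hp : ∀ v, fT (p v) = p' (fV v))
    (z : L ⊗[ℤ] AddCircle (1 : ℚ)) :
    fT (ratTensorMap hV i p hpi z) =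
      ratTensorMap hV' i' p' hpi' (fL.toIntLinearMap.rTensor _ z) := by
  obtain ⟨x, n, hn, rfl⟩ := exists_eq_tmul_inv z
  rw [LinearMap.rTensor_tmul, ratTensorMap_tmul, hp, map_ratSMul hV hV', hi]
  exact (ratTensorMap_tmul hV' i' p' hpi' _ _).symm

theorem ratTensorMap_tmul_inv {x : L} {n : ℕ} (hn : n ≠ 0) {v : V} (h : n • v = i x) :
    ratTensorMap hV i p hpi (x ⊗ₜ (((n : ℚ)⁻¹ : ℚ) : AddCircle (1 : ℚ))) = p v := by
  rw [ratTensorMap_tmul]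
  refine congr_arg p ((eq_ratSMul_iff hV hn (m := 1) ?_).2 (by rw [h, one_smul])).symm
  rw [inv_mul_cancel₀ (Nat.cast_ne_zero.2 hn), Int.cast_one]

/-- If `i x / n` is killed by `p`, it equals `i y`, so `x - n • y` is torsion. Torsion dies against
the divisible group ℚ/ℤ, and `n • y` dies against `1 / n`. -/
theorem ratTensorMap_injective (hi : ∀ x, i x = 0 → ∃ k : ℕ, k ≠ 0 ∧ k • x = 0)
    (hp : ∀ v, p v = 0 → ∃ x, i x = v) : Function.Injective (ratTensorMap hV i p hpi) := by
  rw [injective_iff_map_eq_zero]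
  intro z hz
  obtain ⟨x, n, hn, rfl⟩ := exists_eq_tmul_inv z
  obtain ⟨v, hv⟩ := (hV n hn).2 (i x)
  rw [ratTensorMap_tmul_inv hV hpi hn hv] at hz
  obtain ⟨y, rfl⟩ := hp v hz
  obtain ⟨k, hk, hk'⟩ := hi (x - n • y) (by rw [map_sub, map_nsmul, sub_eq_zero]; exact hv.symm)
  rw [← sub_add_cancel x (n • y), TensorProduct.add_tmul, tmul_eq_zero_of_nsmul hk hk',
    nsmul_tmul_inv, add_zero]

theorem exists_ratTensorMap_eq (hp : ∀ v, p v = 0 → ∃ x, i x = v) {v : V} {k : ℕ} (hk : k ≠ 0)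
    (h : k • p v = 0) : ∃ z, ratTensorMap hV i p hpi z = p v := by
  obtain ⟨x, hx⟩ := hp (k • v) (by rw [map_nsmul, h])
  exact ⟨_, ratTensorMap_tmul_inv hV hpi hk hx.symm⟩

theorem exists_nsmul_ratTensorMap_eq_zero (z : L ⊗[ℤ] AddCircle (1 : ℚ)) :
    ∃ k : ℕ, k ≠ 0 ∧ k • ratTensorMap hV i p hpi z = 0 := by
  obtain ⟨x, n, hn, rfl⟩ := exists_eq_tmul_inv z
  obtain ⟨v, hv⟩ := (hV n hn).2 (i x)
  refine ⟨n, hn, ?_⟩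
  rw [ratTensorMap_tmul_inv hV hpi hn hv, ← map_nsmul]
  exact (congr_arg p hv).trans (hpi x)

end RatTensor

/-! ### Comparison of the cohomology of `G` and `W` in positive degrees. -/

namespace DegreeDatum

open TopRep

variable {G W : Type v} [Group G] [TopologicalSpace G] [IsTopologicalGroup G]
    [Group W] [TopologicalSpace W] [IsTopologicalGroup W] (D : DegreeDatum G W)
    [CompactSpace G] [LocallyCompactSpace W] {M N : TopRep.{max v w} ℤ G}

omit [LocallyCompactSpace W] [CompactSpace G] in
theorem topSplitExact_res [LocallyCompactSpace G] (hM : IsDiscreteModule.{v, w} M) :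
    Coh.TopSplitExact.{v, w} (D.resFunctor.{v, w}.map (Coh.toCoind M))
      (D.resFunctor.{v, w}.map (Coh.toShift M)) :=
  (Coh.topSplitExact_shift hM.2).res D.toGroup

/-- The difference sequence places `H^2(W, M)` between `H^1` and `H^2` of `coind M`. The first is
torsion, and the second is a quotient of `H^1` of `coind (shift M)`, torsion for the same reason. -/
theorem exists_nsmul_eq_zero_two (hM : IsDiscreteModule.{v, w} M)
    (x : Coh.{v, w} 2 (D.resFunctor.{v, w}.obj M)) : ∃ k : ℕ, k ≠ 0 ∧ k • x = 0 := by
  have h₁ := D.topSplitExact_diff (D.res_hasContinuousAction hM.2)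
  have h₂ := D.topSplitExact_coindMap (D.topSplitExact_res hM)
  obtain ⟨y, hy⟩ := (h₂.exact₁ 1 (Coh.map 2 (D.toCoind _) x)).1 (D.coind_eq_zero M 1 _)
  obtain ⟨k, hk, hk'⟩ := D.exists_nsmul_eq_zero_coind hM.shift y
  obtain ⟨z, hz⟩ := (h₁.exact₁ 1 (k • x)).1 (by rw [map_nsmul, ← hy, ← map_nsmul, hk', map_zero])
  obtain ⟨l, hl, hl'⟩ := D.exists_nsmul_eq_zero_coind hM z
  refine ⟨l * k, mul_ne_zero hl hk, ?_⟩
  rw [mul_smul, ← hz, ← map_nsmul, hl', map_zero]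

/-- A torsion class dies in the torsion-free group `H^1(W, C(G, M))`, so it is a connecting image
from degree zero, where restriction is bijective. -/
theorem exists_res_one_eq (hM : IsDiscreteModule.{v, w} M)
    {y : Coh.{v, w} 1 (D.resFunctor.{v, w}.obj M)} {k : ℕ} (hk : k ≠ 0) (hy : k • y = 0) :
    ∃ x, D.res 1 M x = y := by
  have h := Coh.topSplitExact_shift hM.2
  have h' := D.topSplitExact_res hM
  obtain ⟨c, rfl⟩ := (h'.exact₁ 0 y).1 ((D.nsmul_bijective hM hk).1 (by
    change k • Coh.map 1 _ y = k • 0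
    rw [← map_nsmul, hy, map_zero, smul_zero]))
  obtain ⟨c, rfl⟩ := (D.res_zero_bijective hM.shift).2 c
  exact ⟨h.δ 0 c, h.res_δ D.toGroup 0 c⟩

theorem res_one_injective (hM : IsDiscreteModule.{v, w} M) :
    Function.Injective (D.res.{v, w} 1 M) := by
  have h := Coh.topSplitExact_shift hM.2
  have h' := D.topSplitExact_res hM
  rw [injective_iff_map_eq_zero]
  intro x hx
  obtain ⟨c, rfl⟩ := (h.exact₁ 0 x).1 (Coh.coind₁_eq_zero M 0 _)
  obtain ⟨b, hb⟩ := (h'.exact₃ 0 _).1 ((h.res_δ D.toGroup 0 c).symm.trans hx)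
  obtain ⟨b, rfl⟩ := (D.res_zero_bijective hM.coind₁).2 b
  refine (h.exact₃ 0 c).2 ⟨b, (D.res_zero_bijective hM.shift).1 ?_⟩
  exact (Coh.res_map D.toGroup (Coh.toShift M) 0 b).trans hb

theorem range_res_one (hM : IsDiscreteModule.{v, w} M) :
    (D.res.{v, w} 1 M).range = AddCommGroup.torsion (Coh.{v, w} 1 (D.resFunctor.{v, w}.obj M)) := by
  ext y
  rw [mem_torsion_iff_exists_nsmul]
  constructor
  · rintro ⟨x, rfl⟩
    obtain ⟨k, hk, hx⟩ := hM.exists_nsmul_eq_zero x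
    exact ⟨k, hk, by rw [← map_nsmul, hx, map_zero]⟩
  · rintro ⟨k, hk, hy⟩
    exact D.exists_res_one_eq hM hk hy

/-- The homomorphism `H^1(W, M) ⊗ ℚ / ℤ → H^1(W, C(G, M) / M)`. -/
def tensorMap (hM : IsDiscreteModule.{v, w} M) :
    Coh.{v, w} 1 (D.resFunctor.{v, w}.obj M) ⊗[ℤ] AddCircle (1 : ℚ) →+
      Coh.{v, w} 1 (D.resFunctor.{v, w}.obj (Coh.shift M)) :=
  ratTensorMap (fun _ hk => D.nsmul_bijective hM hk) (Coh.map 1 (D.resFunctor.{v, w}.map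
    (Coh.toCoind M)))
    (Coh.map 1 (D.resFunctor.{v, w}.map (Coh.toShift M)))
    fun x => ((D.topSplitExact_res hM).exact₂ 1 _).2 ⟨x, rfl⟩

/-- The kernel of `H^1(W, M) → H^1(W, C(G, M))` comes from `H^1(G, M)`, hence is torsion and
invisible after tensoring with ℚ/ℤ. -/
theorem tensorMap_injective (hM : IsDiscreteModule.{v, w} M) :
    Function.Injective (D.tensorMap hM) := by
  have h := Coh.topSplitExact_shift hM.2
  have h' := D.topSplitExact_res hM
  refine ratTensorMap_injective _ _ (fun x hx => ?_) fun v hv => (h'.exact₂ 1 v).1 hv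
  obtain ⟨c, rfl⟩ := (h'.exact₁ 0 x).1 hx
  obtain ⟨c, rfl⟩ := (D.res_zero_bijective hM.shift).2 c
  obtain ⟨k, hk, hc⟩ := hM.exists_nsmul_eq_zero (h.δ 0 c)
  refine ⟨k, hk, ?_⟩
  rw [← h.res_δ D.toGroup 0 c, ← map_nsmul, hc, map_zero]

/-- Elements of the image are torsion, so they lie in the range of restriction for `shift M`. The
lift is unique by injectivity in degree one, which makes `tensorδ` additive. -/
theorem exists_res_eq_tensorMap (hM : IsDiscreteModule.{v, w} M)
    (z : Coh.{v, w} 1 (D.resFunctor.{v, w}.obj M) ⊗[ℤ] AddCircle (1 : ℚ)) :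
    ∃ t, D.res 1 _ t = D.tensorMap hM z := by
  obtain ⟨k, hk, hz⟩ := exists_nsmul_ratTensorMap_eq_zero
    (fun _ hk => D.nsmul_bijective hM hk)
    (fun x => ((D.topSplitExact_res hM).exact₂ 1 _).2 ⟨x, rfl⟩) z
  exact D.exists_res_one_eq hM.shift hk hz

/-- The homomorphism `H^1(W, M) ⊗ ℚ / ℤ → H^2(G, M)`. -/
def tensorδ (hM : IsDiscreteModule.{v, w} M) :
    Coh.{v, w} 1 (D.resFunctor.{v, w}.obj M) ⊗[ℤ] AddCircle (1 : ℚ) →+ Coh.{v, w} 2 M :=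
  ((Coh.topSplitExact_shift hM.2).δ 1).comp
    (AddMonoidHom.mk' (fun z => (D.exists_res_eq_tensorMap hM z).choose) fun a b =>
      D.res_one_injective hM.shift
        ((D.exists_res_eq_tensorMap hM (a + b)).choose_spec.trans ((map_add _ a b).trans
          ((congr_arg₂ _ (D.exists_res_eq_tensorMap hM a).choose_spec.symm
            (D.exists_res_eq_tensorMap hM b).choose_spec.symm).trans (map_add _ _ _).symm))))

theorem tensorδ_eq (hM : IsDiscreteModule.{v, w} M)
    {z : Coh.{v, w} 1 (D.resFunctor.{v, w}.obj M) ⊗[ℤ] AddCircle (1 : ℚ)} {t : Coh.{v, w} 1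
      (Coh.shift M)}
    (h : D.res 1 _ t = D.tensorMap hM z) :
    D.tensorδ hM z = (Coh.topSplitExact_shift hM.2).δ 1 t :=
  congr_arg ((Coh.topSplitExact_shift hM.2).δ 1) (D.res_one_injective hM.shift
    ((D.exists_res_eq_tensorMap hM z).choose_spec.trans h.symm))

theorem tensorδ_injective (hM : IsDiscreteModule.{v, w} M) :
    Function.Injective (D.tensorδ hM) := by
  rw [injective_iff_map_eq_zero]
  intro z hz
  obtain ⟨t, ht⟩ := D.exists_res_eq_tensorMap hM z
  rw [D.tensorδ_eq hM ht] at hz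
  obtain ⟨b, rfl⟩ := ((Coh.topSplitExact_shift hM.2).exact₃ 1 t).1 hz
  rw [Coh.coind₁_eq_zero M 0 b, map_zero, map_zero] at ht
  exact D.tensorMap_injective hM (ht.symm.trans (map_zero _).symm)

/-- Under `H^2(G, M) = H^1(G, shift M)`, the kernel of restriction consists of the torsion classes
of `H^1(W, shift M)` coming from `H^1(W, C(G, M))`, which are exactly the values of `tensorMap`. -/
theorem exact_tensorδ (hM : IsDiscreteModule.{v, w} M) :
    Function.Exact (D.tensorδ hM) (D.res.{v, w} 2 M) := by
  have h := Coh.topSplitExact_shift hM.2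
  have h' := D.topSplitExact_res hM
  intro y
  constructor
  · intro hy
    obtain ⟨t, rfl⟩ := (h.exact₁ 1 y).1 (Coh.coind₁_eq_zero M 1 _)
    obtain ⟨b, hb⟩ := (h'.exact₃ 1 _).1 ((h.res_δ D.toGroup 1 t).symm.trans hy)
    obtain ⟨k, hk, hkt⟩ := hM.shift.exists_nsmul_eq_zero t
    obtain ⟨z, hz⟩ := exists_ratTensorMap_eq (fun _ hk => D.nsmul_bijective hM hk)
      (fun x => ((D.topSplitExact_res hM).exact₂ 1 _).2 ⟨x, rfl⟩) (fun v hv => (h'.exact₂ 1 v).1 hv)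
      (v := b) hk (by rw [hb]; exact (map_nsmul _ _ _).symm.trans (by rw [hkt, map_zero]))
    exact ⟨z, D.tensorδ_eq hM (hb.symm.trans hz.symm)⟩
  · rintro ⟨z, rfl⟩
    obtain ⟨t, ht⟩ := D.exists_res_eq_tensorMap hM z
    rw [D.tensorδ_eq hM ht]
    refine (h.res_δ D.toGroup 1 t).trans ((h'.exact₃ 1 _).2 ?_)
    obtain ⟨x, n, hn, rfl⟩ := exists_eq_tmul_inv z
    exact ⟨_, (ratTensorMap_tmul _ _ _ _ _ _).symm.trans ht.symm⟩

/-- The connecting image of `t` is killed by some `k`, so `k • t` comes from `H^1(W, C(G, M))`;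
dividing there by `k` corrects `t` to a torsion class. This gives both surjectivity in degree two
and injectivity in degree three. -/
theorem exists_torsion_add (hM : IsDiscreteModule.{v, w} M)
    (t : Coh.{v, w} 1 (D.resFunctor.{v, w}.obj (Coh.shift M))) :
    ∃ (k : ℕ) (b : Coh.{v, w} 1 (D.resFunctor.{v, w}.obj M.coind₁)), k ≠ 0 ∧
      k • (t - Coh.map 1 (D.resFunctor.{v, w}.map (Coh.toShift M)) b) = 0 := by
  have h' := D.topSplitExact_res hM
  obtain ⟨k, hk, hy⟩ := D.exists_nsmul_eq_zero_two hM (h'.δ 1 t)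
  rw [← map_nsmul] at hy
  obtain ⟨b, hb⟩ := (h'.exact₃ 1 _).1 hy
  obtain ⟨b, rfl⟩ := (D.nsmul_bijective hM hk).2 b
  exact ⟨k, b, hk, by rw [smul_sub, ← map_nsmul, hb, sub_self]⟩

theorem res_two_surjective (hM : IsDiscreteModule.{v, w} M) :
    Function.Surjective (D.res.{v, w} 2 M) := by
  have h := Coh.topSplitExact_shift hM.2
  have h' := D.topSplitExact_res hM
  intro y
  obtain ⟨t, rfl⟩ := (h'.exact₁ 1 y).1 (D.res_coind₁_eq_zero hM 0 _)
  obtain ⟨k, b, hk, hb⟩ := D.exists_torsion_add hM t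
  obtain ⟨t', ht'⟩ := D.exists_res_one_eq hM.shift hk hb
  refine ⟨h.δ 1 t', (h.res_δ D.toGroup 1 t').trans ?_⟩
  have := (h'.exact₃ 1 _).2 ⟨b, rfl⟩
  change h'.δ 1 (D.res 1 _ t') = _
  rw [ht', map_sub, this, sub_zero]

theorem res_coind₁_eq_zero_of_two_le (hM : IsDiscreteModule.{v, w} M) {n : ℕ} (hn : 2 ≤ n)
    (x : Coh.{v, w} n (D.resFunctor.{v, w}.obj M.coind₁)) : x = 0 := by
  obtain ⟨n, rfl⟩ := Nat.exists_eq_add_of_le' hn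
  exact D.res_coind₁_eq_zero hM n x

theorem res_succ_bijective (hM : IsDiscreteModule.{v, w} M) {n : ℕ} (hn : 2 ≤ n)
    (h₁ : Function.Bijective (D.res.{v, w} n (Coh.shift M))) :
    Function.Bijective (D.res.{v, w} (n + 1) M) := by
  have h := Coh.topSplitExact_shift hM.2
  have h' := D.topSplitExact_res hM
  constructor
  · rw [injective_iff_map_eq_zero]
    intro x hx
    obtain ⟨c, rfl⟩ := (h.exact₁ n x).1 (Coh.coind₁_eq_zero M _ _)
    obtain ⟨b, hb⟩ := (h'.exact₃ n _).1 ((h.res_δ D.toGroup n c).symm.trans hx)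
    rw [D.res_coind₁_eq_zero_of_two_le hM hn b, map_zero] at hb
    rw [h₁.1 (hb.symm.trans (map_zero _).symm), map_zero]
  · intro y
    obtain ⟨c, rfl⟩ := (h'.exact₁ n y).1 (D.res_coind₁_eq_zero_of_two_le hM (by omega) _)
    obtain ⟨c, rfl⟩ := h₁.2 c
    exact ⟨h.δ n c, h.res_δ D.toGroup n c⟩

/-- After one shift only the degree-two kernel `H^1(W, shift M) ⊗ ℚ/ℤ` is in the way, and it
vanishes because `H^1(W, shift M)` is torsion plus divisible. -/
theorem res_three_bijective (hM : IsDiscreteModule.{v, w} M) :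
    Function.Bijective (D.res.{v, w} 3 M) := by
  refine D.res_succ_bijective hM le_rfl ⟨?_, D.res_two_surjective hM.shift⟩
  rw [injective_iff_map_eq_zero]
  intro x hx
  obtain ⟨z, rfl⟩ := (D.exact_tensorδ hM.shift x).1 hx
  rw [eq_zero_of_torsion_add_divisible (fun _ hk => D.nsmul_bijective hM hk) _
    (D.exists_torsion_add hM) z, map_zero]

theorem res_bijective (hM : IsDiscreteModule.{v, w} M) {i : ℕ} (hi : 3 ≤ i) :
    Function.Bijective (D.res.{v, w} i M) := by
  induction i, hi using Nat.le_induction generalizing M with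
  | base => exact D.res_three_bijective hM
  | succ n hn ih => exact D.res_succ_bijective hM (by omega) (ih hM.shift)

theorem map_tensorδ (hM : IsDiscreteModule.{v, w} M) (hN : IsDiscreteModule.{v, w} N) (f : M ⟶ N)
    (z : Coh.{v, w} 1 (D.resFunctor.{v, w}.obj M) ⊗[ℤ] AddCircle (1 : ℚ)) :
    Coh.map 2 f (D.tensorδ hM z) = D.tensorδ hN
      ((Coh.map.{v, w} 1 (D.resFunctor.{v, w}.map f)).toIntLinearMap.rTensor _ z) := by
  obtain ⟨t, ht⟩ := D.exists_res_eq_tensorMap hM z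
  rw [D.tensorδ_eq hM ht, (Coh.topSplitExact_shift hM.2).map_δ (Coh.topSplitExact_shift hN.2) f
    (Coh.coind₁Map f) (Coh.shiftMap f) (Coh.coind₁Map_toCoind f) (Coh.shiftMap_toShift f)]
  symm
  refine D.tensorδ_eq hN ?_
  refine (Coh.res_map D.toGroup (Coh.shiftMap f) 1 t).trans ?_
  refine (congr_arg _ ht).trans ?_
  refine map_ratTensorMap _ _ _ _ (Coh.map 1 (D.resFunctor.{v, w}.map f))
    (Coh.map 1 (D.resFunctor.{v, w}.map (Coh.coind₁Map f))) (Coh.map 1 (D.resFunctor.{v, w}.map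
      (Coh.shiftMap f)))
    (fun x => ?_) (fun x => ?_) z
  · exact Coh.map_comm.{v, w} (D.resFunctor.{v, w}.map (Coh.toCoind M)) (D.resFunctor.{v, w}.map
      (Coh.coind₁Map f))
      (D.resFunctor.{v, w}.map f) (D.resFunctor.{v, w}.map (Coh.toCoind N))
        (fun y => Coh.coind₁Map_toCoind f y) 1 x
  · exact Coh.map_comm.{v, w} (D.resFunctor.{v, w}.map (Coh.toShift M)) (D.resFunctor.{v, w}.map
      (Coh.shiftMap f))
      (D.resFunctor.{v, w}.map (Coh.coind₁Map f)) (D.resFunctor.{v, w}.map (Coh.toShift N))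
        (fun y => Coh.shiftMap_toShift f y) 1 x

end DegreeDatum

/-! ### Construction of degree data -/

open Topology

/-- The kernel of the degree is open, and `g ↦ kerPart g * (kerPart 1)⁻¹` inverts `toGroup` on it,
so it lies in a continuous image of the compact group `G`. -/
theorem DegreeDatum.locallyCompactSpace {G W : Type v} [Group G] [TopologicalSpace G]
    [IsTopologicalGroup G] [Group W] [TopologicalSpace W] [IsTopologicalGroup W] [CompactSpace G]
    (D : DegreeDatum G W) : LocallyCompactSpace W := by
  have h : IsCompact ((fun g => D.kerPart g * (D.kerPart 1)⁻¹) '' Set.univ) :=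
    isCompact_univ.image (D.kerPart.continuous.mul continuous_const)
  refine h.locallyCompactSpace_of_mem_nhds_of_group (x := 1) (Filter.mem_of_superset
    (((isOpen_discrete {0}).preimage D.continuous_deg).mem_nhds D.deg_one) fun w hw => ?_)
  refine ⟨D.toGroup w, trivial, ?_⟩
  have h := D.kerPart_mul w 1
  rw [show D.deg w = 0 from hw, neg_zero, zpow_zero, mul_one, mul_one] at h
  change D.kerPart _ * _ = w
  rw [h, mul_inv_cancel_right]

section Procyclic

variable {Γ : Type*} [Group Γ] [TopologicalSpace Γ] [IsTopologicalGroup Γ]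

theorem exists_zpow_mem_of_isOpen {Φ : Γ} (hΦ : Dense (Subgroup.zpowers Φ : Set Γ)) {U : Subgroup Γ}
    (hU : IsOpen (U : Set Γ)) (x : Γ) : ∃ k : ℤ, x⁻¹ * Φ ^ k ∈ U := by
  obtain ⟨_, hy, ⟨k, rfl⟩⟩ := hΦ.inter_open_nonempty ((fun y => x⁻¹ * y) ⁻¹' (U : Set Γ))
    (hU.preimage (continuous_const_mul _)) ⟨x, by simp [U.one_mem]⟩
  exact ⟨k, hy⟩

/-- By density every coset of `U` contains a power of `Φ`, and its exponent is determined mod `m`.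
-/
theorem exists_isLocallyConstant_zmod {Φ : Γ} (hΦ : Dense (Subgroup.zpowers Φ : Set Γ))
    {m : ℕ} {U : Subgroup Γ} (hU : IsOpen (U : Set Γ)) (hUΦ : ∀ k : ℤ, Φ ^ k ∈ U ↔ (m : ℤ) ∣ k) :
    ∃ χ : Γ → ZMod m, IsLocallyConstant χ ∧ (∀ k : ℤ, χ (Φ ^ k) = k) ∧ ∀ x, χ x = 0 → x ∈ U := by
  choose k hk using exists_zpow_mem_of_isOpen hΦ hU
  have key {x y : Γ} {l : ℤ} (h₁ : x⁻¹ * y ∈ U) (h₂ : y⁻¹ * Φ ^ l ∈ U) : (k x : ZMod m) = l := by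
    rw [ZMod.intCast_eq_intCast_iff_dvd_sub, ← hUΦ]
    have := U.mul_mem (U.inv_mem (hk x)) (U.mul_mem h₁ h₂)
    convert this using 1
    rw [sub_eq_neg_add, zpow_add, zpow_neg]
    group
  refine ⟨fun x => k x, ?_, fun l => key (x := Φ ^ l) (y := Φ ^ l) ?_ ?_, fun x hx => ?_⟩
  · rw [IsLocallyConstant.iff_exists_open]
    refine fun x => ⟨(fun y => x⁻¹ * y) ⁻¹' (U : Set Γ), hU.preimage (continuous_const_mul _),
      by simp [U.one_mem], fun y hy => ?_⟩
    exact (key hy (hk y)).symm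
  · rw [inv_mul_cancel]; exact U.one_mem
  · rw [inv_mul_cancel]; exact U.one_mem
  · have h₁ := (hUΦ (k x)).2 ((ZMod.intCast_zmod_eq_zero_iff_dvd _ _).1 hx)
    have h₂ := U.mul_mem h₁ (U.inv_mem (hk x))
    rwa [mul_inv_rev, inv_inv, mul_inv_cancel_left] at h₂

/-- An element of an open subgroup `U` of a group with a dense cyclic subgroup belongs to every
open subgroup that contains the powers of the generator lying in `U`. -/
theorem mem_of_forall_zpow_mem {Φ : Γ} (hΦ : Dense (Subgroup.zpowers Φ : Set Γ))
    {U V : Subgroup Γ} (hU : IsOpen (U : Set Γ)) (hV : IsOpen (V : Set Γ))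
    (h : ∀ k : ℤ, Φ ^ k ∈ U → Φ ^ k ∈ V) {x : Γ} (hx : x ∈ U) : x ∈ V := by
  have hUV : IsOpen ((U ⊓ V : Subgroup Γ) : Set Γ) := hU.inter hV
  obtain ⟨k, hk⟩ := exists_zpow_mem_of_isOpen hΦ hUV x
  have h₁ : Φ ^ k ∈ U := by simpa using U.mul_mem hx hk.1
  simpa using V.mul_mem (h k h₁) (V.inv_mem hk.2)

end Procyclic

section Profinite

variable {G : Type*} [Group G] [TopologicalSpace G] [IsTopologicalGroup G] [CompactSpace G]
  [TotallyDisconnectedSpace G]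

theorem eq_one_of_forall_mem_openNormal {x : G}
    (h : ∀ V : OpenNormalSubgroup G, x ∈ V) : x = 1 := by
  by_contra hx
  obtain ⟨V, hV⟩ := ProfiniteGrp.exist_openNormalSubgroup_sub_open_nhds_of_one
    (isOpen_compl_singleton (x := x)) (show (1 : G) ∈ ({x}ᶜ : Set G) from fun h => hx h.symm)
  exact hV (h V) rfl

omit [TotallyDisconnectedSpace G] in
theorem OpenNormalSubgroup.exists_zpow_mem (V : OpenNormalSubgroup G) :
    ∃ m : ℕ, m ≠ 0 ∧ ∀ (x : G) (k : ℤ), (m : ℤ) ∣ k → x ^ k ∈ V := by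
  have := V.toSubgroup.quotient_finite_of_isOpen V.isOpen
  have : V.toSubgroup.FiniteIndex := V.toSubgroup.finiteIndex_of_finite_quotient
  refine ⟨V.toSubgroup.index, Subgroup.FiniteIndex.index_ne_zero, fun x k ⟨l, hl⟩ => ?_⟩
  rw [hl, zpow_mul, zpow_natCast]
  exact V.toSubgroup.zpow_mem (Subgroup.pow_index_mem _ x) l

end Profinite

/-- On the compact closure of the powers of `t` the map `q` is a closed embedding, and its closed
image contains a dense part of the range of `q`. It can therefore be inverted continuously over that
range. -/
theorem exists_continuous_section {G A : Type*} [Group G] [TopologicalSpace G]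
    [IsTopologicalGroup G] [CompactSpace G] [Group A] [TopologicalSpace A] [T2Space A]
    (q : G →* A) (hq : Continuous q) (t : G) (ht : DenseRange
      fun k : ℤ => Set.rangeFactorization q (t ^ k))
    (hker : ∀ x ∈ (Subgroup.zpowers t).topologicalClosure, q x = 1 → x = 1) :
    ∃ c : C(G, G), ∀ g, c g ∈ (Subgroup.zpowers t).topologicalClosure ∧ q (c g) = q g := by
  let C := (Subgroup.zpowers t).topologicalClosure
  have hC : IsClosed (C : Set G) := Subgroup.isClosed_topologicalClosure _
  have : CompactSpace C := isCompact_iff_compactSpace.1 hC.isCompact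
  have hqC : Continuous fun x : C => q x := hq.comp continuous_subtype_val
  have hemb : IsClosedEmbedding fun x : C => q x := hqC.isClosedEmbedding fun x y hxy => by
    have h := hker (x * y⁻¹ : C) (x * y⁻¹ : C).2 (by
      rw [Subgroup.coe_mul, map_mul, Subgroup.coe_inv, map_inv, show q x = q y from hxy,
        mul_inv_cancel])
    exact mul_inv_eq_one.1 (Subtype.ext h)
  have hsurj (g : G) : ∃ x : C, q x = q g := by
    have h₁ : IsClosed ((↑) ⁻¹' (Set.range fun x : C => q x) : Set (Set.range q)) :=
      hemb.isClosed_range.preimage continuous_subtype_val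
    have h₂ : closure (Set.range fun k : ℤ => Set.rangeFactorization q (t ^ k)) ⊆ _ :=
      h₁.closure_subset_iff.2 (by
        rintro _ ⟨k, rfl⟩
        exact ⟨⟨t ^ k, Subgroup.le_topologicalClosure _ ⟨k, rfl⟩⟩, rfl⟩)
    rw [ht.closure_range] at h₂
    exact h₂ (Set.mem_univ ⟨q g, g, rfl⟩)
  choose c hc using hsurj
  have hc' : Continuous c := hemb.isEmbedding.continuous_iff.2 (by
    rw [show (fun x : C => q x) ∘ c = q from funext hc]
    exact hq)
  exact ⟨⟨fun g => (c g : G), continuous_subtype_val.comp hc'⟩, fun g => ⟨(c g).2, hc g⟩⟩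

/-- The hypotheses make `Γ` a copy of the profinite completion of ℤ. A lift `t` of `Φ` gives a
continuous section `c` of the degree, and `g * (c g)⁻¹` lies in the kernel of `pr`, hence in `W`;
this is `kerPart`. -/
theorem exists_degreeDatum {G Γ W : Type v} {S : Type*} [Group G] [TopologicalSpace G]
    [IsTopologicalGroup G] [CompactSpace G] [TotallyDisconnectedSpace G]
    [Group Γ] [TopologicalSpace Γ] [IsTopologicalGroup Γ] [CompactSpace Γ]
    [TotallyDisconnectedSpace Γ] [Group W] [TopologicalSpace W] [IsTopologicalGroup W]
    (pr : G →ₜ* Γ) (hpr : Function.Surjective pr) {Φ : Γ}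
    (hΦ : Dense (Subgroup.zpowers Φ : Set Γ))
    (hU : ∀ m : ℕ, m ≠ 0 → ∃ U : Subgroup Γ, IsOpen (U : Set Γ) ∧ ∀ k : ℤ, Φ ^ k ∈ U ↔ (m : ℤ) ∣ k)
    (j : W →ₜ* G) (hj : Function.Injective j)
    (hjr : ∀ g, g ∈ Set.range j ↔ pr g ∈ Subgroup.zpowers Φ)
    (π : W → S) (i : S → Γ) (hi : Function.Injective i) (hπ : ∀ w, i (π w) = pr (j w))
    (hW : ‹TopologicalSpace W› = TopologicalSpace.induced j ‹_› ⊓ TopologicalSpace.induced π ⊥) :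
    ∃ D : DegreeDatum G W, D.toGroup = j := by
  have hΦ₀ (k : ℤ) (h : Φ ^ k = 1) : k = 0 := by
    by_contra hk
    obtain ⟨U, -, h₂⟩ := hU (k.natAbs + 1) (by omega)
    have h₃ := (h₂ k).1 (h ▸ U.one_mem)
    have := Int.natAbs_dvd_natAbs.2 h₃
    have := Nat.le_of_dvd (by omega) this
    omega
  have hΦ_inj {k l : ℤ} (h : Φ ^ k = Φ ^ l) : k = l :=
    sub_eq_zero.1 (hΦ₀ _ (by rw [zpow_sub, h, mul_inv_cancel]))
  have hdeg (w : W) : ∃ k : ℤ, Φ ^ k = pr (j w) := (hjr _).1 ⟨w, rfl⟩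
  choose deg hdeg using hdeg
  have hdeg_mul (a b : W) : deg (a * b) = deg a + deg b :=
    hΦ_inj (by rw [hdeg, map_mul, map_mul, zpow_add, hdeg, hdeg])
  -- Maps into `W` whose image in `Γ` is constant ignore the discrete factor of the topology, so
  -- continuity into `G` suffices.
  have hcont {X : Type v} [TopologicalSpace X] (f : X → W) (h₁ : Continuous fun x => j (f x))
      (h₂ : ∀ x y, pr (j (f x)) = pr (j (f y))) : Continuous f := by
    rw [hW]
    refine continuous_inf_rng.2 ⟨continuous_induced_rng.2 h₁, continuous_induced_rng.2 ?_⟩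
    have h₃ : ∀ x y, (π ∘ f) x = (π ∘ f) y := fun x y =>
      hi ((hπ _).trans ((h₂ x y).trans (hπ _).symm))
    exact @continuous_of_const _ _ _ ⊥ _ h₃
  have hdeg_cont : Continuous deg := by
    let _ : TopologicalSpace S := ⊥
    have : DiscreteTopology S := ⟨rfl⟩
    have h₁ : Continuous π := continuous_iff_le_induced.2 (hW.le.trans inf_le_right)
    have h₂ : ∀ a b, π a = π b → deg a = deg b := fun a b h =>
      hΦ_inj (by rw [hdeg, hdeg, ← hπ, ← hπ, h])
    refine continuous_def.2 fun s _ => ?_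
    have : deg ⁻¹' s = π ⁻¹' (π '' (deg ⁻¹' s)) :=
      Set.Subset.antisymm (Set.subset_preimage_image _ _) fun a ⟨b, hb, hab⟩ => by
        rw [Set.mem_preimage, ← h₂ _ _ hab]
        exact hb
    rw [this]
    exact (isOpen_discrete _).preimage h₁
  obtain ⟨t₀, ht₀⟩ := hpr Φ
  obtain ⟨t, rfl⟩ := (hjr t₀).2 (ht₀ ▸ Subgroup.mem_zpowers Φ)
  have hdeg_t : deg t = 1 := hΦ_inj (by rw [hdeg, ht₀, zpow_one])
  have hdense : DenseRange j := by
    have h₁ : IsOpenQuotientMap pr := MonoidHom.isOpenQuotientMap_of_isQuotientMap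
      (pr.continuous_toFun.isClosedMap.isQuotientMap pr.continuous_toFun hpr)
    have h₂ := hΦ.preimage h₁.isOpenMap
    have h₃ : pr ⁻¹' (Subgroup.zpowers Φ : Set Γ) = Set.range j := Set.ext fun g => (hjr g).symm
    rwa [h₃] at h₂
  -- Additivity extends from `W` to `G` by density. The last clause will show that an element on
  -- which all the `χ` vanish is trivial in `Γ`.
  have hχ (m : ℕ) (hm : m ≠ 0) : ∃ χ : G → ZMod m, IsLocallyConstant χ ∧
      (∀ a b, χ (a * b) = χ a + χ b) ∧ (∀ w, χ (j w) = deg w) ∧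
        ∀ V : OpenNormalSubgroup Γ, (∀ k : ℤ, (m : ℤ) ∣ k → Φ ^ k ∈ V) →
          ∀ x, χ x = 0 → pr x ∈ V := by
    obtain ⟨U, h₁, h₂⟩ := hU m hm
    obtain ⟨χ, h₃, h₄, h₅⟩ := exists_isLocallyConstant_zmod hΦ h₁ h₂
    have h₆ : IsLocallyConstant (χ ∘ pr) := h₃.comp_continuous pr.continuous_toFun
    have h₇ (w : W) : χ (pr (j w)) = deg w := by rw [← hdeg, h₄]
    refine ⟨χ ∘ pr, h₆, fun a b => ?_, h₇, fun V hV x hx =>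
      mem_of_forall_zpow_mem hΦ h₁ V.isOpen (fun k hk => hV k ((h₂ k).1 hk)) (h₅ _ hx)⟩
    have h₈ : (fun p : G × G => χ (pr (p.1 * p.2))) = fun p => χ (pr p.1) + χ (pr p.2) :=
      (hdense.prodMap hdense).equalizer (h₆.continuous.comp continuous_mul)
        ((h₆.continuous.comp continuous_fst).add (h₆.continuous.comp continuous_snd))
        (funext fun p => by
          change χ (pr (j p.1 * j p.2)) = χ (pr (j p.1)) + χ (pr (j p.2))
          rw [← map_mul, h₇, h₇, h₇, hdeg_mul, Int.cast_add])
    exact congr_fun h₈ (a, b)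
  choose χ hχ_const hχ_mul hχ_deg hχ_mem using hχ
  let q : G →* ∀ m : {m : ℕ // m ≠ 0}, Multiplicative (ZMod m) :=
    MonoidHom.mk' (fun g m => .ofAdd (χ m m.2 g)) fun a b => funext fun m =>
      congr_arg _ (hχ_mul m m.2 a b)
  have hq : Continuous q := continuous_pi fun m =>
    (hχ_const m m.2).continuous
  have hq_one {g : G} : q g = 1 ↔ ∀ (m : ℕ) (hm : m ≠ 0), χ m hm g = 0 :=
    ⟨fun h m hm => congr_fun h ⟨m, hm⟩, fun h => funext fun m => h m m.2⟩
  have hq_j (w : W) : q (j w) = q (j t ^ deg w) := by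
    have h : deg (t ^ deg w) = deg w := hΦ_inj (by
      rw [hdeg, map_zpow, map_zpow, ht₀])
    exact funext fun m => congr_arg Multiplicative.ofAdd (by
      rw [← map_zpow, hχ_deg, hχ_deg, h])
  have hq_pr {g : G} (h : q g = 1) : pr g = 1 := eq_one_of_forall_mem_openNormal fun V => by
    obtain ⟨m, hm, hmV⟩ := V.exists_zpow_mem
    exact hχ_mem m hm V (hmV Φ) g (hq_one.1 h m hm)
  -- Given an open normal `V`, take `m` such that all `m`-th powers lie in `V`, and approximate `x`
  -- modulo `V` by a power `j t ^ k` with `χ m` zero. Then `m ∣ k`, so the power and hence `x` lie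
  -- in `V`.
  have hq_ker : ∀ x ∈ (Subgroup.zpowers (j t)).topologicalClosure, q x = 1 → x = 1 := by
    refine fun x hx h => eq_one_of_forall_mem_openNormal fun V => ?_
    obtain ⟨m, hm, hmV⟩ := V.exists_zpow_mem
    obtain ⟨_, ⟨hy, hy'⟩, ⟨k, rfl⟩⟩ := mem_closure_iff.1 hx
      ((fun y => x * y⁻¹) ⁻¹' (V : Set G) ∩ χ m hm ⁻¹' {0})
      ((V.isOpen.preimage (continuous_const.mul continuous_inv)).inter
        (hχ_const m hm {0}))
      ⟨by simp, hq_one.1 h m hm⟩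
    have hk : (m : ℤ) ∣ k := by
      rw [← ZMod.intCast_zmod_eq_zero_iff_dvd, ← (show χ m hm (j t ^ k) = 0 from hy'), ← map_zpow,
        hχ_deg]
      congr 1
      exact hΦ_inj (by rw [hdeg, map_zpow, map_zpow, ht₀])
    have h₁ := V.toSubgroup.mul_mem hy (hmV (j t) k hk)
    rwa [inv_mul_cancel_right] at h₁
  obtain ⟨c, hc⟩ := exists_continuous_section q hq (j t) (by
    have h₁ : DenseRange (Set.rangeFactorization q ∘ j) :=
      Set.rangeFactorization_surjective.denseRange.comp hdense
        (hq.subtype_mk _)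
    refine h₁.mono ?_
    rintro _ ⟨w, rfl⟩
    exact ⟨deg w, Subtype.ext (hq_j w).symm⟩) hq_ker
  have hpr_c (g : G) : pr (g * (c g)⁻¹) = 1 :=
    hq_pr (by rw [map_mul, map_inv, (hc g).2, mul_inv_cancel])
  have hc_mul (w : W) (g : G) : c (j w * g) = j t ^ deg w * c g := by
    refine mul_inv_eq_one.1 (hq_ker _ (mul_mem (hc _).1 (inv_mem (mul_mem
      (Subgroup.le_topologicalClosure _ ⟨deg w, rfl⟩) (hc g).1))) ?_)
    rw [map_mul, map_inv, (hc _).2, map_mul, map_mul, (hc g).2, hq_j, mul_inv_cancel]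
  have hker (g : G) : ∃ w, j w = g * (c g)⁻¹ := (hjr _).2 (hpr_c g ▸ Subgroup.one_mem _)
  choose ker hker using hker
  refine ⟨{ toGroup := j, denseRange := hdense, deg := deg, deg_mul := hdeg_mul,
            continuous_deg := hdeg_cont, gen := t, deg_gen := hdeg_t,
            kerPart := ⟨ker, hcont ker ?_ fun x y => ?_⟩
            kerPart_mul := fun w g => hj ?_
            exists_extension := fun m hm => ⟨χ m hm, hχ_const m hm, hχ_mul m hm, hχ_deg m hm⟩ },
              rfl⟩
  · simp only [hker]
    exact continuous_id.mul (map_continuous c).inv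
  · rw [hker, hker, hpr_c, hpr_c]
  · change j (ker (j w * g)) = j (w * ker g * t ^ (-deg w))
    rw [hker, hc_mul, map_mul, map_mul, hker, map_zpow, mul_inv_rev, zpow_neg]
    simp only [mul_assoc]

/-! ### Integral closures in algebraic extensions of a local field -/

/-- The integral elements form the unit ball of the spectral norm. That norm is multiplicative and
ultrametric, so nonunits are the elements of norm less than one and are closed under addition. -/
theorem isLocalRing_integralClosure_of_norm {R K L : Type*} [NontriviallyNormedField K]
    [IsUltrametricDist K] [CompleteSpace K] [CommRing R] [IsDomain R] [IsIntegrallyClosed R]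
    [Algebra R K] [IsFractionRing R K] [Field L] [Algebra K L] [Algebra R L] [IsScalarTower R K L]
    [Algebra.IsAlgebraic K L] (h : ∀ x : K, ‖x‖ ≤ 1 ↔ x ∈ Set.range (algebraMap R K)) :
    IsLocalRing (integralClosure R L) := by
  have hint (x : L) : IsIntegral R x ↔ spectralNorm K L x ≤ 1 := by
    have hx : IsIntegral K x := Algebra.IsIntegral.isIntegral x
    rw [spectralNorm, spectralValue_le_one_iff (minpoly.monic hx)]
    constructor
    · intro hxR n
      rw [minpoly.isIntegrallyClosed_eq_field_fractions' K hxR, Polynomial.coeff_map, h]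
      exact ⟨_, rfl⟩
    · intro hn
      have : minpoly K x ∈ Polynomial.lifts (algebraMap R K) :=
        (Polynomial.lifts_iff_coeff_lifts _).2 fun n => (h _).1 (hn n)
      obtain ⟨p, hp, -, hpm⟩ := Polynomial.lifts_and_natDegree_eq_and_monic this (minpoly.monic hx)
      refine ⟨p, hpm, ?_⟩
      rw [IsScalarTower.algebraMap_eq R K L, ← Polynomial.eval₂_map, hp]
      exact minpoly.aeval K x
  have hunit (x : integralClosure R L) (hx : x ∈ nonunits (integralClosure R L)) :
      spectralNorm K L x < 1 := by
    refine ((hint x).1 x.2).lt_of_ne fun h₁ => hx ?_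
    have hx₀ : (x : L) ≠ 0 := fun h₀ => by
      rw [h₀, spectralNorm_zero] at h₁
      exact zero_ne_one h₁
    have h₂ : spectralNorm K L (x : L)⁻¹ = 1 := by
      have := map_mul (spectralMulAlgNorm K L) (x : L) (x : L)⁻¹
      rw [mul_inv_cancel₀ hx₀, map_one] at this
      change 1 = spectralNorm K L x * spectralNorm K L (x : L)⁻¹ at this
      rw [h₁, one_mul] at this
      exact this.symm
    exact .of_mul_eq_one ⟨(x : L)⁻¹, (hint _).2 h₂.le⟩ (Subtype.ext (mul_inv_cancel₀ hx₀))
  refine IsLocalRing.of_nonunits_add fun a b ha hb hab => ?_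
  obtain ⟨u, hu⟩ := hab.exists_right_inv
  have h₁ : spectralNorm K L ((a + b : integralClosure R L) : L) < 1 :=
    (isNonarchimedean_spectralNorm (K := K) (a : L) (b : L)).trans_lt
      (max_lt (hunit a ha) (hunit b hb))
  have h₂ := map_mul (spectralMulAlgNorm K L) ((a + b : integralClosure R L) : L) u
  rw [← Subalgebra.coe_mul, hu, Subalgebra.coe_one, map_one] at h₂
  change 1 = spectralNorm K L ((a + b : integralClosure R L) : L) * spectralNorm K L u at h₂
  have := mul_lt_one_of_nonneg_of_lt_one_left (spectralNorm_nonneg _) h₁ ((hint u).1 u.2)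
  exact h₂.not_gt this

instance isLocalRing_integralClosure (K : Type*) [Field K] [ValuativeRel K] [TopologicalSpace K]
    [IsNonarchimedeanLocalField K] (L : Type*) [Field L] [Algebra K L] [Algebra.IsAlgebraic K L] :
    IsLocalRing (integralClosure 𝒪[K] L) := by
  let := IsTopologicalAddGroup.rightUniformSpace K
  have := isUniformAddGroup_of_addCommGroup (G := K)
  have hc : CompleteSpace K := inferInstance
  let : (Valued.v (R := K) (Γ₀ := ValueGroupWithZero K)).RankOne :=
  { hom' := IsRankLeOne.nonempty.some.emb (R := K).comp MonoidWithZeroHom.ValueGroup₀.embedding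
    strictMono' := IsRankLeOne.nonempty.some.strictMono.comp
        MonoidWithZeroHom.ValueGroup₀.embedding_strictMono }
  let := Valued.toNontriviallyNormedField (L := K) (Γ₀ := ValueGroupWithZero K)
  refine isLocalRing_integralClosure_of_norm (K := K) fun x => ?_
  rw [Valued.toNormedField.norm_le_one_iff]
  exact ⟨fun h => ⟨⟨x, h⟩, rfl⟩, fun ⟨y, hy⟩ => hy ▸ y.2⟩

/-- Two homomorphisms from an unramified algebra to a domain that are congruent modulo a proper
ideal are equal. -/
theorem AlgHom.ext_of_formallyUnramified {R A B : Type*} [CommRing R] [CommRing A] [IsDomain A]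
    [CommRing B] [Algebra R A] [Algebra R B] [Algebra.FormallyUnramified R B]
    [Algebra.EssFiniteType R B] {f g : B →ₐ[R] A} {Q : Ideal A} (hQ : Q ≠ ⊤)
    (h : ∀ b, f b - g b ∈ Q) : f = g := by
  let F : B ⊗[R] B →ₐ[R] A := Algebra.TensorProduct.lift f g fun _ _ => .all _ _
  have h₁ : (Ideal.Quotient.mkₐ R Q).comp F =
      ((Ideal.Quotient.mkₐ R Q).comp f).comp (Algebra.TensorProduct.lmul' R) := by
    refine Algebra.TensorProduct.ext' fun a b => ?_
    simp only [F, AlgHom.comp_apply, Algebra.TensorProduct.lift_tmul, map_mul,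
      Algebra.TensorProduct.lmul'_apply_tmul]
    rw [show Ideal.Quotient.mkₐ R Q (g b) = Ideal.Quotient.mkₐ R Q (f b) from
      (Ideal.Quotient.eq.2 (h b)).symm]
  -- The separability element of `B ⊗ B` multiplies to `1` and is killed by `1 ⊗ b - b ⊗ 1`. Modulo
  -- `Q` the map `F` factors through multiplication, so its value there is nonzero and can be
  -- cancelled in the domain `A`.
  have h₂ : F (Algebra.FormallyUnramified.elem R B) ≠ 0 := fun h₀ => by
    have := congr($h₁ (Algebra.FormallyUnramified.elem R B))
    rw [AlgHom.comp_apply, AlgHom.comp_apply, Algebra.FormallyUnramified.lmul_elem, h₀, map_zero,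
      map_one] at this
    have h₃ := Ideal.Quotient.nontrivial_iff.2 hQ
    exact zero_ne_one this
  ext b
  have h₃ := congr_arg F (Algebra.FormallyUnramified.one_tmul_sub_tmul_one_mul_elem (R := R) b)
  rw [map_mul, map_zero, map_sub] at h₃
  have h₄ := (mul_eq_zero.1 h₃).resolve_right h₂
  simp only [F, Algebra.TensorProduct.lift_tmul, map_one, one_mul, mul_one] at h₄
  exact (sub_eq_zero.1 h₄).symm

/-- An automorphism of an algebraic extension of a finite field agrees on each finite set with a
power of the Frobenius. -/
theorem exists_pow_card_eq {k l : Type*} [Field k] [Finite k] [Field l] [Algebra k l]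
    [Algebra.IsAlgebraic k l] (τ : l →ₐ[k] l) (s : Finset l) :
    ∃ n : ℕ, ∀ x ∈ s, τ x = x ^ Nat.card k ^ n := by
  let k' := IntermediateField.adjoin k (s : Set l)
  have : FiniteDimensional k k' := IntermediateField.finiteDimensional_adjoin fun x _ =>
    Algebra.IsIntegral.isIntegral x
  have : Finite k' := Module.finite_of_finite k
  have := Fintype.ofFinite k
  obtain ⟨n, hn⟩ := (FiniteField.bijective_frobeniusAlgEquivOfAlgebraic_pow k k').2
    (AlgEquiv.ofBijective (τ.restrictNormal k') (AlgHom.bijective _))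
  refine ⟨n, fun x hx => ?_⟩
  have h₁ := congr((($hn ⟨x, IntermediateField.subset_adjoin k _ hx⟩ : k') : l))
  rw [AlgEquiv.coe_ofBijective, AlgEquiv.coe_pow,
    FiniteField.coe_frobeniusAlgEquivOfAlgebraic_iterate] at h₁
  refine ((AlgHom.restrictNormal_commutes τ k' _).symm.trans h₁.symm).trans ?_
  rw [Nat.card_eq_fintype_card]
  rfl

/-! ### The action of the Galois group on the residue field -/

section Residue

variable {K : Type*} [Field K] [ValuativeRel K] [TopologicalSpace K]
  [IsNonarchimedeanLocalField K]

theorem isAlgebraic_quotient_under {R A : Type*} [CommRing R] [CommRing A] [Algebra R A]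
    [Algebra.IsIntegral R A] (Q : Ideal A) [Q.IsPrime] :
    Algebra.IsAlgebraic (R ⧸ Q.under R) (A ⧸ Q) :=
  ⟨fun x => by
    obtain ⟨x, rfl⟩ := Ideal.Quotient.mk_surjective x
    have h := (Algebra.IsIntegral.isIntegral (R := R) x).map (Ideal.Quotient.mkₐ R Q)
    exact (h.tower_top (A := R ⧸ Q.under R)).isAlgebraic⟩

theorem finite_quotient_under {A : Type*} [CommRing A] [Algebra 𝒪[K] A] [Algebra.IsIntegral 𝒪[K] A]
    (Q : Ideal A) [Q.IsMaximal] : Finite (𝒪[K] ⧸ Q.under 𝒪[K]) := by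
  have : (Q.under 𝒪[K]).IsMaximal := Ideal.isMaximal_comap_of_isIntegral_of_isMaximal Q
  rw [IsLocalRing.eq_maximalIdeal this]
  exact inferInstanceAs (Finite 𝓀[K])

variable {L : Type*} [Field L] [Algebra K L] [IsGalois K L]

omit [TopologicalSpace K] [IsNonarchimedeanLocalField K] in
theorem continuous_galois_apply (x : integralClosure 𝒪[K] L) {X : Type*} [TopologicalSpace X]
    (f : integralClosure 𝒪[K] L → X) :
    Continuous fun σ : Gal(L/K) => f ((σ.restrictScalars 𝒪[K]).mapIntegralClosure x) := by
  have h (σ : Gal(L/K)) : IsOpen {τ : Gal(L/K) | τ (x : L) = σ (x : L)} := by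
    have := (stabilizer_isOpen_of_isIntegral (K := K) (x : L)).preimage (continuous_const_mul σ⁻¹)
    convert this using 1
    ext τ
    change τ x = σ x ↔ (σ⁻¹ * τ) • (x : L) = x
    rw [mul_smul, inv_smul_eq_iff]
    rfl
  exact ((IsLocallyConstant.iff_exists_open _).2 fun σ => ⟨_, h σ, rfl, fun τ hτ =>
    congr_arg f (Subtype.ext (show τ (x : L) = σ (x : L) from hτ))⟩).continuous

/-- `𝒪[K]` is the ring of invariants of its integral closure, so for the profinite Galois group the
decomposition group surjects onto the automorphisms of the residue extension, among them the
Frobenius. -/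
theorem exists_isArithFrobAt (Q : Ideal (integralClosure 𝒪[K] L)) [hQ : Q.IsMaximal] :
    ∃ σ : Gal(L/K), (σ.restrictScalars 𝒪[K]).mapIntegralClosure.toAlgHom.IsArithFrobAt Q := by
  let A := integralClosure 𝒪[K] L
  let _ : MulSemiringAction Gal(L/K) A := IsIntegralClosure.MulSemiringAction 𝒪[K] K L A
  have hsmul (σ : Gal(L/K)) (x : A) : ((σ • x : A) : L) = σ x :=
    algebraMap_galRestrict_apply 𝒪[K] σ x
  have : SMulCommClass Gal(L/K) 𝒪[K] A := ⟨fun σ r x => Subtype.ext (by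
    rw [hsmul, Algebra.smul_def, Algebra.smul_def, Subalgebra.coe_mul, Subalgebra.coe_mul, map_mul,
      hsmul]
    congr 1
    exact σ.commutes r.1)⟩
  have : Algebra.IsInvariant 𝒪[K] A Gal(L/K) := ⟨fun x hx => by
    obtain ⟨y, hy⟩ := (InfiniteGalois.mem_range_algebraMap_iff_fixed (x : L)).2
      fun σ => (hsmul σ x).symm.trans (congr_arg _ (hx σ))
    have hy' : IsIntegral 𝒪[K] y := by
      rw [← isIntegral_algebraMap_iff (FaithfulSMul.algebraMap_injective K L), hy]
      exact x.2
    obtain ⟨z, rfl⟩ := IsIntegrallyClosed.algebraMap_eq_of_integral hy'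
    exact ⟨z, Subtype.ext hy⟩⟩
  let _ : TopologicalSpace A := ⊥
  have : DiscreteTopology A := ⟨rfl⟩
  have : ContinuousSMul Gal(L/K) A := by
    refine ⟨continuous_prod_of_discrete_right.2 fun x => ?_⟩
    exact (continuous_galois_apply x id).congr fun σ => Subtype.ext (hsmul σ x).symm
  let P := Q.under 𝒪[K]
  have hP : P.IsMaximal := Ideal.isMaximal_comap_of_isIntegral_of_isMaximal Q
  have := finite_quotient_under (K := K) Q
  let _ := Ideal.Quotient.field P
  let _ := Ideal.Quotient.field Q
  have : Algebra.IsAlgebraic (𝒪[K] ⧸ P) (A ⧸ Q) := isAlgebraic_quotient_under Q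
  have := Fintype.ofFinite (𝒪[K] ⧸ P)
  obtain ⟨σ, hσ⟩ := Ideal.Quotient.stabilizerHom_surjective_of_profinite (G := Gal(L/K)) P Q
    (FiniteField.frobeniusAlgEquivOfAlgebraic (𝒪[K] ⧸ P) (A ⧸ Q))
  refine ⟨σ, fun x => Ideal.Quotient.eq.1 ?_⟩
  have h₁ := congr($hσ (Ideal.Quotient.mk Q x))
  rw [Ideal.Quotient.stabilizerHom_apply] at h₁
  have h₂ : σ • x = (σ.1.restrictScalars 𝒪[K]).mapIntegralClosure.toAlgHom x :=
    Subtype.ext (hsmul σ.1 x)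
  rw [← h₂, map_pow, Nat.card_eq_fintype_card]
  exact h₁

theorem isArithFrobAt_pow {A B : Type*} [CommRing A] [CommRing B] [Algebra A B] {φ : B →ₐ[A] B}
    {Q : Ideal B} (h : φ.IsArithFrobAt Q) (n : ℕ) (x : B) :
    (φ ^ n) x - x ^ Nat.card (A ⧸ Q.under A) ^ n ∈ Q := by
  induction n with
  | zero => simp
  | succ n ih =>
    have h₁ := h ((φ ^ n) x)
    have h₂ := Ideal.Quotient.eq.2 ih
    rw [← Ideal.Quotient.eq] at h₁ ⊢
    rw [pow_succ', AlgHom.mul_apply, h₁, map_pow, h₂, ← map_pow, ← pow_mul, pow_succ]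

omit [TopologicalSpace K] [IsNonarchimedeanLocalField K] [IsGalois K L] in
theorem coe_mapIntegralClosure_pow (σ : Gal(L/K)) (n : ℕ) :
    ((σ ^ n).restrictScalars 𝒪[K]).mapIntegralClosure.toAlgHom =
      (σ.restrictScalars 𝒪[K]).mapIntegralClosure.toAlgHom ^ n := by
  induction n with
  | zero => rfl
  | succ n ih => rw [pow_succ, pow_succ, ← ih]; rfl

/-- By `hinj` and compactness the Galois group embeds topologically in the maps to the residue ring,
so a basic open condition involves finitely many residues, on which an automorphism agrees with a
power of the Frobenius. -/
theorem dense_zpowers_of_isArithFrobAt (Q : Ideal (integralClosure 𝒪[K] L)) [Q.IsMaximal]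
    {Φ : Gal(L/K)} (hΦ : (Φ.restrictScalars 𝒪[K]).mapIntegralClosure.toAlgHom.IsArithFrobAt Q)
    (hinj : ∀ σ τ : Gal(L/K), (∀ x, (σ.restrictScalars 𝒪[K]).mapIntegralClosure x -
      (τ.restrictScalars 𝒪[K]).mapIntegralClosure x ∈ Q) → σ = τ) :
    Dense (Subgroup.zpowers Φ : Set Gal(L/K)) := by
  let A := integralClosure 𝒪[K] L
  let _ : TopologicalSpace (A ⧸ Q) := ⊥
  have : DiscreteTopology (A ⧸ Q) := ⟨rfl⟩
  let ρ : Gal(L/K) → A → A ⧸ Q := fun σ x =>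
    Ideal.Quotient.mk Q ((σ.restrictScalars 𝒪[K]).mapIntegralClosure x)
  have hρ : Continuous ρ := continuous_pi fun x => continuous_galois_apply x _
  have hemb : Topology.IsClosedEmbedding ρ := hρ.isClosedEmbedding fun σ τ h =>
    hinj σ τ fun x => Ideal.Quotient.eq.1 congr($h x)
  have hP : (Q.under 𝒪[K]).IsMaximal := Ideal.isMaximal_comap_of_isIntegral_of_isMaximal Q
  have := finite_quotient_under (K := K) Q
  have : Algebra.IsAlgebraic (𝒪[K] ⧸ Q.under 𝒪[K]) (A ⧸ Q) := isAlgebraic_quotient_under Q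
  let _ := Ideal.Quotient.field (Q.under 𝒪[K])
  let _ := Ideal.Quotient.field Q
  rw [dense_iff_inter_open]
  rintro U hU ⟨σ, hσ⟩
  obtain ⟨V, hV, rfl⟩ := hemb.isOpen_iff.1 hU
  obtain ⟨s, u, hu, hs⟩ := isOpen_pi_iff.1 hV (ρ σ) hσ
  -- The integral closure is local, so every automorphism preserves its unique maximal ideal.
  have hcomap : Q = Q.comap (σ.restrictScalars 𝒪[K]).mapIntegralClosure := by
    have : (Q.comap (σ.restrictScalars 𝒪[K]).mapIntegralClosure).IsMaximal :=
      Ideal.comap_isMaximal_of_surjective _ (AlgEquiv.surjective _)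
    exact (IsLocalRing.eq_maximalIdeal ‹_›).trans (IsLocalRing.eq_maximalIdeal this).symm
  let τ : (A ⧸ Q) →ₐ[𝒪[K] ⧸ Q.under 𝒪[K]] (A ⧸ Q) :=
    { toRingHom := Ideal.quotientMap Q
        (σ.restrictScalars 𝒪[K]).mapIntegralClosure.toAlgHom.toRingHom hcomap.le
      commutes' := fun x => by
        obtain ⟨x, rfl⟩ := Ideal.Quotient.mk_surjective x
        exact congr_arg (Ideal.Quotient.mk Q)
          ((σ.restrictScalars 𝒪[K]).mapIntegralClosure.toAlgHom.commutes x) }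
  classical
  obtain ⟨n, hn⟩ := exists_pow_card_eq τ (s.image (Ideal.Quotient.mk Q))
  refine ⟨Φ ^ n, hs fun x hx => ?_, ⟨n, zpow_natCast _ _⟩⟩
  have h₁ := hn _ (Finset.mem_image_of_mem _ hx)
  have h₂ : ρ (Φ ^ n) x = ρ σ x := by
    have h₃ := Ideal.Quotient.eq.2 (isArithFrobAt_pow hΦ n x)
    rw [← coe_mapIntegralClosure_pow, map_pow] at h₃
    exact h₃.trans h₁.symm
  rw [h₂]
  exact (hu x hx).2

end Residue

/-! ### Roots of unity in unramified extensions -/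

section RootsOfUnity

open Polynomial

/-- Differentiating `x ^ N = 1` gives `N x ^ (N - 1) dx = 0` with a unit coefficient, so `dx = 0`
and all differentials vanish. -/
theorem formallyUnramified_of_adjoin_eq_top {R B : Type*} [CommRing R] [CommRing B] [Algebra R B]
    {x : B} (h : Algebra.adjoin R {x} = ⊤) {N : ℕ} (hN : IsUnit (N : R)) (hx : x ^ N = 1) :
    Algebra.FormallyUnramified R B := by
  have hN' : IsUnit (N : B) := by simpa using hN.map (algebraMap R B)
  have hN₀ : N ≠ 0 ∨ Subsingleton B := by
    rcases eq_or_ne N 0 with rfl | h₀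
    · refine .inr (subsingleton_of_zero_eq_one ?_)
      rw [Nat.cast_zero] at hN'
      exact isUnit_zero_iff.1 hN'
    · exact .inl h₀
  have hD : KaehlerDifferential.D R B x = 0 := by
    rcases hN₀ with hN₀ | h₀
    · have h₁ := congr_arg (KaehlerDifferential.D R B) hx
      rw [Derivation.leibniz_pow, Derivation.map_one_eq_zero, ← Nat.cast_smul_eq_nsmul B,
        smul_smul] at h₁
      have h₂ : IsUnit ((N : B) * x ^ (N - 1)) := hN'.mul ((IsUnit.of_pow_eq_one hx hN₀).pow _)
      exact h₂.smul_eq_zero.1 h₁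
    · rw [Subsingleton.elim x 0, map_zero]
  have h₁ : KaehlerDifferential.D R B = 0 := by
    refine Derivation.ext fun y => ?_
    exact Derivation.eqOn_adjoin (D1 := KaehlerDifferential.D R B) (D2 := 0) (s := {x})
      (fun y hy => by rw [Set.mem_singleton_iff.1 hy, hD]; rfl)
        (h ▸ Algebra.mem_top : y ∈ Algebra.adjoin R {x})
  rw [Algebra.formallyUnramified_iff]
  rw [← Submodule.subsingleton_iff B, subsingleton_iff_bot_eq_top.symm,
    ← KaehlerDifferential.span_range_derivation, h₁, eq_comm, Submodule.span_eq_bot]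
  rintro _ ⟨y, rfl⟩
  rfl

theorem isUnit_aeval_derivative_minpoly {R B : Type*} [CommRing R] [IsDomain R]
    [IsIntegrallyClosed R] [CommRing B] [IsDomain B] [Algebra R B] [Module.IsTorsionFree R B] {x :
      B}
    {N : ℕ} (hN : IsUnit (N : R)) (hN₀ : N ≠ 0) (hx : x ^ N = 1) :
    IsUnit (aeval x (derivative (minpoly R x))) := by
  have hxi : IsIntegral R x := ⟨X ^ N - 1, monic_X_pow_sub_C 1 hN₀, by simp [hx]⟩
  obtain ⟨g, hg⟩ := minpoly.isIntegrallyClosed_dvd hxi (p := X ^ N - 1) (by simp [hx])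
  have h₁ := congr_arg (fun p => aeval x (derivative p)) hg
  simp only [derivative_mul, map_add, map_mul, minpoly.aeval, zero_mul, add_zero,
    derivative_X_pow, derivative_one, map_sub, sub_zero, map_pow, aeval_X, map_natCast] at h₁
  have hN' : IsUnit (N : B) := by simpa using hN.map (algebraMap R B)
  have h₂ : IsUnit ((N : B) * x ^ (N - 1)) := hN'.mul ((IsUnit.of_pow_eq_one hx hN₀).pow _)
  rw [h₁] at h₂
  exact isUnit_of_mul_isUnit_left h₂

/-- The minimal polynomial `f` of `x` divides `X ^ N - 1`, so `f'(x)` is a unit. Conductor times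
different is the ideal `(f'(x))`, hence the conductor is trivial and `x` generates `B` over `R`. -/
theorem formallyUnramified_of_pow_eq_one {R K L B : Type*} [CommRing R]
    [IsDedekindDomain R] [Field K] [Algebra R K] [IsFractionRing R K] [Field L] [Algebra K L]
    [Algebra R L] [IsScalarTower R K L] [CommRing B] [Algebra R B] [Algebra B L]
    [IsScalarTower R B L] [IsIntegralClosure B R L] [FiniteDimensional K L] [Algebra.IsSeparable K
      L]
    [IsDedekindDomain B] [Module.IsTorsionFree R B]
    {x : B} (hx : Algebra.adjoin K {algebraMap B L x} = ⊤) {N : ℕ} (hN : IsUnit (N : R))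
    (hN₀ : N ≠ 0) (hxN : x ^ N = 1) : Algebra.FormallyUnramified R B := by
  refine formallyUnramified_of_adjoin_eq_top (x := x) ?_ hN hxN
  have h₁ := conductor_mul_differentIdeal R K L x hx
  rw [Ideal.span_singleton_eq_top.2 (isUnit_aeval_derivative_minpoly hN hN₀ hxN)] at h₁
  refine (conductor_eq_top_iff_adjoin_eq_top (R := R) (x := x)).1 (top_le_iff.1 (h₁ ▸ ?_))
  exact Ideal.mul_le_left

end RootsOfUnity

theorem Nat.pow_sub_one_dvd_pow_sub_one_iff {q m n : ℕ} (hq : 2 ≤ q) :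
    q ^ m - 1 ∣ q ^ n - 1 ↔ m ∣ n := by
  rw [← Nat.gcd_eq_left_iff_dvd, Nat.pow_sub_one_gcd_pow_sub_one, ← Nat.gcd_eq_left_iff_dvd]
  constructor
  · intro h
    have h₁ : 0 < q ^ m := by positivity
    have h₂ : 0 < q ^ m.gcd n := by positivity
    exact Nat.pow_right_injective hq (by dsimp only; omega)
  · intro h
    rw [h]

/-! ### The maximal unramified extension, its Frobenius and its roots of unity. -/

section MaximalUnramified

variable {K : Type u} [Field K] [ValuativeRel K] [TopologicalSpace K]
  [IsNonarchimedeanLocalField K] [CharZero K]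
  {Kbar : Type v} [Field Kbar] [Algebra K Kbar] [IsAlgClosure K Kbar]

instance isGalois_maximalUnramified : IsGalois K (maximalUnramified K Kbar) where

omit [TopologicalSpace K] [IsNonarchimedeanLocalField K] [CharZero K] [IsAlgClosure K Kbar] in
theorem IsFiniteUnramified.le {E : IntermediateField K Kbar} (hE : IsFiniteUnramified K Kbar E) :
    E ≤ maximalUnramified K Kbar :=
  le_iSup (fun E : {E : IntermediateField K Kbar // IsFiniteUnramified K Kbar E} => E.1) ⟨E, hE⟩

theorem IsFiniteUnramified.eq_of_sub_mem {E : IntermediateField K Kbar}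
    (hE : IsFiniteUnramified K Kbar E) {L : Type*} [Field L] [Algebra K L]
    {Q : Ideal (integralClosure 𝒪[K] L)} (hQ : Q ≠ ⊤) {f g : E →ₐ[K] L}
    (h : ∀ b, (f.restrictScalars 𝒪[K]).mapIntegralClosure b -
      (g.restrictScalars 𝒪[K]).mapIntegralClosure b ∈ Q) : f = g := by
  have := hE.1
  have := hE.2
  have : Module.Finite 𝒪[K] (integralClosure 𝒪[K] E) :=
    IsIntegralClosure.finite 𝒪[K] K E (integralClosure 𝒪[K] E)
  have := IsIntegralClosure.isFractionRing_of_finite_extension 𝒪[K] K E (integralClosure 𝒪[K] E)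
  have h₁ := AlgHom.ext_of_formallyUnramified hQ h
  ext x
  obtain ⟨a, b, -, rfl⟩ := IsFractionRing.div_surjective (A := integralClosure 𝒪[K] E) x
  have h₂ (a : integralClosure 𝒪[K] E) : f (a : E) = g (a : E) :=
    congr_arg Subtype.val congr($h₁ a)
  rw [map_div₀, map_div₀]
  exact congr_arg₂ _ (h₂ a) (h₂ b)

/-- The equaliser of `σ` and `τ` is a subfield containing every finite unramified extension, by
rigidity of unramified algebras, so it is everything. -/
theorem eq_of_sub_mem {Q : Ideal (integralClosure 𝒪[K] (maximalUnramified K Kbar))} (hQ : Q ≠ ⊤)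
    (σ τ : Gal(maximalUnramified K Kbar/K))
    (h : ∀ x, (σ.restrictScalars 𝒪[K]).mapIntegralClosure x -
      (τ.restrictScalars 𝒪[K]).mapIntegralClosure x ∈ Q) : σ = τ := by
  let D : IntermediateField K (maximalUnramified K Kbar) :=
    (AlgHom.equalizer (σ : maximalUnramified K Kbar →ₐ[K] maximalUnramified K Kbar)
      (τ : maximalUnramified K Kbar →ₐ[K] maximalUnramified K Kbar)).toIntermediateField
        fun x hx => by
        rw [AlgHom.mem_equalizer] at hx ⊢
        rw [map_inv₀, map_inv₀, hx]
  have hD : maximalUnramified K Kbar ≤ IntermediateField.lift D := by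
    refine iSup_le fun E x hx => ?_
    have hE := E.2.le
    refine (IntermediateField.mem_lift (⟨x, hE hx⟩ : maximalUnramified K Kbar)).2 ?_
    have h₁ := E.2.eq_of_sub_mem hQ
      (f := (σ : maximalUnramified K Kbar →ₐ[K] maximalUnramified K Kbar).comp
        (IntermediateField.inclusion hE))
      (g := (τ : maximalUnramified K Kbar →ₐ[K] maximalUnramified K Kbar).comp
        (IntermediateField.inclusion hE))
      fun b => h (((IntermediateField.inclusion hE).restrictScalars 𝒪[K]).mapIntegralClosure b)
    exact congr($h₁ ⟨x, hx⟩)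
  ext x
  exact congr_arg Subtype.val ((IntermediateField.mem_lift x).1 (hD x.2))

theorem exists_isUnramifiedFrobenius :
    ∃ Φ : Gal(maximalUnramified K Kbar/K), IsUnramifiedFrobenius Φ := by
  obtain ⟨Φ, hΦ⟩ := exists_isArithFrobAt (K := K)
    (IsLocalRing.maximalIdeal (integralClosure 𝒪[K] (maximalUnramified K Kbar)))
  exact ⟨Φ, fun Q hQ => by rwa [IsLocalRing.eq_maximalIdeal hQ]⟩

theorem IsUnramifiedFrobenius.unique {Φ Ψ : Gal(maximalUnramified K Kbar/K)}
    (hΦ : IsUnramifiedFrobenius Φ) (hΨ : IsUnramifiedFrobenius Ψ) : Φ = Ψ := by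
  let Q := IsLocalRing.maximalIdeal (integralClosure 𝒪[K] (maximalUnramified K Kbar))
  refine eq_of_sub_mem (Ideal.IsMaximal.ne_top inferInstance : Q ≠ ⊤) Φ Ψ fun x => ?_
  rw [← sub_sub_sub_cancel_right]
  exact Q.sub_mem (hΦ Q inferInstance x) (hΨ Q inferInstance x)

theorem IsUnramifiedFrobenius.frobeniusPowers_eq {Φ : Gal(maximalUnramified K Kbar/K)}
    (hΦ : IsUnramifiedFrobenius Φ) : frobeniusPowers K Kbar = Subgroup.zpowers Φ := by
  rw [frobeniusPowers, Subgroup.zpowers_eq_closure]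
  congr 1
  ext Ψ
  exact ⟨fun h => h.unique hΦ, fun h => (Set.mem_singleton_iff.1 h) ▸ hΦ⟩

theorem IsUnramifiedFrobenius.dense_zpowers {Φ : Gal(maximalUnramified K Kbar/K)}
    (hΦ : IsUnramifiedFrobenius Φ) :
    Dense (Subgroup.zpowers Φ : Set Gal(maximalUnramified K Kbar/K)) :=
  dense_zpowers_of_isArithFrobAt (IsLocalRing.maximalIdeal _) (hΦ _ inferInstance)
    (eq_of_sub_mem (Ideal.IsMaximal.ne_top inferInstance))

omit [CharZero K] in
theorem isUnit_natCast_card_pow_sub_one {m : ℕ} (hm : m ≠ 0) :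
    IsUnit ((Nat.card 𝓀[K] ^ m - 1 : ℕ) : 𝒪[K]) := by
  have h : ((Nat.card 𝓀[K] : ℕ) : 𝓀[K]) = 0 := by
    have := Fintype.ofFinite 𝓀[K]
    rw [Nat.card_eq_fintype_card]
    exact FiniteField.cast_card_eq_zero _
  refine (IsLocalRing.residue_ne_zero_iff_isUnit _).1 ?_
  rw [map_natCast, Nat.cast_sub (Nat.one_le_pow _ _ Nat.card_pos), Nat.cast_pow, h, zero_pow hm]
  simp

theorem isFiniteUnramified_adjoin {ζ : Kbar} {N : ℕ} (hN : IsUnit (N : 𝒪[K])) (hζ : ζ ^ N = 1)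
    (hN₀ : N ≠ 0) :
    IsFiniteUnramified K Kbar (IntermediateField.adjoin K {ζ}) := by
  have hζi : IsIntegral K ζ := Algebra.IsIntegral.isIntegral ζ
  have := IntermediateField.adjoin.finiteDimensional hζi
  refine ⟨this, ?_⟩
  let E := IntermediateField.adjoin K {ζ}
  let z : E := IntermediateField.AdjoinSimple.gen K ζ
  have hz : z ^ N = 1 := Subtype.ext hζ
  have hzi : IsIntegral 𝒪[K] z := IsIntegral.of_pow (Nat.pos_of_ne_zero hN₀) (hz ▸ isIntegral_one)
  have := IsIntegralClosure.isDedekindDomain 𝒪[K] K E (integralClosure 𝒪[K] E)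
  have : Module.IsTorsionFree 𝒪[K] (integralClosure 𝒪[K] E) :=
    Module.isTorsionFree_iff_faithfulSMul.2 <| (faithfulSMul_iff_algebraMap_injective _ _).2
      fun a b h => Subtype.ext ((algebraMap K E).injective congr($h.1))
  refine formallyUnramified_of_pow_eq_one (K := K) (L := E) (x := ⟨z, hzi⟩) ?_ hN hN₀
    (Subtype.ext hz)
  exact (IntermediateField.adjoin.powerBasis hζi).adjoin_gen_eq_top

/-- Take the stabiliser of a primitive root of unity `z` of order `q ^ m - 1`, which lies in the
maximal unramified extension. Since `Φ ^ n` sends `z` to `z ^ (q ^ n)`, it fixes `z` exactly when `q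
^ m - 1 ∣ q ^ n - 1`, that is, when `m ∣ n`. -/
theorem IsUnramifiedFrobenius.exists_isOpen {Φ : Gal(maximalUnramified K Kbar/K)}
    (hΦ : IsUnramifiedFrobenius Φ) {m : ℕ} (hm : m ≠ 0) :
    ∃ U : Subgroup Gal(maximalUnramified K Kbar/K), IsOpen (U : Set Gal(maximalUnramified K
      Kbar/K)) ∧
      ∀ k : ℤ, Φ ^ k ∈ U ↔ (m : ℤ) ∣ k := by
  let Q := IsLocalRing.maximalIdeal (integralClosure 𝒪[K] (maximalUnramified K Kbar))
  have hq : 2 ≤ Nat.card 𝓀[K] := Finite.one_lt_card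
  have hN₀ : Nat.card 𝓀[K] ^ m - 1 ≠ 0 := by
    have := Nat.one_lt_pow hm hq
    omega
  set N := Nat.card 𝓀[K] ^ m - 1 with hN
  have hNu : IsUnit (N : 𝒪[K]) := isUnit_natCast_card_pow_sub_one hm
  have : IsAlgClosed Kbar := IsAlgClosure.isAlgClosed K
  have : CharZero Kbar := charZero_of_injective_algebraMap (algebraMap K Kbar).injective
  have : NeZero (N : Kbar) := ⟨Nat.cast_ne_zero.2 hN₀⟩
  obtain ⟨ζ, hζ⟩ := HasEnoughRootsOfUnity.exists_primitiveRoot Kbar N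
  have hE := isFiniteUnramified_adjoin hNu hζ.pow_eq_one hN₀
  let z : maximalUnramified K Kbar := ⟨ζ, hE.le (IntermediateField.mem_adjoin_simple_self K ζ)⟩
  have hz : IsPrimitiveRoot z N := IsPrimitiveRoot.of_map_of_injective
    (f := (maximalUnramified K Kbar).val) hζ (RingHom.injective _)
  have hzi : IsIntegral 𝒪[K] z :=
    IsIntegral.of_pow (Nat.pos_of_ne_zero hN₀) (hz.pow_eq_one ▸ isIntegral_one)
  -- The order being prime to the residue characteristic, the Frobenius congruence modulo `Q`
  -- becomes an equality on `z`.
  have hNQ : ((N : ℕ) : integralClosure 𝒪[K] (maximalUnramified K Kbar)) ∉ Q := fun h => by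
    refine (IsLocalRing.mem_maximalIdeal _).1 h ?_
    simpa using hNu.map (algebraMap 𝒪[K] (integralClosure 𝒪[K] (maximalUnramified K Kbar)))
  have hcard : Nat.card (𝒪[K] ⧸ Q.under 𝒪[K]) = Nat.card 𝓀[K] := by
    have : (Q.under 𝒪[K]).IsMaximal := Ideal.isMaximal_comap_of_isIntegral_of_isMaximal Q
    rw [IsLocalRing.eq_maximalIdeal this]
    rfl
  have h₁ : Φ z = z ^ Nat.card 𝓀[K] := by
    have := (hΦ Q inferInstance).apply_of_pow_eq_one (ζ := ⟨z, hzi⟩) (Subtype.ext hz.pow_eq_one) hNQ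
    rw [hcard] at this
    exact congr_arg Subtype.val this
  have h₂ (n : ℕ) : (Φ ^ n) z = z ^ Nat.card 𝓀[K] ^ n := by
    induction n with
    | zero => simp
    | succ n ih => rw [pow_succ, AlgEquiv.mul_apply, h₁, map_pow, ih, ← pow_mul, pow_succ]
  refine ⟨MulAction.stabilizer _ z, stabilizer_isOpen_of_isIntegral z, ?_⟩
  have h₃ (n : ℕ) : Φ ^ n ∈ MulAction.stabilizer Gal(maximalUnramified K Kbar/K) z ↔ m ∣ n := by
    rw [MulAction.mem_stabilizer_iff, AlgEquiv.smul_def, h₂, ← Nat.pow_sub_one_dvd_pow_sub_one_iff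
      hq,
      ← hN, ← hz.pow_eq_one_iff_dvd]
    have hz₀ : z ≠ 0 := hz.ne_zero hN₀
    conv_lhs => rw [← Nat.sub_add_cancel (Nat.one_le_pow n _ Nat.card_pos), pow_succ]
    exact mul_eq_right₀ hz₀
  intro k
  obtain ⟨n, rfl | rfl⟩ := k.eq_nat_or_neg
  · rw [zpow_natCast, h₃, Int.natCast_dvd_natCast]
  · rw [zpow_neg, inv_mem_iff, zpow_natCast, h₃, dvd_neg, Int.natCast_dvd_natCast]

end MaximalUnramified

/-! ### The degree datum of a local field -/

section LocalField

variable (K : Type u) [Field K] [ValuativeRel K] [TopologicalSpace K]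
  [IsNonarchimedeanLocalField K] [CharZero K]
  (Kbar : Type v) [Field Kbar] [Algebra K Kbar] [IsAlgClosure K Kbar]

theorem exists_degreeDatum_toGalCont :
    ∃ D : DegreeDatum Gal(Kbar/K) (WeilGroup K Kbar), D.toGroup = WeilGroup.toGalCont K Kbar := by
  have : Normal K Kbar := IsAlgClosure.normal K Kbar
  have : IsGalois K Kbar := { }
  obtain ⟨Φ, hΦ⟩ := exists_isUnramifiedFrobenius (K := K) (Kbar := Kbar)
  refine exists_degreeDatum
    (pr := ⟨galToUnramified K Kbar, InfiniteGalois.restrictNormalHom_continuous _⟩)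
    (AlgEquiv.restrictNormalHom_surjective Kbar) (Φ := Φ) hΦ.dense_zpowers
    (fun m hm => hΦ.exists_isOpen hm) (WeilGroup.toGalCont K Kbar)
    Subtype.val_injective (fun g => ?_) (WeilGroup.toFrobeniusPowers K Kbar) Subtype.val
    Subtype.val_injective (fun w => rfl) rfl
  rw [← hΦ.frobeniusPowers_eq]
  exact ⟨fun ⟨w, hw⟩ => hw ▸ w.2, fun h => ⟨⟨g, h⟩, rfl⟩⟩

end LocalField

namespace DegreeDatum

variable {G W : Type v} [Group G] [TopologicalSpace G] [IsTopologicalGroup G] [CompactSpace G]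
  [Group W] [TopologicalSpace W] [IsTopologicalGroup W]

theorem res_comparison (D : DegreeDatum G W) {φ : W →ₜ* G} (hD : D.toGroup = φ) :
    (∀ M : TopRep.{max v w} ℤ G, IsDiscreteModule.{v, w} M →
      Function.Bijective (Coh.res.{v, w} φ 0 M)) ∧
    (∀ M : TopRep.{max v w} ℤ G, IsDiscreteModule.{v, w} M →
      Function.Injective (Coh.res.{v, w} φ 1 M) ∧
      (Coh.res.{v, w} φ 1 M).range = AddCommGroup.torsion
        (Coh.{v, w} 1 ((TopRep.resFunctor.{0, v, v, max v w} (φ : W →* G)).obj M))) ∧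
    (∃ δ : ∀ M : TopRep.{max v w} ℤ G, IsDiscreteModule.{v, w} M →
        (Coh.{v, w} 1 ((TopRep.resFunctor.{0, v, v, max v w} (φ : W →* G)).obj M) ⊗[ℤ] AddCircle
          (1 : ℚ) →+
          Coh.{v, w} 2 M),
      (∀ (M N : TopRep.{max v w} ℤ G) (f : M ⟶ N)
        (hM : IsDiscreteModule.{v, w} M) (hN : IsDiscreteModule.{v, w} N)
        (x : Coh.{v, w} 1 ((TopRep.resFunctor.{0, v, v, max v w} (φ : W →* G)).obj M) ⊗[ℤ]
          AddCircle (1 : ℚ)),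
          Coh.map.{v, w} 2 f (δ M hM x) =
            δ N hN ((Coh.map.{v, w} 1
              ((TopRep.resFunctor.{0, v, v, max v w} (φ : W →* G)).map f)).toIntLinearMap.rTensor _
                x)) ∧
      ∀ (M : TopRep.{max v w} ℤ G) (hM : IsDiscreteModule.{v, w} M),
        Function.Injective (δ M hM) ∧
        Function.Exact (δ M hM) (Coh.res.{v, w} φ 2 M) ∧
        Function.Surjective (Coh.res.{v, w} φ 2 M)) ∧
    (∀ M : TopRep.{max v w} ℤ G, IsDiscreteModule.{v, w} M → ∀ i : ℕ, 3 ≤ i →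
      Function.Bijective (Coh.res.{v, w} φ i M)) := by
  subst hD
  have := D.locallyCompactSpace
  exact ⟨fun M hM => D.res_zero_bijective hM,
    fun M hM => ⟨D.res_one_injective hM, D.range_res_one hM⟩,
    ⟨fun M hM => D.tensorδ hM, fun M N f hM hN x => D.map_tensorδ hM hN f x,
      fun M hM => ⟨D.tensorδ_injective hM, D.exact_tensorδ hM, D.res_two_surjective hM⟩⟩,
    fun M hM i hi => D.res_bijective hM hi⟩

end DegreeDatum

end

theorem mainTheorem5 (K : Type u) [Field K] [ValuativeRel K] [TopologicalSpace K]
    [IsNonarchimedeanLocalField K] [CharZero K]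
    (Kbar : Type v) [Field Kbar] [Algebra K Kbar] [IsAlgClosure K Kbar] :
    -- the restriction homomorphisms are functorial in the module
    (∀ (n : ℕ) (M N : TopRep.{max v w} ℤ Gal(Kbar/K)) (f : M ⟶ N),
      IsDiscreteModule.{v, w} M → IsDiscreteModule.{v, w} N → ∀ x : Coh.{v, w} n M,
        galoisToWeil.{u, v, w} K Kbar n N (Coh.map.{v, w} n f x) =
          Coh.map.{v, w} n ((weilRes.{u, v, w} K Kbar).map f)
            (galoisToWeil.{u, v, w} K Kbar n M x)) ∧
    -- `H^0(G, M) = H^0(W, M)`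
    (∀ M : TopRep.{max v w} ℤ Gal(Kbar/K), IsDiscreteModule.{v, w} M →
      Function.Bijective (galoisToWeil.{u, v, w} K Kbar 0 M)) ∧
    -- `H^1(G, M) = H^1(W, M)_tors`
    (∀ M : TopRep.{max v w} ℤ Gal(Kbar/K), IsDiscreteModule.{v, w} M →
      Function.Injective (galoisToWeil.{u, v, w} K Kbar 1 M) ∧
      (galoisToWeil.{u, v, w} K Kbar 1 M).range =
        AddCommGroup.torsion (Coh.{v, w} 1 ((weilRes.{u, v, w} K Kbar).obj M))) ∧
    -- functorial exact sequence `0 → H^1(W, M) ⊗ ℚ/ℤ → H^2(G, M) → H^2(W, M) → 0`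
    (∃ δ : ∀ M : TopRep.{max v w} ℤ Gal(Kbar/K), IsDiscreteModule.{v, w} M →
        (Coh.{v, w} 1 ((weilRes.{u, v, w} K Kbar).obj M) ⊗[ℤ] AddCircle (1 : ℚ) →+
          Coh.{v, w} 2 M),
      (∀ (M N : TopRep.{max v w} ℤ Gal(Kbar/K)) (f : M ⟶ N)
        (hM : IsDiscreteModule.{v, w} M) (hN : IsDiscreteModule.{v, w} N)
        (x : Coh.{v, w} 1 ((weilRes.{u, v, w} K Kbar).obj M) ⊗[ℤ] AddCircle (1 : ℚ)),
          Coh.map.{v, w} 2 f (δ M hM x) =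
            δ N hN ((Coh.map.{v, w} 1
              ((weilRes.{u, v, w} K Kbar).map f)).toIntLinearMap.rTensor _ x)) ∧
      ∀ (M : TopRep.{max v w} ℤ Gal(Kbar/K)) (hM : IsDiscreteModule.{v, w} M),
        Function.Injective (δ M hM) ∧
        Function.Exact (δ M hM) (galoisToWeil.{u, v, w} K Kbar 2 M) ∧
        Function.Surjective (galoisToWeil.{u, v, w} K Kbar 2 M)) ∧
    -- `H^i(G, M) = H^i(W, M)` for `i ≥ 3`
    (∀ M : TopRep.{max v w} ℤ Gal(Kbar/K), IsDiscreteModule.{v, w} M → ∀ i : ℕ, 3 ≤ i →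
      Function.Bijective (galoisToWeil.{u, v, w} K Kbar i M)) := by
  have : Normal K Kbar := IsAlgClosure.normal K Kbar
  have : IsGalois K Kbar := { }
  obtain ⟨D, hD⟩ := exists_degreeDatum_toGalCont K Kbar
  exact ⟨fun n M N f _ _ x => Coh.res_map (WeilGroup.toGalCont K Kbar) f n x,
    D.res_comparison hD⟩
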